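/- Let $\mathcal E$ be a Grothendieck topos, the topos of sheaves of sets on a small site, let $\gamma^*\colon \mathcal{S}et\to\mathcal E$ be the constant sheaf functor, and let $\zeta\colon U\to\gamma^*I$ be a cover: a family with non-empty components $U_i$ ($i\in I$) such that $U\to 1$ is an epimorphism. Let $R=\{R_i\}_{i\in I}$ be a family of sets. *Definitions.* A simplicial family is a morphism $\zeta_\bullet\colon H_\bullet\to\gamma^*S_\bullet$ of simplicial objects of $\mathcal E$, with $S_\bullet$ a simplicial set, all of whose components $(H_n)_w$ ($w\in S_n$) are non-empty. The Čech simplicial family $U_\bullet\to\gamma^*N_\bullet$ has $U_n=U^{n+1}$ and $N_n=\{(i_0,\dots,i_n)\mid U_{i_0}\times\dots\times U_{i_n}\neq\emptyset\}$. A simplicial family is self-dual if it is equipped with isomorphisms $\tau_n$ of $H_n$ and of $S_n$, compatible with $\zeta_n$, with $\tau_0=\mathrm{id}$, that reverse the order of faces and degeneracies; one writes $\ell^{op}=\tau_1(\ell)$ and $(\tau_1)_\ell\colon (H_1)_\ell\cong (H_1)_{\ell^{op}}$. A self-dual simplicial hypercover refinement of the Čech simplicial family is a self-dual simplicial family with a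 morphism $(h_\bullet,\alpha_\bullet)$ of simplicial families to the Čech simplicial family that identifies $S_0=I$ and $H_0=U$, such that $H_k\to(\mathrm{cosk}_{k-1}H_\bullet)_k$ is an epimorphism for all $k\ge 1$. For $\ell\in S_1$ write $i\xrightarrow{\ell}j$ if $i=\partial_1\ell$, $j=\partial_0\ell$; it gives the span $(H_0)_i\xleftarrow{d_1}(H_1)_\ell\xrightarrow{d_0}(H_0)_j$. Condition G: for all $i\xrightarrow{\ell}j$ there is $w\in S_2$ with $\partial_2w=\ell$, $\partial_0w=\ell^{op}$ and $(d_1)_{\partial_1w}=(d_0)_{\partial_1w}$. An $S_\bullet$-descent datum on $R$ consists of bijections $s_\ell\colon R_i\to R_j$ for $i\xrightarrow{\ell}j$ with $s_{\sigma_0(i)}=\mathrm{id}$ and $s_{\partial_1w}=s_{\partial_0w}\circ s_{\partial_2w}$ for $w\in S_2$; it is consistent if $s_\ell=s_t$ whenever $\ell,t\colon i\to j$ and there is a morphism of spans $(H_1)_\ell\to(H_1)_t$ over $(H_0)_i$ and $(H_0)_j$. An $H_\bullet$-descent datum on $R$ consists of isomorphisms $\sigma_\ell\colon\gamma^*R_i\times(H_1)_\ell\to\gamma^*R_j\times(H_1)_{\ell^{op}}$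 over $(\tau_1)_\ell$ that satisfy the corresponding identity and cocycle conditions over $(H_0)_i$ and $(H_2)_w$. A trivialization $\theta$ of an object $X$ by the cover, with family of sets $R$, consists of isomorphisms $\theta_i\colon\gamma^*R_i\times U_i\to X\times U_i$ over $U_i$, $i\in I$. Its Čech descent datum is given by the isomorphisms $\sigma_{j,i}\colon\gamma^*R_i\times U_i\times U_j\to\gamma^*R_j\times U_j\times U_i$ with $(\theta_j\times U_i)\circ\sigma_{j,i}=(X\times\tau)\circ(\theta_i\times U_j)$, where $\tau$ is the symmetry $U_i\times U_j\cong U_j\times U_i$. An action span is a span $U_i\xleftarrow{u}V\xrightarrow{v}U_j$ with $V\ne\emptyset$ for which there is a bijection $s\colon R_i\to R_j$ with $\sigma_{j,i}\circ(\gamma^*R_i\times(u,v))=(\gamma^*R_j\times(v,u))\circ(\gamma^*s\times V)$. The pair $(X,\theta)$ is a covering projection if for all $(i,j)\in N_1$ the maps $(u,v)\colon V\to U_i\times U_j$, over all action spans, form an epimorphic family. With $(h_1)_\ell=((d_1)_\ell,(d_0)_\ell)\colon(H_1)_\ell\to U_i\times U_j$, the $H_\bullet$-descent datum $\{\sigma_\ell\}$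 corresponds to $(X,\theta)$ if $\sigma_{j,i}\circ(\gamma^*R_i\times(h_1)_\ell)=(\gamma^*R_j\times(h_1)_{\ell^{op}})\circ\sigma_\ell$ for all $i\xrightarrow{\ell}j$. **Theorem.** (1) Let $(X,\theta)$ be a covering projection trivialized by $U\to\gamma^*I$, with family of sets $R$. Then there exist a self-dual simplicial hypercover refinement $H_\bullet\to\gamma^*S_\bullet$ of the Čech simplicial family, with $\tau\circ\tau=\mathrm{id}$, that satisfies condition G, and a consistent $S_\bullet$-descent datum $\{s_\ell\}_{\ell\in S_1}$ on $R$ such that the $H_\bullet$-descent datum corresponding to $(X,\theta)$ is $\sigma_\ell=\gamma^*(s_\ell)\times(\tau_1)_\ell$. (2) Conversely, let $H_\bullet\to\gamma^*S_\bullet$ be any self-dual simplicial hypercover refinement of the Čech simplicial family and $\{s_\ell\}$ a consistent $S_\bullet$-descent datum on $R$. Then there is a covering projection $(X,\theta)$ trivialized by $U\to\gamma^*I$, with family of sets $R$, to which the $H_\bullet$-descent datum $\gamma^*(s_\ell)\times(\tau_1)_\ell$ corresponds; and for any two pairs $(X,\theta)$, $(X',\theta')$ to which it corresponds there is a unique isomorphism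 $e\colon X\cong X'$ with $(e\times U_i)\circ\theta_i=\theta'_i$ for all $i\in I$. -/

import Mathlib

open CategoryTheory Limits Opposite Simplicial

universe u

namespace CoveringProj

noncomputable section

variable {C : Type u} [SmallCategory C] {J : GrothendieckTopology C}

/-! ### Families in a topos

The topos is `Sheaf J (Type u)` for a small site `(C, J)`. -/

/-- The inverse image functor `γ^*` from sets to the topos. -/
abbrev γ (J : GrothendieckTopology C) : Type u ⥤ Sheaf J (Type u) := constantSheaf J (Type u)

/-- The object `X` is empty, that is, an initial object of the topos. -/
def IsEmptyObj (X : Sheaf J (Type u)) : Prop := Nonempty (IsInitial X)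

instance : PreservesFiniteLimits (γ J) :=
  inferInstanceAs (PreservesFiniteLimits (Functor.const Cᵒᵖ ⋙ presheafToSheaf J (Type u)))

/-- The component `H_s` of a family `ζ : H ⟶ γ^* S`: the pullback of `ζ` along
`γ^* s : γ^* 1 ⟶ γ^* S`. -/
def component {H : Sheaf J (Type u)} {S : Type u} (ζ : H ⟶ (γ J).obj S) (s : S) :
    Sheaf J (Type u) :=
  pullback ζ ((γ J).map (↾ fun _ : PUnit.{u + 1} => s))

/-- The inclusion of the component in `H`. -/
def componentι {H : Sheaf J (Type u)} {S : Type u} (ζ : H ⟶ (γ J).obj S) (s : S) :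
    component ζ s ⟶ H :=
  pullback.fst _ _

/-- The map from the component to the terminal object `γ^* 1`. -/
def componentPt {H : Sheaf J (Type u)} {S : Type u} (ζ : H ⟶ (γ J).obj S) (s : S) :
    component ζ s ⟶ (γ J).obj PUnit.{u + 1} :=
  pullback.snd _ _

theorem component_condition {H : Sheaf J (Type u)} {S : Type u} (ζ : H ⟶ (γ J).obj S) (s : S) :
    componentι ζ s ≫ ζ = componentPt ζ s ≫ (γ J).map (↾ fun _ : PUnit.{u + 1} => s) :=
  pullback.condition

/-- The map `h_s : H_s ⟶ H'_{a s}` induced by a morphism of families `(h, a)`. The index of the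
target is any `s'` with `a s = s'`. -/
def componentMap {H H' : Sheaf J (Type u)} {S S' : Type u} (ζ : H ⟶ (γ J).obj S)
    (ζ' : H' ⟶ (γ J).obj S') (h : H ⟶ H') (a : S ⟶ S') (comm : h ≫ ζ' = ζ ≫ (γ J).map a)
    (s : S) (s' : S') (hs : a s = s') : component ζ s ⟶ component ζ' s' :=
  pullback.map _ _ _ _ h (𝟙 _) ((γ J).map a) comm.symm (by
    subst hs
    rw [← Functor.map_comp, Category.id_comp]
    rfl)

theorem componentMap_fst {H H' : Sheaf J (Type u)} {S S' : Type u} (ζ : H ⟶ (γ J).obj S)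
    (ζ' : H' ⟶ (γ J).obj S') (h : H ⟶ H') (a : S ⟶ S') (comm : h ≫ ζ' = ζ ≫ (γ J).map a)
    (s : S) (s' : S') (hs : a s = s') :
    componentMap ζ ζ' h a comm s s' hs ≫ componentι ζ' s' = componentι ζ s ≫ h :=
  pullback.lift_fst _ _ _

theorem component_hom_ext {T H : Sheaf J (Type u)} {S : Type u} {ζ : H ⟶ (γ J).obj S} {s : S}
    (f g : T ⟶ component ζ s) (h : f ≫ componentι ζ s = g ≫ componentι ζ s) : f = g :=
  pullback.hom_ext h ((Types.isTerminalPUnit.isTerminalObj (γ J) _).hom_ext _ _)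

theorem componentMap_comp_eq_id {H H' : Sheaf J (Type u)} {S S' : Type u} {ζ : H ⟶ (γ J).obj S}
    {ζ' : H' ⟶ (γ J).obj S'} {h : H ⟶ H'} {h' : H' ⟶ H} {a : S ⟶ S'} {a' : S' ⟶ S}
    (comm : h ≫ ζ' = ζ ≫ (γ J).map a) (comm' : h' ≫ ζ = ζ' ≫ (γ J).map a')
    (e : h ≫ h' = 𝟙 H) {s : S} {s' : S'} {hs : a s = s'} {hs' : a' s' = s} :
    componentMap ζ ζ' h a comm s s' hs ≫ componentMap ζ' ζ h' a' comm' s' s hs' = 𝟙 _ :=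
  component_hom_ext _ _ (by
    rw [Category.assoc, componentMap_fst, ← Category.assoc, componentMap_fst, Category.assoc, e,
      Category.comp_id, Category.id_comp])

/-- An isomorphism of families induces isomorphisms of the components. -/
def componentIso {H H' : Sheaf J (Type u)} {S S' : Type u} (ζ : H ⟶ (γ J).obj S)
    (ζ' : H' ⟶ (γ J).obj S') (h : H ≅ H') (a : S ≅ S')
    (comm : h.hom ≫ ζ' = ζ ≫ (γ J).map a.hom) (s : S) (s' : S') (hs : a.hom s = s') :
    component ζ s ≅ component ζ' s' where
  hom := componentMap ζ ζ' h.hom a.hom comm s s' hs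
  inv := componentMap ζ' ζ h.inv a.inv
    (by rw [Iso.inv_comp_eq, ← Category.assoc, comm, Category.assoc, ← Functor.map_comp,
      a.hom_inv_id, CategoryTheory.Functor.map_id, Category.comp_id]) s' s
    (by subst hs; exact ConcreteCategory.congr_hom a.hom_inv_id s)
  hom_inv_id := componentMap_comp_eq_id _ _ h.hom_inv_id
  inv_hom_id := componentMap_comp_eq_id _ _ h.inv_hom_id

/-! ### Simplicial families -/

/-- A simplicial family: a morphism `ζ : H ⟶ γ^* S` of simplicial objects, where `S` is a
simplicial set, such that all the components `(H_n)_w` are non-empty. -/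
structure SimplicialFamily (J : GrothendieckTopology C) where
  S : SSet.{u}
  H : SimplicialObject (Sheaf J (Type u))
  ζ : H ⟶ ((SimplicialObject.whiskering _ _).obj (γ J)).obj S
  nonempty (n : SimplexCategoryᵒᵖ) (w : S.obj n) : ¬ IsEmptyObj (component (ζ.app n) w)

namespace SimplicialFamily

/-- A morphism of simplicial families; also called a refinement of `Y`. -/
structure Hom (X Y : SimplicialFamily J) where
  α : X.S ⟶ Y.S
  h : X.H ⟶ Y.H
  comm : h ≫ Y.ζ = X.ζ ≫ ((SimplicialObject.whiskering _ _).obj (γ J)).map α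

variable (X : SimplicialFamily J)

/-- The component `(H_0)_i`. -/
def vert (i : X.S _⦋0⦌) : Sheaf J (Type u) := component (X.ζ.app (op ⦋0⦌)) i

/-- The component `(H_1)_ℓ`, for a 1-simplex `ℓ : i → j`. -/
def arr {i j : X.S _⦋0⦌} (ℓ : SSet.Edge i j) : Sheaf J (Type u) :=
  component (X.ζ.app (op ⦋1⦌)) ℓ.edge

/-- The component `(H_2)_w`, for a 2-simplex `w` with `∂₂ w = ℓ`, `∂₀ w = r`, `∂₁ w = t`. -/
def tri {i j k : X.S _⦋0⦌} {ℓ : SSet.Edge i j} {r : SSet.Edge j k} {t : SSet.Edge i k}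
    (w : SSet.Edge.CompStruct ℓ r t) : Sheaf J (Type u) :=
  component (X.ζ.app (op ⦋2⦌)) w.simplex

/-- The face operator on components, `(H_{n+1})_w ⟶ (H_n)_v` where `v = ∂_a w`. -/
def face {n : ℕ} (a : Fin (n + 2)) (w : X.S _⦋n + 1⦌) (v : X.S _⦋n⦌) (h : X.S.δ a w = v) :
    component (X.ζ.app (op ⦋n + 1⦌)) w ⟶ component (X.ζ.app (op ⦋n⦌)) v :=
  componentMap _ _ (X.H.δ a) (X.S.δ a) (X.ζ.naturality _) w v h

/-- The degeneracy operator on components, `(H_n)_v ⟶ (H_{n+1})_w` where `w = σ_a v`. -/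
def degen {n : ℕ} (a : Fin (n + 1)) (v : X.S _⦋n⦌) (w : X.S _⦋n + 1⦌) (h : X.S.σ a v = w) :
    component (X.ζ.app (op ⦋n⦌)) v ⟶ component (X.ζ.app (op ⦋n + 1⦌)) w :=
  componentMap _ _ (X.H.σ a) (X.S.σ a) (X.ζ.naturality _) v w h

section

variable {i j k : X.S _⦋0⦌}

/-- The left leg `(d_1)_ℓ` of the span of `ℓ : i → j`. -/
def d₁ (ℓ : SSet.Edge i j) : X.arr ℓ ⟶ X.vert i := X.face 1 ℓ.edge i ℓ.src_eq

/-- The right leg `(d_0)_ℓ` of the span of `ℓ : i → j`. -/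
def d₀ (ℓ : SSet.Edge i j) : X.arr ℓ ⟶ X.vert j := X.face 0 ℓ.edge j ℓ.tgt_eq

/-- The degeneracy `(s_0)_i : (H_0)_i ⟶ (H_1)_{σ_0 i}`. -/
def s₀ (i : X.S _⦋0⦌) : X.vert i ⟶ X.arr (SSet.Edge.id i) := X.degen 0 i _ rfl

variable {ℓ : SSet.Edge i j} {r : SSet.Edge j k} {t : SSet.Edge i k}
  (w : SSet.Edge.CompStruct ℓ r t)

/-- `(d_2)_w : (H_2)_w ⟶ (H_1)_ℓ`. -/
def face₂ : X.tri w ⟶ X.arr ℓ := X.face 2 _ _ w.d₂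

/-- `(d_1)_w : (H_2)_w ⟶ (H_1)_t`. -/
def face₁ : X.tri w ⟶ X.arr t := X.face 1 _ _ w.d₁

/-- `(d_0)_w : (H_2)_w ⟶ (H_1)_r`. -/
def face₀ : X.tri w ⟶ X.arr r := X.face 0 _ _ w.d₀

end

end SimplicialFamily

/-- A strict duality on a simplicial object: a contravariant simplicial isomorphism `τ` to
itself, with `τ_0 = id`. -/
structure StrictDuality {D : Type*} [Category* D] (X : SimplicialObject D) where
  τ (n : ℕ) : X _⦋n⦌ ≅ X _⦋n⦌
  τ_δ (n : ℕ) (a : Fin (n + 2)) : (τ (n + 1)).hom ≫ X.δ a = X.δ a.rev ≫ (τ n).hom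
  τ_σ (n : ℕ) (a : Fin (n + 1)) : (τ n).hom ≫ X.σ a = X.σ a.rev ≫ (τ (n + 1)).hom
  τ_zero : τ 0 = Iso.refl _

/-- A self-dual simplicial family. -/
structure SelfDualFamily (J : GrothendieckTopology C) extends SimplicialFamily J where
  dualS : StrictDuality S
  dualH : StrictDuality H
  τ_ζ (n : ℕ) : (dualH.τ n).hom ≫ ζ.app (op ⦋n⦌) =
    ζ.app (op ⦋n⦌) ≫ (γ J).map (dualS.τ n).hom

namespace SelfDualFamily

variable (X : SelfDualFamily J)

/-- Both dualities are involutions. -/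
def IsInvolutive : Prop :=
  ∀ n : ℕ, (X.dualS.τ n).hom ≫ (X.dualS.τ n).hom = 𝟙 _ ∧
    (X.dualH.τ n).hom ≫ (X.dualH.τ n).hom = 𝟙 _

section

variable {i j : X.S _⦋0⦌}

/-- The opposite 1-simplex `ℓ^op = τ_1 ℓ : j → i` of `ℓ : i → j`. -/
def opp (ℓ : SSet.Edge i j) : SSet.Edge j i :=
  SSet.Edge.mk ((X.dualS.τ 1).hom ℓ.edge)
    (by
      have h := ConcreteCategory.congr_hom (X.dualS.τ_δ 0 1) ℓ.edge
      rw [X.dualS.τ_zero] at h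
      exact h.trans ℓ.tgt_eq)
    (by
      have h := ConcreteCategory.congr_hom (X.dualS.τ_δ 0 0) ℓ.edge
      rw [X.dualS.τ_zero] at h
      exact h.trans ℓ.src_eq)

/-- The isomorphism `(τ_1)_ℓ : (H_1)_ℓ ≅ (H_1)_{ℓ^op}`. -/
def τ₁ (ℓ : SSet.Edge i j) : X.arr ℓ ≅ X.arr (X.opp ℓ) :=
  componentIso _ _ (X.dualH.τ 1) (X.dualS.τ 1) (X.τ_ζ 1) _ _ rfl

end

/-- Condition `G`: for every `ℓ : i → j` there is a 2-simplex `w` with `∂₂ w = ℓ`,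
`∂₀ w = ℓ^op`, such that `(d_1)_t = (d_0)_t : (H_1)_t ⟶ (H_0)_i` for `t = ∂₁ w : i → i`. -/
def ConditionG : Prop :=
  ∀ ⦃i j : X.S _⦋0⦌⦄ (ℓ : SSet.Edge i j), ∃ t : SSet.Edge i i,
    Nonempty (SSet.Edge.CompStruct ℓ (X.opp ℓ) t) ∧ X.d₁ t = X.d₀ t

end SelfDualFamily

/-! ### Descent data -/

/-- A descent datum of the simplicial set `S` on a family of sets `R` indexed by `S_0`. -/
structure SetDescentDatum (S : SSet.{u}) (R : S _⦋0⦌ → Type u) where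
  s {i j : S _⦋0⦌} (ℓ : SSet.Edge i j) : R i ≃ R j
  s_id (i : S _⦋0⦌) : s (SSet.Edge.id i) = Equiv.refl (R i)
  s_comp {i j k : S _⦋0⦌} {ℓ : SSet.Edge i j} {r : SSet.Edge j k} {t : SSet.Edge i k}
    (w : SSet.Edge.CompStruct ℓ r t) : s t = (s ℓ).trans (s r)

/-- The descent datum is consistent: `s_ℓ = s_t` as soon as there is a morphism from the span of
`ℓ : i → j` to the span of `t : i → j`. -/
def SetDescentDatum.IsConsistent (X : SimplicialFamily J) {R : X.S _⦋0⦌ → Type u}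
    (s : SetDescentDatum X.S R) : Prop :=
  ∀ ⦃i j : X.S _⦋0⦌⦄ (ℓ t : SSet.Edge i j),
    (∃ f : X.arr ℓ ⟶ X.arr t, f ≫ X.d₁ t = X.d₁ ℓ ∧ f ≫ X.d₀ t = X.d₀ ℓ) → s.s ℓ = s.s t

/-- A descent datum of the self-dual simplicial family `X` on the object
`γ^* R ×_{γ^* S_0} H_0` over `H_0`. In the identity and cocycle conditions only the first
projections of both sides are compared; the second ones agree by `comm_snd`. -/
structure FamilyDescentDatum (X : SelfDualFamily J) (R : X.S _⦋0⦌ → Type u) where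
  σ {i j : X.S _⦋0⦌} (ℓ : SSet.Edge i j) :
    (γ J).obj (R i) ⨯ X.arr ℓ ≅ (γ J).obj (R j) ⨯ X.arr (X.opp ℓ)
  comm_snd {i j : X.S _⦋0⦌} (ℓ : SSet.Edge i j) :
    (σ ℓ).hom ≫ prod.snd = prod.snd ≫ (X.τ₁ ℓ).hom
  identity (i : X.S _⦋0⦌) :
    prod.map (𝟙 _) (X.s₀ i) ≫ (σ (SSet.Edge.id i)).hom ≫ prod.fst = prod.fst
  cocycle {i j k : X.S _⦋0⦌} {ℓ : SSet.Edge i j} {r : SSet.Edge j k} {t : SSet.Edge i k}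
    (w : SSet.Edge.CompStruct ℓ r t) :
    prod.lift (prod.map (𝟙 _) (X.face₂ w) ≫ (σ ℓ).hom ≫ prod.fst) (prod.snd ≫ X.face₀ w) ≫
        (σ r).hom ≫ prod.fst =
      prod.map (𝟙 _) (X.face₁ w) ≫ (σ t).hom ≫ prod.fst

/-- The descent datum `σ_ℓ = γ^*(s_ℓ) × (τ_1)_ℓ` induced by a descent datum `s` of the index
simplicial set. -/
def SetDescentDatum.induced (X : SelfDualFamily J) {R : X.S _⦋0⦌ → Type u}
    (s : SetDescentDatum X.S R) : FamilyDescentDatum X R where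
  σ ℓ := prod.mapIso ((γ J).mapIso (s.s ℓ).toIso) (X.τ₁ ℓ)
  comm_snd ℓ := by simp
  identity i := by
    have h : (γ J).map (s.s (SSet.Edge.id i)).toIso.hom = 𝟙 _ := by
      rw [s.s_id]
      exact CategoryTheory.Functor.map_id _ _
    simp [h]
  cocycle {i j k ℓ r t} w := by
    have h : (γ J).map (s.s t).toIso.hom =
        (γ J).map (s.s ℓ).toIso.hom ≫ (γ J).map (s.s r).toIso.hom := by
      rw [s.s_comp w, ← Functor.map_comp]
      rfl
    simp [h]

/-! ### Covers and the Čech simplicial family -/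

/-- A cover: a family `ζ : U ⟶ γ^* I` with non-empty components such that `U ⟶ 1` is an
epimorphism. -/
structure Cover (J : GrothendieckTopology C) where
  I : Type u
  U : Sheaf J (Type u)
  ζ : U ⟶ (γ J).obj I
  nonempty (i : I) : ¬ IsEmptyObj (component ζ i)
  epi : Epi (terminal.from U)

/-! Auxiliary facts on sheaves of sets, used to construct the Čech simplicial family. -/

theorem isEmptyObj_of_hom {X Y : Sheaf J (Type u)} (f : X ⟶ Y) (h : IsEmptyObj Y) :
    IsEmptyObj X := by
  obtain ⟨h⟩ := h
  have := h.isIso_to f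
  exact ⟨h.ofIso (asIso f).symm⟩

theorem bot_mem_of_isEmptyObj {X : Sheaf J (Type u)} (h : IsEmptyObj X) {c : C}
    (x : X.obj.obj (op c)) : ⊥ ∈ J c := by
  obtain ⟨h⟩ := h
  let P : Cᵒᵖ ⥤ Type u := (Functor.const _).obj PEmpty
  let f : X ⟶ (presheafToSheaf J (Type u)).obj P := h.to _
  let y := f.hom.app _ x
  have := Presheaf.imageSieve_mem J (CategoryTheory.toSheafify J P) y
  refine J.superset_covering ?_ this
  rintro d g ⟨p, -⟩
  exact p.elim

/-- Sections of a sheaf as maps from the sheaf associated to a representable. -/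
def elt (X : Sheaf J (Type u)) (c : C) :
    ((presheafToSheaf J (Type u)).obj (yoneda.obj c) ⟶ X) ≃ X.obj.obj (op c) :=
  ((sheafificationAdjunction J (Type u)).homEquiv _ _).trans yonedaEquiv

theorem elt_comp {X Y : Sheaf J (Type u)} (f : X ⟶ Y) (c : C)
    (x : (presheafToSheaf J (Type u)).obj (yoneda.obj c) ⟶ X) :
    elt Y c (x ≫ f) = f.hom.app _ (elt X c x) := by
  simp [elt]
  rfl

/-- The section of `γ^* S` given by an element of `S`. -/
abbrev constElt (J : GrothendieckTopology C) {S : Type u} (d : C) (s : S) :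
    ((γ J).obj S).obj.obj (op d) :=
  (toSheafify J ((Functor.const Cᵒᵖ).obj S)).app (op d) s

theorem exists_const {S : Type u} {c : C} (z : ((γ J).obj S).obj.obj (op c)) :
    ∃ R ∈ J c, ∀ (d : C) (g : d ⟶ c), R g → ∃ s : S,
      ((γ J).obj S).obj.map g.op z = constElt J d s :=
  ⟨_, Presheaf.imageSieve_mem J
      (CategoryTheory.toSheafify J ((Functor.const Cᵒᵖ).obj S)) z, by
    rintro d g ⟨s, hs⟩
    exact ⟨s, hs.symm⟩⟩

theorem map_const {S S' : Type u} (a : S ⟶ S') (d : C) (s : S) :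
    ((γ J).map a).hom.app (op d) (constElt J d s) = constElt J d (a s) := by
  have := congr_arg (fun t => t.app (op d)) (toSheafify_naturality J ((Functor.const Cᵒᵖ).map a))
  exact (ConcreteCategory.congr_hom this s).symm

theorem sheaf_ext (Y : Sheaf J (Type u)) {c : C} (R : Sieve c) (hR : R ∈ J c)
    (a b : Y.obj.obj (op c))
    (h : ∀ (d : C) (g : d ⟶ c), R g → Y.obj.map g.op a = Y.obj.map g.op b) : a = b :=
  (Presieve.IsSheafFor.isSeparatedFor (((isSheaf_iff_isSheaf_of_type J _).1 Y.property) R hR)).ext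
    (fun d g hg => h d g hg)

theorem exists_component_elt {X : Sheaf J (Type u)} {S : Type u} (ζ : X ⟶ (γ J).obj S) (s : S)
    {d : C} (x : X.obj.obj (op d)) (hx : ζ.hom.app _ x = constElt J d s) :
    Nonempty ((component ζ s).obj.obj (op d)) := by
  let x' := (elt X d).symm x
  let y' := (elt ((γ J).obj PUnit.{u + 1}) d).symm (constElt J d PUnit.unit)
  have : x' ≫ ζ = y' ≫ (γ J).map (↾ fun _ : PUnit.{u + 1} => s) := by
    apply (elt _ d).injective
    rw [elt_comp, elt_comp, Equiv.apply_symm_apply, Equiv.apply_symm_apply, hx]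
    exact (map_const (↾ fun _ : PUnit.{u + 1} => s) d PUnit.unit).symm
  exact ⟨elt _ d (pullback.lift x' y' this)⟩

namespace Cover

variable (𝒰 : Cover J)

/-- The component `U_i` of the cover. -/
abbrev comp (i : 𝒰.I) : Sheaf J (Type u) := component 𝒰.ζ i

/-- The Čech simplicial set `N`: its `n`-simplexes are the `(i_0, …, i_n)` such that
`U_{i_0} × ⋯ × U_{i_n}` is not empty. -/
def nerve : SSet.{u} where
  obj n := {f : Fin (n.unop.len + 1) → 𝒰.I // ¬ IsEmptyObj (∏ᶜ fun k => 𝒰.comp (f k))}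
  map θ := ↾ fun f => ⟨fun k => f.1 (θ.unop.toOrderHom k), fun h => f.2
    (isEmptyObj_of_hom (Pi.lift fun k => Pi.π (fun k => 𝒰.comp (f.1 k)) (θ.unop.toOrderHom k)) h)⟩

/-- The `k`-th vertex `(i_0, …, i_n) ↦ i_k`. -/
def nerveVertex (n : SimplexCategoryᵒᵖ) (k : Fin (n.unop.len + 1)) : 𝒰.nerve.obj n ⟶ 𝒰.I :=
  ↾ fun f => f.1 k

/-- The canonical simplicial object, with `U_n = U × ⋯ × U` (`n + 1` factors). -/
def power : SimplicialObject (Sheaf J (Type u)) := cechNerveTerminalFrom 𝒰.U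

/-- The `k`-th projection `U × ⋯ × U ⟶ U`. -/
def powerProj (n : SimplexCategoryᵒᵖ) (k : Fin (n.unop.len + 1)) : 𝒰.power.obj n ⟶ 𝒰.U :=
  Pi.π (fun _ : Fin (n.unop.len + 1) => 𝒰.U) k

/-- `γ^*(I^{n+1})` is a product of copies of `γ^* I`. -/
def isLimitPow (n : SimplexCategoryᵒᵖ) :
    IsLimit (Fan.mk ((γ J).obj (Fin (n.unop.len + 1) → 𝒰.I))
      fun k => (γ J).map (↾ fun f : Fin (n.unop.len + 1) → 𝒰.I => f k)) :=
  isLimitFanMkObjOfIsLimit (γ J) (fun _ : Fin (n.unop.len + 1) => 𝒰.I)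
    (fun k => (↾ fun f : Fin (n.unop.len + 1) → 𝒰.I => f k))
    (Types.productLimitCone fun _ : Fin (n.unop.len + 1) => 𝒰.I).isLimit

/-- The inclusion of `N_n` in `I^{n+1}`. -/
def incl (n : SimplexCategoryᵒᵖ) : 𝒰.nerve.obj n ⟶ (Fin (n.unop.len + 1) → 𝒰.I) :=
  ↾ fun f => f.1

instance (n : SimplexCategoryᵒᵖ) : Mono ((γ J).map (𝒰.incl n)) := by
  have : Mono (𝒰.incl n) := (mono_iff_injective _).2 Subtype.val_injective
  infer_instance

theorem hom_ext_nerve {X : Sheaf J (Type u)} (n : SimplexCategoryᵒᵖ)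
    (a b : X ⟶ (γ J).obj (𝒰.nerve.obj n))
    (h : ∀ k, a ≫ (γ J).map (𝒰.nerveVertex n k) = b ≫ (γ J).map (𝒰.nerveVertex n k)) :
    a = b := by
  rw [← cancel_mono ((γ J).map (𝒰.incl n))]
  refine Fan.IsLimit.hom_ext (𝒰.isLimitPow n) _ _ fun k => ?_
  have := h k
  have e : 𝒰.nerveVertex n k = 𝒰.incl n ≫ (↾ fun f => f k) := rfl
  rw [e, Functor.map_comp] at this
  simpa using this

theorem exists_index (n : SimplexCategoryᵒᵖ) :
    ∃ z : 𝒰.power.obj n ⟶ (γ J).obj (𝒰.nerve.obj n),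
      ∀ k, z ≫ (γ J).map (𝒰.nerveVertex n k) = 𝒰.powerProj n k ≫ 𝒰.ζ := by
  let z₀ : 𝒰.power.obj n ⟶ (γ J).obj (Fin (n.unop.len + 1) → 𝒰.I) :=
    Fan.IsLimit.lift (𝒰.isLimitPow n) fun k => 𝒰.powerProj n k ≫ 𝒰.ζ
  have hz₀ (k) : z₀ ≫ (γ J).map (↾ fun f : Fin (n.unop.len + 1) → 𝒰.I => f k) =
      𝒰.powerProj n k ≫ 𝒰.ζ := Fan.IsLimit.fac (𝒰.isLimitPow n) _ k
  let p := pullback.fst z₀ ((γ J).map (𝒰.incl n))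
  have hp : Epi p := by
    refine ⟨fun {Y} a b hab => ?_⟩
    have key (d : C) (x : (𝒰.power.obj n).obj.obj (op d)) (f : Fin (n.unop.len + 1) → 𝒰.I)
        (hx : z₀.hom.app _ x = constElt J d f) : a.hom.app _ x = b.hom.app _ x := by
      by_cases hf : IsEmptyObj (∏ᶜ fun k => 𝒰.comp (f k))
      · have hd : ⊥ ∈ J d := by
          have hk (k) : Nonempty ((𝒰.comp (f k)).obj.obj (op d)) := by
            refine exists_component_elt 𝒰.ζ (f k) ((𝒰.powerProj n k).hom.app _ x) ?_
            have := congr_arg (fun t => t.hom.app (op d) x) (hz₀ k)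
            refine this.symm.trans ?_
            change ((γ J).map _).hom.app _ (z₀.hom.app _ x) = _
            rw [hx]
            exact map_const _ _ _
          refine bot_mem_of_isEmptyObj hf (elt _ d (Pi.lift fun k =>
            (elt _ d).symm (hk k).some))
        exact sheaf_ext Y _ hd _ _ fun _ _ h => h.elim
      · let x' := (elt _ d).symm x
        let y' := (elt ((γ J).obj (𝒰.nerve.obj n)) d).symm (constElt J d ⟨f, hf⟩)
        have : x' ≫ z₀ = y' ≫ (γ J).map (𝒰.incl n) := by
          apply (elt _ d).injective
          rw [elt_comp, elt_comp, Equiv.apply_symm_apply, Equiv.apply_symm_apply, hx]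
          exact (map_const (𝒰.incl n) d ⟨f, hf⟩).symm
        have e : x' ≫ a = x' ≫ b := by
          rw [← pullback.lift_fst x' y' this, Category.assoc, Category.assoc]
          exact pullback.lift x' y' this ≫= hab
        have := congr_arg (elt _ d) e
        rwa [elt_comp, elt_comp, Equiv.apply_symm_apply] at this
    ext c x
    obtain ⟨R, hR, h⟩ := exists_const (z₀.hom.app c x)
    refine sheaf_ext Y R hR _ _ fun d g hg => ?_
    obtain ⟨f, hf⟩ := h d g hg
    have := key d ((𝒰.power.obj n).obj.map g.op x) f
      (by rw [NatTrans.naturality_apply]; exact hf)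
    rwa [NatTrans.naturality_apply, NatTrans.naturality_apply] at this
  have : IsIso p := isIso_of_mono_of_epi p
  refine ⟨inv p ≫ pullback.snd _ _, fun k => ?_⟩
  rw [← hz₀ k, ← cancel_epi p]
  have e : 𝒰.nerveVertex n k = 𝒰.incl n ≫ (↾ fun f => f k) := rfl
  rw [e, Functor.map_comp]
  simp only [Category.assoc, IsIso.hom_inv_id_assoc]
  rw [← Category.assoc, ← pullback.condition, Category.assoc]

/-- The map `U_n ⟶ γ^* N_n`: the unique one whose composite with each vertex map
`γ^* N_n ⟶ γ^* I` is the corresponding projection `U_n ⟶ U` followed by `ζ`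
(see `cechζ_vertex` and `hom_ext_nerve`). -/
def cechζ : 𝒰.power ⟶ ((SimplicialObject.whiskering _ _).obj (γ J)).obj 𝒰.nerve where
  app n := (𝒰.exists_index n).choose
  naturality n m θ := by
    refine 𝒰.hom_ext_nerve m _ _ fun k => ?_
    have e : 𝒰.power.map θ ≫ 𝒰.powerProj m k = 𝒰.powerProj n (θ.unop.toOrderHom k) := by
      simp [power, powerProj, cechNerveTerminalFrom]
    calc
      _ = 𝒰.power.map θ ≫ (𝒰.exists_index m).choose ≫ (γ J).map (𝒰.nerveVertex m k) :=
        Category.assoc _ _ _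
      _ = 𝒰.powerProj n (θ.unop.toOrderHom k) ≫ 𝒰.ζ := by
        rw [(𝒰.exists_index m).choose_spec k, ← Category.assoc, e]
      _ = (𝒰.exists_index n).choose ≫ (γ J).map (𝒰.nerve.map θ ≫ 𝒰.nerveVertex m k) :=
        ((𝒰.exists_index n).choose_spec (θ.unop.toOrderHom k)).symm
      _ = _ := by rw [Functor.map_comp]; exact (Category.assoc _ _ _).symm

theorem cechζ_vertex (n : SimplexCategoryᵒᵖ) (k : Fin (n.unop.len + 1)) :
    𝒰.cechζ.app n ≫ (γ J).map (𝒰.nerveVertex n k) = 𝒰.powerProj n k ≫ 𝒰.ζ :=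
  (𝒰.exists_index n).choose_spec k

theorem exists_cech_component (n : SimplexCategoryᵒᵖ) (w : 𝒰.nerve.obj n) :
    Nonempty ((∏ᶜ fun k => 𝒰.comp (𝒰.nerveVertex n k w)) ⟶ component (𝒰.cechζ.app n) w) := by
  let P : Sheaf J (Type u) := ∏ᶜ fun k => 𝒰.comp (𝒰.nerveVertex n k w)
  let π (k) : P ⟶ 𝒰.comp (𝒰.nerveVertex n k w) := Pi.π _ k
  let f : P ⟶ 𝒰.power.obj n := Pi.lift fun k => π k ≫ componentι _ _
  have hf (k) : f ≫ 𝒰.powerProj n k = π k ≫ componentι _ _ := limit.lift_π _ _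
  let g : P ⟶ (γ J).obj PUnit.{u + 1} := π 0 ≫ componentPt _ _
  let z : 𝒰.power.obj n ⟶ (γ J).obj (𝒰.nerve.obj n) := 𝒰.cechζ.app n
  have hz (k) : z ≫ (γ J).map (𝒰.nerveVertex n k) = 𝒰.powerProj n k ≫ 𝒰.ζ := 𝒰.cechζ_vertex n k
  have h : f ≫ z = g ≫ (γ J).map (↾ fun _ : PUnit.{u + 1} => w) := by
    refine 𝒰.hom_ext_nerve n _ _ fun k => ?_
    have hg : g = π k ≫ componentPt _ _ :=
      (Types.isTerminalPUnit.isTerminalObj (γ J) _).hom_ext _ _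
    rw [Category.assoc, hz k, ← Category.assoc, hf k, Category.assoc, component_condition, hg,
      Category.assoc, Category.assoc, ← Functor.map_comp]
    rfl
  exact ⟨pullback.lift f g h⟩

/-- The Čech simplicial family `U_• ⟶ γ^* N_•` of the cover. -/
def cech : SimplicialFamily J where
  S := 𝒰.nerve
  H := 𝒰.power
  ζ := 𝒰.cechζ
  nonempty n w h := w.2 (isEmptyObj_of_hom (𝒰.exists_cech_component n w).some h)

end Cover

/-! ### Hypercover refinements -/

/-- A self-dual simplicial hypercover refinement of the Čech simplicial family of a cover
`U ⟶ γ^* I`: a self-dual simplicial family `H_• ⟶ γ^* S_•` with a morphism `(h, α)` of simplicial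
families to the Čech simplicial family, which identifies `S_0` with `I` and `H_0` with `U`,
such that the maps `H_k ⟶ (cosk_{k-1} H)_k`, `k ≥ 1`, are epimorphisms. -/
structure HypercoverRefinement (𝒰 : Cover J) extends SelfDualFamily J where
  hom : SimplicialFamily.Hom toSimplicialFamily 𝒰.cech
  bijective_zero : Function.Bijective (hom.α.app (op ⦋0⦌))
  isIso_zero : IsIso (hom.h.app (op ⦋0⦌))
  epi_cosk (k : ℕ) : Epi (((SimplicialObject.coskAdj k).unit.app H).app (op ⦋k + 1⦌))

namespace HypercoverRefinement

variable {𝒰 : Cover J} (X : HypercoverRefinement 𝒰)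

/-- The index in `I` of a vertex of `S`, under the identification `S_0 = I`. -/
def idx (i : X.S _⦋0⦌) : 𝒰.I := 𝒰.nerveVertex (op ⦋0⦌) 0 (X.hom.α.app (op ⦋0⦌) i)

/-- The identification `(H_0)_i = U_i`. -/
def toComp (i : X.S _⦋0⦌) : X.vert i ⟶ 𝒰.comp (X.idx i) :=
  componentMap _ _ (X.hom.h.app (op ⦋0⦌) ≫ 𝒰.powerProj (op ⦋0⦌) 0)
    (X.hom.α.app (op ⦋0⦌) ≫ 𝒰.nerveVertex (op ⦋0⦌) 0)
    ((Category.assoc _ _ _).trans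
      ((congrArg (_ ≫ ·) (𝒰.cechζ_vertex (op ⦋0⦌) 0).symm).trans
        ((Category.assoc _ _ _).symm.trans
          ((congrArg (· ≫ _) (NatTrans.congr_app X.hom.comm (op ⦋0⦌))).trans
            ((Category.assoc _ _ _).trans
              (congrArg (_ ≫ ·) ((γ J).map_comp _ _).symm))))))
    i (X.idx i) rfl

/-- The component `(h_1)_ℓ = ((d_1)_ℓ, (d_0)_ℓ) : (H_1)_ℓ ⟶ U_i × U_j` of the morphism to the Čech
simplicial family. -/
def h₁ {i j : X.S _⦋0⦌} (ℓ : SSet.Edge i j) : X.arr ℓ ⟶ 𝒰.comp (X.idx i) ⨯ 𝒰.comp (X.idx j) :=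
  prod.lift (X.d₁ ℓ ≫ X.toComp i) (X.d₀ ℓ ≫ X.toComp j)

end HypercoverRefinement

/-! ### Locally constant objects and covering projections -/

/-- A trivialization of the object `X` by the cover `𝒰`, with family of sets `R`: isomorphisms
`θ_i : γ^* R_i × U_i ≅ X × U_i` over `U_i`. -/
structure Trivialization (𝒰 : Cover J) (X : Sheaf J (Type u)) (R : 𝒰.I → Type u) where
  θ (i : 𝒰.I) : (γ J).obj (R i) ⨯ 𝒰.comp i ≅ X ⨯ 𝒰.comp i
  comm_snd (i : 𝒰.I) : (θ i).hom ≫ prod.snd = prod.snd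

namespace Trivialization

variable {𝒰 : Cover J} {X : Sheaf J (Type u)} {R : 𝒰.I → Type u} (T : Trivialization 𝒰 X R)

/-- The Čech descent datum `σ_{j,i} : γ^* R_i × U_i × U_j ≅ γ^* R_j × U_j × U_i` of a
trivialization, determined by `(θ_j × U_i) ∘ σ_{j,i} = (X × τ) ∘ (θ_i × U_j)`. -/
def σ (i j : 𝒰.I) : (γ J).obj (R i) ⨯ (𝒰.comp i ⨯ 𝒰.comp j) ≅
    (γ J).obj (R j) ⨯ (𝒰.comp j ⨯ 𝒰.comp i) :=
  (Limits.prod.associator _ _ _).symm ≪≫ prod.mapIso (T.θ i) (Iso.refl (𝒰.comp j)) ≪≫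
    Limits.prod.associator _ _ _ ≪≫ prod.mapIso (Iso.refl X) (prod.braiding (𝒰.comp i) (𝒰.comp j)) ≪≫
      (Limits.prod.associator _ _ _).symm ≪≫ (prod.mapIso (T.θ j) (Iso.refl (𝒰.comp i))).symm ≪≫
        Limits.prod.associator _ _ _

/-- The span `U_i ← V → U_j` is an action span: `V` is non-empty and, over `V`, the descent datum
is given by a bijection of `R_i` with `R_j`. -/
def IsActionSpan {i j : 𝒰.I} {V : Sheaf J (Type u)} (u : V ⟶ 𝒰.comp i) (v : V ⟶ 𝒰.comp j) :
    Prop :=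
  ¬ IsEmptyObj V ∧ ∃ s : R i ≃ R j,
    prod.map (𝟙 _) (prod.lift u v) ≫ (T.σ i j).hom =
      prod.map ((γ J).map s.toIso.hom) (𝟙 V) ≫ prod.map (𝟙 _) (prod.lift v u)

/-- The locally constant object is a covering projection: whenever `U_i × U_j` is non-empty, the
family of all the maps `(u, v) : V ⟶ U_i × U_j` given by action spans is epimorphic. -/
def IsCoveringProjection : Prop :=
  ∀ i j : 𝒰.I, ¬ IsEmptyObj (𝒰.comp i ⨯ 𝒰.comp j) →
    ∀ (Y : Sheaf J (Type u)) (f g : 𝒰.comp i ⨯ 𝒰.comp j ⟶ Y),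
      (∀ (V : Sheaf J (Type u)) (u : V ⟶ 𝒰.comp i) (v : V ⟶ 𝒰.comp j),
        T.IsActionSpan u v → prod.lift u v ≫ f = prod.lift u v ≫ g) → f = g

/-- `D` is the descent datum of the refinement `H` that corresponds to the Čech descent datum `σ`
of the trivialization: `σ_{j,i} ∘ (γ^* R_i × (h_1)_ℓ) = (γ^* R_j × (h_1)_{ℓ^op}) ∘ D_ℓ` for all
`ℓ : i → j`. -/
def Induces (H : HypercoverRefinement 𝒰)
    (D : FamilyDescentDatum H.toSelfDualFamily fun i => R (H.idx i)) : Prop :=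
  ∀ ⦃i j : H.S _⦋0⦌⦄ (ℓ : SSet.Edge i j),
    prod.map (𝟙 _) (H.h₁ ℓ) ≫ (T.σ (H.idx i) (H.idx j)).hom =
      (D.σ ℓ).hom ≫ prod.map (𝟙 _) (H.h₁ (H.opp ℓ))

end Trivialization

end

end CoveringProj

/-! Everything is read on points, the sections over an object `c` of the site, and statements about
points hold locally (`Loc`). A stage with `⊥ ∈ J c` is empty: every local statement is true there.
At every other stage distinct constants of `γ^* S` stay distinct (`cst_injective`). A trivialization
becomes a family of leaves `U_i ⟶ X`, one for each `r : R_i`, such that every point of `U_i`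
identifies `R_i`, locally, with the points of `X` (`leaf_injective`, `loc_leaf`; the converse is
`exists_of_family`). A span `(u, v)` carries the action `s` exactly when the leaf `r` along `u` is
the leaf `s r` along `v` (`map_lift_σ_iff`), and `Induces` is this equation on the spans of all `ℓ`
(`induces_iff`). By injectivity of the leaves, at a non-empty stage there is at most one such `s`.

From a covering projection to a hypercover. A simplex of `S` consists of indices, of bijections
between the sets `R_i` at these indices, and of a reflexive symmetric relation of marks, subject to
being realized by some tuple of points at a non-empty stage. `H_n` is the sheaf of tuples of points
of `U` together with a simplex that describes the action on them and whose marked pairs are equal.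
All operators reindex tuples, so reversal of the order gives an involutive duality. The bijections
exist locally by the covering projection condition (`loc_action`) and are unique, so only the marks
are additional data. These serve condition G: a degenerate edge is marked, hence its component lies
over the diagonal, and reindexing `ℓ` along `0, 1, 0` gives a triangle with faces `ℓ`, `ℓ^op` and a
degenerate edge. The marks need not be transitive, so they can be prescribed independently on the
edges of a boundary; this makes `H_k ⟶ (cosk_{k-1} H)_k` an epimorphism (`loc_lift_cosk`). The
bijections stored in the edges form the descent datum; its identity, cocycle and consistency
conditions follow from uniqueness of the action at a point (`exists_descentDatum`).

From a hypercover to a covering projection. The epimorphism in degree 1 joins any two points of the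
cover, locally, by a point of some `(H_1)_ℓ` (`loc_arr`); the one in degree 2 fills every triangle
of such points (`s_comp_of_pt`). So the `s_ℓ` form a locally constant cocycle, and copies of the
`U_i` indexed by the `R_i` are glued along it (`exists_glued`). The spans of the `ℓ` are then action
spans that cover `U_i × U_j`. In two objects with the same descent datum the same points of leaves
coincide, which gives the unique isomorphism (`exists_hom_of_induces`). -/

namespace CoveringProj

noncomputable section

section Points

variable {C : Type u} [SmallCategory C] {J : GrothendieckTopology C}

/-! ### Points of sheaves

A point of the sheaf `X` at the stage `c` is a morphism `(rep J).obj c ⟶ X`, that is, a section of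
`X` over `c`. -/

/-- The sheaf associated to a representable presheaf. -/
abbrev rep (J : GrothendieckTopology C) : C ⥤ Sheaf J (Type u) :=
  yoneda ⋙ presheafToSheaf J (Type u)

theorem elt_rep {X : Sheaf J (Type u)} {c d : C} (g : d ⟶ c) (x : (rep J).obj c ⟶ X) :
    elt X d ((rep J).map g ≫ x) = X.obj.map g.op (elt X c x) := by
  simp only [elt, Equiv.trans_apply]
  erw [Adjunction.homEquiv_naturality_left, yonedaEquiv_naturality]

/-- The statement `Q` holds locally on `c`. -/
def Loc (J : GrothendieckTopology C) (c : C) (Q : ∀ d : C, (d ⟶ c) → Prop) : Prop :=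
  ∃ R ∈ J c, ∀ (d : C) (g : d ⟶ c), R g → Q d g

namespace Loc

variable {c : C} {Q Q' : ∀ d : C, (d ⟶ c) → Prop}

theorem of_forall (h : ∀ d g, Q d g) : Loc J c Q :=
  ⟨⊤, J.top_mem c, fun d g _ => h d g⟩

theorem of_bot (h : ⊥ ∈ J c) : Loc J c Q :=
  ⟨⊥, h, fun _ _ hg => hg.elim⟩

theorem mono (h : Loc J c Q) (H : ∀ d g, Q d g → Q' d g) : Loc J c Q' := by
  obtain ⟨R, hR, h⟩ := h
  exact ⟨R, hR, fun d g hg => H d g (h d g hg)⟩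

theorem and (h : Loc J c Q) (h' : Loc J c Q') : Loc J c fun d g => Q d g ∧ Q' d g := by
  obtain ⟨R, hR, h⟩ := h
  obtain ⟨R', hR', h'⟩ := h'
  exact ⟨R ⊓ R', J.intersection_covering hR hR', fun d g hg => ⟨h d g hg.1, h' d g hg.2⟩⟩

theorem bind (h : Loc J c Q) (H : ∀ d g, Q d g → Loc J d fun e k => Q' e (k ≫ g)) :
    Loc J c Q' := by
  obtain ⟨R, hR, h⟩ := h
  choose S hS hS' using fun d g hg => H d g (h d g hg)
  refine ⟨Sieve.bind R fun d g hg => S d g hg, J.bind_covering hR fun d g hg => hS d g hg, ?_⟩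
  rintro e k ⟨d, g', g, hg, hk, rfl⟩
  exact hS' _ _ hg _ _ hk

theorem restrict (h : Loc J c Q) {d : C} (g : d ⟶ c) : Loc J d fun e k => Q e (k ≫ g) := by
  obtain ⟨R, hR, h⟩ := h
  exact ⟨R.pullback g, J.pullback_stable g hR, fun e k hk => h _ _ hk⟩

theorem forall_fin {n : ℕ} {Q : Fin n → ∀ d : C, (d ⟶ c) → Prop} (h : ∀ a, Loc J c (Q a)) :
    Loc J c fun d g => ∀ a, Q a d g := by
  induction n with
  | zero => exact of_forall fun _ _ a => a.elim0
  | succ n ih =>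
    exact ((h 0).and (ih fun a => h a.succ)).mono fun d g hg => Fin.cases hg.1 hg.2

/-- If all members of the covering sieve had empty domain, transitivity would make the empty sieve
cover `c`. This turns local existence into existence at one non-empty stage, which is enough to
compare sets or bijections that do not depend on the stage. -/
theorem exists_of_not_bot (h : Loc J c Q) (hc : ⊥ ∉ J c) : ∃ d g, Q d g ∧ ⊥ ∉ J d := by
  by_contra! H
  obtain ⟨R, hR, h⟩ := h
  exact hc (J.transitive hR _ fun d g hg => by simpa using H d g (h d g hg))

theorem of_not_bot (h : ⊥ ∉ J c → Loc J c Q) : Loc J c Q := by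
  by_cases hc : ⊥ ∈ J c
  · exact of_bot hc
  · exact h hc

end Loc

theorem pt_ext {X : Sheaf J (Type u)} {c : C} {x y : (rep J).obj c ⟶ X}
    (h : Loc J c fun _ g => (rep J).map g ≫ x = (rep J).map g ≫ y) : x = y := by
  obtain ⟨R, hR, h⟩ := h
  refine (elt X c).injective (sheaf_ext X R hR _ _ fun d g hg => ?_)
  rw [← elt_rep, ← elt_rep, h d g hg]

theorem pt_ext_of_bot {X : Sheaf J (Type u)} {c : C} {x y : (rep J).obj c ⟶ X} (h : ⊥ ∈ J c) :
    x = y :=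
  pt_ext (Loc.of_bot h)

theorem hom_ext_pt {X Y : Sheaf J (Type u)} {f g : X ⟶ Y}
    (h : ∀ (c : C) (x : (rep J).obj c ⟶ X), x ≫ f = x ≫ g) : f = g := by
  ext c x
  have := congrArg (elt Y c.unop) (h c.unop ((elt X c.unop).symm x))
  rwa [elt_comp, elt_comp, Equiv.apply_symm_apply] at this

/-- A natural operation on points defines a morphism. -/
theorem exists_hom_of_pt {X Y : Sheaf J (Type u)}
    (F : ∀ c : C, ((rep J).obj c ⟶ X) → ((rep J).obj c ⟶ Y))
    (hF : ∀ {c d : C} (g : d ⟶ c) (x), F d ((rep J).map g ≫ x) = (rep J).map g ≫ F c x) :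
    ∃ f : X ⟶ Y, ∀ (c : C) (x : (rep J).obj c ⟶ X), x ≫ f = F c x := by
  refine ⟨⟨{ app := fun c => ↾ fun x => elt Y c.unop (F c.unop ((elt X c.unop).symm x))
             naturality := fun c d g => ?_ }⟩, fun c x => (elt Y c).injective ?_⟩
  · ext x
    change elt Y d.unop (F d.unop ((elt X d.unop).symm (X.obj.map g x))) =
      Y.obj.map g (elt Y c.unop (F c.unop ((elt X c.unop).symm x)))
    rw [← Quiver.Hom.op_unop g, ← elt_rep, ← hF]
    congr 2
    rw [Equiv.symm_apply_eq, elt_rep, Equiv.apply_symm_apply]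
  · rw [elt_comp]
    change elt Y c (F c ((elt X c).symm (elt X c x))) = _
    rw [Equiv.symm_apply_apply]

/-- Gluing: points that are locally unique and exist locally. -/
theorem exists_pt_of_loc {X : Sheaf J (Type u)} {c : C}
    (Q : ∀ d : C, (d ⟶ c) → ((rep J).obj d ⟶ X) → Prop)
    (hex : Loc J c fun d g => ∃ x, Q d g x)
    (hres : ∀ {d e : C} (g : d ⟶ c) (k : e ⟶ d) (x), Q d g x → Q e (k ≫ g) ((rep J).map k ≫ x))
    (huniq : ∀ {d : C} (g : d ⟶ c) (x y), Q d g x → Q d g y → x = y) :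
    ∃ x : (rep J).obj c ⟶ X, Loc J c fun d g => Q d g ((rep J).map g ≫ x) := by
  obtain ⟨R, hR, h⟩ := hex
  choose x hx using h
  have hs := ((isSheaf_iff_isSheaf_of_type J _).1 X.property) R hR
  let fam : Presieve.FamilyOfElements X.obj R.arrows := fun d g hg => elt X d (x d g hg)
  have hfam : fam.Compatible := by
    rw [Presieve.compatible_iff_sieveCompatible]
    intro d e g k hg
    change elt X e (x e (k ≫ g) _) = X.obj.map k.op (elt X d (x d g hg))
    rw [← elt_rep]
    exact congrArg _ (huniq (k ≫ g) _ _ (hx _ _ _) (hres g k _ (hx _ _ _)))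
  refine ⟨(elt X c).symm (hs.amalgamate fam hfam), R, hR, fun d g hg => ?_⟩
  have e : (rep J).map g ≫ (elt X c).symm (hs.amalgamate fam hfam) = x d g hg := by
    apply (elt X d).injective
    rw [elt_rep, Equiv.apply_symm_apply]
    exact hs.valid_glue hfam g hg
  change Q d g _
  rw [e]
  exact hx d g hg

theorem loc_lift_of_epi {X Y : Sheaf J (Type u)} (f : X ⟶ Y) [Epi f] {c : C}
    (y : (rep J).obj c ⟶ Y) :
    Loc J c fun d g => ∃ x : (rep J).obj d ⟶ X, x ≫ f = (rep J).map g ≫ y := by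
  have : Sheaf.IsLocallySurjective f := (Sheaf.isLocallySurjective_iff_epi f).2 inferInstance
  refine ⟨_, Presheaf.imageSieve_mem J f.hom (elt Y c y), ?_⟩
  rintro d g ⟨x, hx⟩
  refine ⟨(elt X d).symm x, (elt Y d).injective ?_⟩
  rw [elt_comp, elt_rep, Equiv.apply_symm_apply]
  exact hx

theorem epi_of_loc_lift {X Y : Sheaf J (Type u)} (f : X ⟶ Y)
    (h : ∀ (c : C) (y : (rep J).obj c ⟶ Y),
      Loc J c fun d g => ∃ x : (rep J).obj d ⟶ X, x ≫ f = (rep J).map g ≫ y) : Epi f := by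
  refine ⟨fun a b hab => hom_ext_pt fun c y => pt_ext ((h c y).mono ?_)⟩
  rintro d g ⟨x, hx⟩
  rw [← Category.assoc, ← hx, ← Category.assoc, ← hx, Category.assoc, Category.assoc, hab]

/-- A jointly locally surjective family of morphisms is effective epimorphic. -/
theorem exists_desc {ι : Type*} {A : ι → Sheaf J (Type u)} {X Y : Sheaf J (Type u)}
    (a : ∀ k, A k ⟶ X) (b : ∀ k, A k ⟶ Y)
    (ha : ∀ (c : C) (x : (rep J).obj c ⟶ X),
      Loc J c fun d g => ∃ (k : ι) (p : (rep J).obj d ⟶ A k), p ≫ a k = (rep J).map g ≫ x)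
    (hab : ∀ (c : C) (k l : ι) (p : (rep J).obj c ⟶ A k) (q : (rep J).obj c ⟶ A l),
      p ≫ a k = q ≫ a l → p ≫ b k = q ≫ b l) :
    ∃ e : X ⟶ Y, ∀ k, a k ≫ e = b k := by
  -- The graph of the map to be built: locally, `x` and `y` are images of one point of some `A k`.
  -- It is single-valued by `hab` and total by `ha` and gluing.
  let Q (c : C) (x : (rep J).obj c ⟶ X) (y : (rep J).obj c ⟶ Y) : Prop :=
    Loc J c fun d g => ∃ (k : ι) (p : (rep J).obj d ⟶ A k),
      p ≫ a k = (rep J).map g ≫ x ∧ p ≫ b k = (rep J).map g ≫ y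
  have hQ {c : C} {x} {y y'} (h : Q c x y) (h' : Q c x y') : y = y' := by
    refine pt_ext ((h.and h').mono ?_)
    rintro d g ⟨⟨k, p, h₁, h₂⟩, l, q, h₃, h₄⟩
    rw [← h₂, ← h₄]
    exact hab _ _ _ _ _ (h₁.trans h₃.symm)
  have hres {c d : C} (g : d ⟶ c) {x y} (h : Q c x y) :
      Q d ((rep J).map g ≫ x) ((rep J).map g ≫ y) := by
    refine (h.restrict g).mono ?_
    rintro e k ⟨l, p, h₁, h₂⟩
    exact ⟨l, p, by rw [h₁, Functor.map_comp, Category.assoc],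
      by rw [h₂, Functor.map_comp, Category.assoc]⟩
  have hex (c : C) (x : (rep J).obj c ⟶ X) : ∃ y, Q c x y := by
    obtain ⟨y, hy⟩ := exists_pt_of_loc (X := Y) (fun d g y => Q d ((rep J).map g ≫ x) y)
      ((ha c x).mono fun d g => by
        rintro ⟨k, p, hp⟩
        exact ⟨p ≫ b k, Loc.of_forall fun e l => ⟨k, (rep J).map l ≫ p, by
          rw [Category.assoc, hp], by rw [Category.assoc]⟩⟩)
      (fun {d e} g k y h => by
        simpa only [Functor.map_comp, Category.assoc] using hres k h)
      (fun g y y' h h' => hQ h h')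
    refine ⟨y, hy.bind fun d g h => h.mono ?_⟩
    rintro e k ⟨l, p, h₁, h₂⟩
    exact ⟨l, p, by rw [h₁, Functor.map_comp, Category.assoc],
      by rw [h₂, Functor.map_comp, Category.assoc]⟩
  choose F hF using hex
  obtain ⟨e, he⟩ := exists_hom_of_pt F fun {c d} g x => hQ (hF d _) (hres g (hF c x))
  refine ⟨e, fun k => hom_ext_pt fun c p => ?_⟩
  rw [← Category.assoc, he]
  exact hQ (hF _ _) (Loc.of_forall fun d g => ⟨k, (rep J).map g ≫ p, by
    rw [Category.assoc], by rw [Category.assoc]⟩)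

theorem hom_ext_of_loc_surj {ι : Type*} {A : ι → Sheaf J (Type u)} {X Y : Sheaf J (Type u)}
    (a : ∀ k, A k ⟶ X)
    (ha : ∀ (c : C) (x : (rep J).obj c ⟶ X),
      Loc J c fun d g => ∃ (k : ι) (p : (rep J).obj d ⟶ A k), p ≫ a k = (rep J).map g ≫ x)
    {f g : X ⟶ Y} (h : ∀ k, a k ≫ f = a k ≫ g) : f = g := by
  refine hom_ext_pt fun c x => pt_ext ((ha c x).mono ?_)
  rintro d k ⟨l, p, hp⟩
  rw [← Category.assoc, ← hp, Category.assoc, h, ← Category.assoc, hp, Category.assoc]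

theorem isIso_of_pt {X Y : Sheaf J (Type u)} (f : X ⟶ Y)
    (hinj : ∀ (c : C) (x y : (rep J).obj c ⟶ X), x ≫ f = y ≫ f → x = y)
    (hsurj : ∀ (c : C) (y : (rep J).obj c ⟶ Y),
      Loc J c fun d g => ∃ x : (rep J).obj d ⟶ X, x ≫ f = (rep J).map g ≫ y) : IsIso f := by
  have : Epi f := epi_of_loc_lift f hsurj
  have : Mono f := ⟨fun a b hab => hom_ext_pt fun c x => hinj c _ _ (by
    rw [Category.assoc, hab, Category.assoc])⟩
  exact isIso_of_mono_of_epi f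

/-! #### Emptiness -/

/-- Over a stage covered by the empty sieve every sheaf has exactly one section. So if `X` has
points only at such stages, there is exactly one map from `X` to any sheaf. -/
theorem isEmptyObj_iff {X : Sheaf J (Type u)} :
    IsEmptyObj X ↔ ∀ (c : C), ((rep J).obj c ⟶ X) → ⊥ ∈ J c := by
  refine ⟨fun h c x => bot_mem_of_isEmptyObj h (elt X c x), fun h => ?_⟩
  have (Y : Sheaf J (Type u)) : Nonempty (Unique (X ⟶ Y)) := by
    obtain ⟨f, -⟩ := exists_hom_of_pt (X := X) (Y := Y)
      (fun c x => (exists_pt_of_loc (X := Y) (c := c) (fun _ _ _ => True)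
        (Loc.of_bot (h c x)) (fun _ _ _ _ => trivial)
        fun g _ _ _ _ => pt_ext_of_bot (h _ ((rep J).map g ≫ x))).choose)
      (fun g x => pt_ext_of_bot (h _ ((rep J).map g ≫ x)))
    exact ⟨⟨⟨f⟩, fun g => hom_ext_pt fun c x => pt_ext_of_bot (h c x)⟩⟩
  have (Y : Sheaf J (Type u)) : Unique (X ⟶ Y) := (this Y).some
  exact ⟨IsInitial.ofUnique X⟩

theorem not_isEmptyObj_iff {X : Sheaf J (Type u)} :
    ¬ IsEmptyObj X ↔ ∃ (c : C) (_ : (rep J).obj c ⟶ X), ⊥ ∉ J c := by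
  rw [isEmptyObj_iff]
  push Not
  rfl

/-! #### Sections of constant sheaves -/

/-- The morphism `A ⟶ γ^* S` which is constant with value `s`. -/
def cst (A : Sheaf J (Type u)) {S : Type u} (s : S) : A ⟶ (γ J).obj S :=
  (Types.isTerminalPUnit.isTerminalObj (γ J) _).from A ≫ (γ J).map (↾ fun _ : PUnit.{u + 1} => s)

@[simp]
theorem comp_cst {A B : Sheaf J (Type u)} (f : A ⟶ B) {S : Type u} (s : S) :
    f ≫ cst B s = cst A s := by
  rw [cst, cst, ← Category.assoc]
  congr 1
  exact (Types.isTerminalPUnit.isTerminalObj (γ J) _).hom_ext _ _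

@[simp]
theorem cst_map (A : Sheaf J (Type u)) {S S' : Type u} (f : S ⟶ S') (s : S) :
    cst A s ≫ (γ J).map f = cst A (f s) := by
  rw [cst, cst, Category.assoc, ← Functor.map_comp]
  rfl

theorem elt_cst {S : Type u} (c : C) (s : S) :
    elt _ c (cst ((rep J).obj c) s) = constElt J c s := by
  have h : (elt _ c).symm (constElt J c PUnit.unit) =
      (Types.isTerminalPUnit.isTerminalObj (γ J) _).from ((rep J).obj c) :=
    (Types.isTerminalPUnit.isTerminalObj (γ J) _).hom_ext _ _
  rw [cst, ← h, elt_comp, Equiv.apply_symm_apply]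
  exact map_const (↾ fun _ : PUnit.{u + 1} => s) c PUnit.unit

theorem loc_cst {S : Type u} {c : C} (z : (rep J).obj c ⟶ (γ J).obj S) :
    Loc J c fun _ g => ∃ s : S, (rep J).map g ≫ z = cst _ s := by
  obtain ⟨R, hR, h⟩ := exists_const (elt _ c z)
  refine ⟨R, hR, fun d g hg => ?_⟩
  obtain ⟨s, hs⟩ := h d g hg
  refine ⟨s, (elt _ d).injective ?_⟩
  rw [elt_rep, elt_cst, hs]

/-- Sections that become equal in the associated sheaf are equal on a covering sieve. For distinct
constants that sieve is empty. -/
theorem cst_injective {S : Type u} {c : C} (hc : ⊥ ∉ J c) {s s' : S}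
    (h : cst ((rep J).obj c) s = cst ((rep J).obj c) s') : s = s' := by
  by_contra hs
  have e := congrArg (elt _ c) h
  rw [elt_cst, elt_cst] at e
  have := Presheaf.equalizerSieve_mem J (toSheafify J ((Functor.const Cᵒᵖ).obj S))
    (X := op c) s s' e
  refine hc (J.superset_covering ?_ this)
  intro d g hg
  exact hs hg

/-! #### Points of components -/

theorem exists_component_pt {A H : Sheaf J (Type u)} {S : Type u} (ζ : H ⟶ (γ J).obj S) (s : S)
    (x : A ⟶ H) (hx : x ≫ ζ = cst A s) : ∃ y : A ⟶ component ζ s, y ≫ componentι ζ s = x :=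
  ⟨pullback.lift x _ hx, pullback.lift_fst _ _ _⟩

@[simp]
theorem componentι_comp {H : Sheaf J (Type u)} {S : Type u} (ζ : H ⟶ (γ J).obj S) (s : S) :
    componentι ζ s ≫ ζ = cst _ s := by
  rw [component_condition, cst]
  congr 1
  exact (Types.isTerminalPUnit.isTerminalObj (γ J) _).hom_ext _ _

instance {H : Sheaf J (Type u)} {S : Type u} (ζ : H ⟶ (γ J).obj S) (s : S) :
    Mono (componentι ζ s) :=
  ⟨fun _ _ h => component_hom_ext _ _ h⟩

/-! #### Points of associated sheaves -/

/-- The point of the associated sheaf given by a section of the presheaf. -/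
def pt {P : Cᵒᵖ ⥤ Type u} {c : C} (p : P.obj (op c)) :
    (rep J).obj c ⟶ (presheafToSheaf J (Type u)).obj P :=
  (presheafToSheaf J (Type u)).map (yonedaEquiv.symm p)

theorem rep_map_pt {P : Cᵒᵖ ⥤ Type u} {c d : C} (g : d ⟶ c) (p : P.obj (op c)) :
    (rep J).map g ≫ pt p = pt (J := J) (P.map g.op p) := by
  rw [pt, pt]
  change (presheafToSheaf J (Type u)).map _ ≫ _ = _
  rw [← Functor.map_comp]
  congr 1
  apply yonedaEquiv.injective
  erw [← yonedaEquiv_naturality]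
  simp

theorem pt_map {P P' : Cᵒᵖ ⥤ Type u} (f : P ⟶ P') {c : C} (p : P.obj (op c)) :
    pt p ≫ (presheafToSheaf J (Type u)).map f = pt (J := J) (f.app _ p) := by
  rw [pt, pt, ← Functor.map_comp]
  congr 1
  apply yonedaEquiv.injective
  simp [yonedaEquiv_comp]

theorem elt_pt {P : Cᵒᵖ ⥤ Type u} {c : C} (p : P.obj (op c)) :
    elt _ c (pt (J := J) p) = (toSheafify J P).app _ p := by
  have e : toSheafify J _ ≫ sheafifyMap J (yonedaEquiv.symm p) = yonedaEquiv.symm p ≫ toSheafify J P :=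
    (toSheafify_naturality J (yonedaEquiv.symm p)).symm
  have e' : elt _ c (pt (J := J) p) =
      yonedaEquiv (toSheafify J _ ≫ sheafifyMap J (yonedaEquiv.symm p)) := by
    simp only [elt, Equiv.trans_apply, Adjunction.homEquiv_unit, pt]
    rfl
  rw [e', e, yonedaEquiv_comp, Equiv.apply_symm_apply]

theorem loc_pt {P : Cᵒᵖ ⥤ Type u} {c : C} (x : (rep J).obj c ⟶ (presheafToSheaf J (Type u)).obj P) :
    Loc J c fun d g => ∃ p : P.obj (op d), (rep J).map g ≫ x = pt p := by
  refine ⟨_, Presheaf.imageSieve_mem J (toSheafify J P) (elt _ c x), ?_⟩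
  rintro d g ⟨p, hp⟩
  refine ⟨p, (elt _ d).injective ?_⟩
  rw [elt_rep, elt_pt]
  exact hp.symm

theorem loc_eq_of_pt_eq {P : Cᵒᵖ ⥤ Type u} {c : C} {p q : P.obj (op c)}
    (h : pt (J := J) p = pt q) : Loc J c fun _ g => P.map g.op p = P.map g.op q := by
  have e := congrArg (elt _ c) h
  rw [elt_pt, elt_pt] at e
  have := Presheaf.equalizerSieve_mem J (toSheafify J P) (X := op c) p q e
  exact ⟨_, this, fun d g hg => hg⟩

theorem hom_ext_of_pt {P : Cᵒᵖ ⥤ Type u} {Y : Sheaf J (Type u)}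
    {f g : (presheafToSheaf J (Type u)).obj P ⟶ Y}
    (h : ∀ (c : C) (p : P.obj (op c)), pt p ≫ f = pt p ≫ g) : f = g := by
  refine hom_ext_pt fun c x => pt_ext ((loc_pt x).mono ?_)
  rintro d k ⟨p, hp⟩
  rw [← Category.assoc, ← Category.assoc, hp, h]

/-- A natural operation on sections of a presheaf defines a morphism from the associated sheaf. -/
theorem exists_hom_of_presheaf {P : Cᵒᵖ ⥤ Type u} {Y : Sheaf J (Type u)}
    (F : ∀ c : C, P.obj (op c) → ((rep J).obj c ⟶ Y))
    (hF : ∀ {c d : C} (g : d ⟶ c) (p : P.obj (op c)),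
      F d (P.map g.op p) = (rep J).map g ≫ F c p) :
    ∃ f : (presheafToSheaf J (Type u)).obj P ⟶ Y, ∀ (c : C) (p : P.obj (op c)),
      pt p ≫ f = F c p := by
  let φ : P ⟶ Y.obj :=
    { app := fun c => ↾ fun p => elt Y c.unop (F c.unop p)
      naturality := fun c d g => by
        ext p
        change elt Y d.unop (F d.unop (P.map g.unop.op p)) =
          Y.obj.map g.unop.op (elt Y c.unop (F c.unop p))
        rw [hF, elt_rep] }
  refine ⟨((sheafificationAdjunction J (Type u)).homEquiv _ _).symm φ, fun c p => ?_⟩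
  apply (elt Y c).injective
  rw [elt_comp, elt_pt]
  have := ((sheafificationAdjunction J (Type u)).homEquiv _ _).apply_symm_apply φ
  rw [Adjunction.homEquiv_unit] at this
  exact ConcreteCategory.congr_hom (NatTrans.congr_app this (op c)) p

theorem cst_eq_pt {S : Type u} (c : C) (s : S) :
    cst ((rep J).obj c) s = pt (P := (Functor.const Cᵒᵖ).obj S) (c := c) s := by
  apply (elt _ c).injective
  rw [elt_cst]
  exact (elt_pt (P := (Functor.const Cᵒᵖ).obj S) s).symm

/-! #### Jointly epimorphic classes of morphisms -/

/-- If two morphisms out of `Z` agree as soon as they agree on the points in the class `Q`, then all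
points of `Z` are locally in `Q`. -/
theorem loc_of_jointly_epi {Z : Sheaf J (Type u)} (Q : ∀ c : C, ((rep J).obj c ⟶ Z) → Prop)
    (hQ : ∀ {c d : C} (g : d ⟶ c) (z), Q c z → Q d ((rep J).map g ≫ z))
    (h : ∀ (Y : Sheaf J (Type u)) (f g : Z ⟶ Y),
      (∀ (c : C) (z : (rep J).obj c ⟶ Z), Q c z → z ≫ f = z ≫ g) → f = g)
    {c : C} (z : (rep J).obj c ⟶ Z) : Loc J c fun d g => Q d ((rep J).map g ≫ z) := by
  let S (c : C) (z : (rep J).obj c ⟶ Z) : Sieve c :=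
    { arrows := fun d g => Q d ((rep J).map g ≫ z)
      downward_closed := fun {d e g} hg k => by
        rw [Functor.map_comp, Category.assoc]
        exact hQ k _ hg }
  have hS {c d : C} (g : d ⟶ c) (z) : S d ((rep J).map g ≫ z) = (S c z).pullback g := by
    ext e k
    change Q e _ ↔ Q e ((rep J).map (k ≫ g) ≫ z)
    rw [Functor.map_comp, Category.assoc]
  -- The two test morphisms go to the sheaf of closed sieves, the subobject classifier: the
  -- characteristic map of the points locally in `Q`, and the constant map `true`. They agree on
  -- `Q`, hence everywhere, so the sieve where `z` lies in `Q` has closure `⊤` and is covering.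
  let Ω : Sheaf J (Type u) := ⟨(Functor.closedSieves J).toFunctor,
    (isSheaf_iff_isSheaf_of_type J _).2 (classifier_isSheaf J)⟩
  let el (c : C) (S : Sieve c) : Ω.obj.obj (op c) := ⟨J.close S, J.close_isClosed S⟩
  have hel {c d : C} (g : d ⟶ c) (S : Sieve c) : Ω.obj.map g.op (el c S) = el d (S.pullback g) :=
    Subtype.ext (J.pullback_close g S).symm
  obtain ⟨f, hf⟩ := exists_hom_of_pt (X := Z) (Y := Ω) (fun c z => (elt Ω c).symm (el c (S c z)))
    fun g z => (elt Ω _).injective (by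
      rw [Equiv.apply_symm_apply, elt_rep, Equiv.apply_symm_apply, hel, hS])
  obtain ⟨t, ht⟩ := exists_hom_of_pt (X := Z) (Y := Ω) (fun c _ => (elt Ω c).symm (el c ⊤))
    fun g z => (elt Ω _).injective (by
      rw [Equiv.apply_symm_apply, elt_rep, Equiv.apply_symm_apply, hel, Sieve.pullback_top])
  have e : f = t := h Ω f t fun c z hz => by
    rw [hf, ht]
    congr 2
    exact (Sieve.id_mem_iff_eq_top).1 (by
      change Q _ ((rep J).map (𝟙 c) ≫ z)
      rwa [CategoryTheory.Functor.map_id, Category.id_comp])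
  have e' := (hf c z).symm.trans ((congrArg (z ≫ ·) e).trans (ht c z))
  have e'' : J.close (S c z) = J.close ⊤ := congrArg Subtype.val ((elt Ω c).symm.injective e')
  rw [top_le_iff.1 (J.le_close ⊤), J.close_eq_top_iff_mem] at e''
  exact ⟨_, e'', fun d g hg => hg⟩

end Points

section Trivializations

variable {C : Type u} [SmallCategory C] {J : GrothendieckTopology C}

attribute [local simp] prod.lift_fst prod.lift_snd prod.lift_fst_assoc prod.lift_snd_assoc

/-! ### Trivializations as families of morphisms -/

/-- The copy of `V` in `γ^* R × V` given by `r : R`. -/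
def copy {R : Type u} (V : Sheaf J (Type u)) (r : R) : V ⟶ (γ J).obj R ⨯ V :=
  prod.lift (cst V r) (𝟙 V)

theorem comp_copy {R : Type u} {A V : Sheaf J (Type u)} (f : A ⟶ V) (r : R) :
    f ≫ copy V r = prod.lift (cst A r) f := by
  rw [copy, prod.comp_lift, comp_cst, Category.comp_id]

theorem loc_copy {R : Type u} {V : Sheaf J (Type u)} {c : C}
    (z : (rep J).obj c ⟶ (γ J).obj R ⨯ V) :
    Loc J c fun _ g => ∃ r : R, ((rep J).map g ≫ z ≫ prod.snd) ≫ copy V r = (rep J).map g ≫ z := by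
  refine (loc_cst (z ≫ prod.fst)).mono ?_
  rintro d g ⟨r, hr⟩
  refine ⟨r, ?_⟩
  rw [comp_copy, ← hr]
  apply Limits.prod.hom_ext <;> simp

theorem hom_ext_copy {R : Type u} {V Y : Sheaf J (Type u)} {f g : (γ J).obj R ⨯ V ⟶ Y}
    (h : ∀ r : R, copy V r ≫ f = copy V r ≫ g) : f = g := by
  refine hom_ext_of_loc_surj (copy V) (fun c z => (loc_copy z).mono ?_) h
  rintro d k ⟨r, hr⟩
  exact ⟨r, _, hr⟩

/-- A family of morphisms `V ⟶ X` indexed by `R` which is locally bijective on points over `V`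
gives an isomorphism `γ^* R × V ≅ X × V` over `V`. -/
theorem exists_iso_of_family {R : Type u} {V X : Sheaf J (Type u)} (p : R → (V ⟶ X))
    (hinj : ∀ (c : C) (v : (rep J).obj c ⟶ V) (r r' : R), ⊥ ∉ J c → v ≫ p r = v ≫ p r' → r = r')
    (hsurj : ∀ (c : C) (v : (rep J).obj c ⟶ V) (x : (rep J).obj c ⟶ X),
      Loc J c fun _ g => ∃ r : R, (rep J).map g ≫ v ≫ p r = (rep J).map g ≫ x) :
    ∃ θ : (γ J).obj R ⨯ V ≅ X ⨯ V, θ.hom ≫ prod.snd = prod.snd ∧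
      ∀ r, copy V r ≫ θ.hom ≫ prod.fst = p r := by
  -- The copies of `V` cover `γ^* R × V` and are disjoint at non-empty stages, so the maps `p r`
  -- glue without any condition.
  obtain ⟨act, hact⟩ := exists_desc (copy V) p
    (fun c z => (loc_copy z).mono fun d k ⟨r, hr⟩ => ⟨r, _, hr⟩) (by
      intro c r r' v w h
      rw [comp_copy, comp_copy] at h
      obtain rfl : v = w := by simpa using h =≫ prod.snd
      refine pt_ext (Loc.of_not_bot fun hc => ?_)
      rw [cst_injective hc (s := r) (s' := r') (by simpa using h =≫ prod.fst)]
      exact Loc.of_forall fun _ _ => rfl)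
  have : IsIso (prod.lift act (prod.snd : (γ J).obj R ⨯ V ⟶ V)) := by
    refine isIso_of_pt _ (fun c x y h => ?_) fun c y => ?_
    · have h₁ : x ≫ act = y ≫ act := by simpa using h =≫ prod.fst
      have h₂ : x ≫ prod.snd = y ≫ prod.snd := by simpa using h =≫ prod.snd
      refine pt_ext (((loc_copy x).and (loc_copy y)).bind ?_)
      rintro d g ⟨⟨r, hr⟩, r', hr'⟩
      refine Loc.of_not_bot fun hd => Loc.of_forall fun e k => ?_
      have : r = r' := by
        refine hinj d ((rep J).map g ≫ x ≫ prod.snd) r r' hd ?_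
        rw [← hact, ← Category.assoc, hr, Category.assoc, h₁, ← Category.assoc, ← hr',
          Category.assoc, hact, h₂]
      rw [Functor.map_comp, Category.assoc, Category.assoc, ← hr, ← hr', h₂, this]
    · refine (hsurj c (y ≫ prod.snd) (y ≫ prod.fst)).mono ?_
      rintro d g ⟨r, hr⟩
      refine ⟨((rep J).map g ≫ y ≫ prod.snd) ≫ copy V r, ?_⟩
      have : (((rep J).map g ≫ y ≫ prod.snd) ≫ copy V r) ≫ act = (rep J).map g ≫ y ≫ prod.fst := by
        rw [Category.assoc, hact, ← hr]
        simp only [Category.assoc]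
      rw [prod.comp_lift, this, comp_copy]
      apply Limits.prod.hom_ext <;> simp
  refine ⟨asIso (prod.lift act prod.snd), by simp, fun r => by simp [hact]⟩

/-! ### Leaves of a trivialization and action spans -/

namespace Trivialization

variable {𝒰 : Cover J} {X : Sheaf J (Type u)} {R : 𝒰.I → Type u} (T : Trivialization 𝒰 X R)

/-- The restriction `U_i ⟶ X` of `θ_i` to the copy of `U_i` given by `r : R_i`. -/
def leaf (i : 𝒰.I) (r : R i) : 𝒰.comp i ⟶ X :=
  copy _ r ≫ (T.θ i).hom ≫ prod.fst

theorem lift_cst_θ {A : Sheaf J (Type u)} (i : 𝒰.I) (r : R i) (v : A ⟶ 𝒰.comp i) :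
    prod.lift (cst A r) v ≫ (T.θ i).hom ≫ prod.fst = v ≫ T.leaf i r := by
  rw [leaf, ← comp_copy, Category.assoc]

theorem leaf_injective {i : 𝒰.I} {r r' : R i} {c : C} (v : (rep J).obj c ⟶ 𝒰.comp i)
    (hc : ⊥ ∉ J c) (h : v ≫ T.leaf i r = v ≫ T.leaf i r') : r = r' := by
  rw [← lift_cst_θ, ← lift_cst_θ] at h
  have : prod.lift (cst _ r) v ≫ (T.θ i).hom = prod.lift (cst _ r') v ≫ (T.θ i).hom := by
    apply Limits.prod.hom_ext
    · simpa using h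
    · simp [T.comm_snd]
  rw [cancel_mono] at this
  exact cst_injective hc (by simpa using this =≫ prod.fst)

theorem loc_leaf {i : 𝒰.I} {c : C} (v : (rep J).obj c ⟶ 𝒰.comp i) (x : (rep J).obj c ⟶ X) :
    Loc J c fun _ g => ∃ r : R i, (rep J).map g ≫ v ≫ T.leaf i r = (rep J).map g ≫ x := by
  refine (loc_copy (prod.lift x v ≫ (T.θ i).inv)).mono ?_
  have e : (T.θ i).inv ≫ prod.snd = prod.snd := by rw [Iso.inv_comp_eq, T.comm_snd]
  rintro d g ⟨r, hr⟩
  refine ⟨r, ?_⟩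
  rw [Category.assoc _ _ prod.snd, e, prod.lift_snd] at hr
  rw [leaf, ← Category.assoc v, ← Category.assoc, ← Category.assoc _ v, hr]
  simp

theorem eq_of_leaf {X' : Sheaf J (Type u)} (T' : Trivialization 𝒰 X' R) (e : X ⟶ X') (i : 𝒰.I) :
    (T.θ i).hom ≫ prod.map e (𝟙 (𝒰.comp i)) = (T'.θ i).hom ↔
      ∀ r, T.leaf i r ≫ e = T'.leaf i r := by
  refine ⟨fun h r => ?_, fun h => ?_⟩
  · rw [leaf, leaf, ← h]
    simp
  · apply Limits.prod.hom_ext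
    · refine hom_ext_copy fun r => ?_
      simpa [leaf] using h r
    · simp [T.comm_snd, T'.comm_snd]

/-- `σ_{j,i}` is the symmetry `X × τ` conjugated by the isomorphisms `a` induced by `θ_i` and `θ_j`.
Moving the second of them to the other side, both morphisms are compared in `X × (U_j × U_i)`,
component by component. -/
theorem comp_σ_eq_iff {i j : 𝒰.I} {A : Sheaf J (Type u)}
    (m : A ⟶ (γ J).obj (R i) ⨯ (𝒰.comp i ⨯ 𝒰.comp j))
    (n : A ⟶ (γ J).obj (R j) ⨯ (𝒰.comp j ⨯ 𝒰.comp i)) :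
    m ≫ (T.σ i j).hom = n ↔
      m ≫ prod.map (𝟙 _) prod.fst ≫ (T.θ i).hom ≫ prod.fst =
          n ≫ prod.map (𝟙 _) prod.fst ≫ (T.θ j).hom ≫ prod.fst ∧
        m ≫ prod.snd ≫ (prod.braiding _ _).hom = n ≫ prod.snd := by
  let a (i j : 𝒰.I) : (γ J).obj (R i) ⨯ (𝒰.comp i ⨯ 𝒰.comp j) ≅ X ⨯ (𝒰.comp i ⨯ 𝒰.comp j) :=
    (Limits.prod.associator _ _ _).symm ≪≫ prod.mapIso (T.θ i) (Iso.refl (𝒰.comp j)) ≪≫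
      Limits.prod.associator _ _ _
  have ha (i j) : (a i j).hom =
      prod.lift (prod.map (𝟙 _) prod.fst ≫ (T.θ i).hom ≫ prod.fst) prod.snd := by
    have h := T.comm_snd i
    have e : prod.lift prod.fst (prod.snd ≫ prod.fst) =
      prod.map (𝟙 ((γ J).obj (R i))) (prod.fst : 𝒰.comp i ⨯ 𝒰.comp j ⟶ _) := by apply Limits.prod.hom_ext <;> simp
    have e' : prod.lift (prod.snd ≫ prod.fst) (prod.snd ≫ prod.snd) =
      (prod.snd : (γ J).obj (R i) ⨯ (𝒰.comp i ⨯ 𝒰.comp j) ⟶ _) := by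
        apply Limits.prod.hom_ext <;> simp
    apply Limits.prod.hom_ext <;> simp [a, h, e, e']
  have hσ : (T.σ i j).hom = (a i j).hom ≫ prod.map (𝟙 X) (prod.braiding _ _).hom ≫ (a j i).inv := by
    simp only [σ, a, Iso.trans_hom, Iso.trans_inv, Iso.symm_hom, Iso.symm_inv, Category.assoc,
      prod.mapIso_hom, Iso.refl_hom]
  rw [hσ, ← Category.assoc, ← Category.assoc, Iso.comp_inv_eq, ha, ha, Category.assoc]
  refine ⟨fun h => ⟨by simpa using h =≫ prod.fst, by simpa using h =≫ prod.snd⟩, fun h => ?_⟩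
  apply Limits.prod.hom_ext
  · simpa using h.1
  · simpa using h.2

/-- The components in `U_j × U_i` agree automatically, and the components in `X` can be tested on
the copies of `V` in `γ^* R_i × V`, where `θ_i` and `θ_j` are given by leaves. -/
theorem map_lift_σ_iff {i j : 𝒰.I} {V : Sheaf J (Type u)} (u : V ⟶ 𝒰.comp i) (v : V ⟶ 𝒰.comp j)
    (s : R i ≃ R j) :
    prod.map (𝟙 _) (prod.lift u v) ≫ (T.σ i j).hom =
        prod.map ((γ J).map s.toIso.hom) (𝟙 V) ≫ prod.map (𝟙 _) (prod.lift v u) ↔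
      ∀ r, u ≫ T.leaf i r = v ≫ T.leaf j (s r) := by
  rw [comp_σ_eq_iff, and_iff_left (by apply Limits.prod.hom_ext <;> simp)]
  have e₁ (r : R i) : copy V r ≫ prod.map (𝟙 _) (prod.lift u v) ≫ prod.map (𝟙 _) prod.fst ≫
      (T.θ i).hom ≫ prod.fst = u ≫ T.leaf i r := by
    rw [← lift_cst_θ, copy]
    simp
  have e₂ (r : R i) : copy V r ≫ (prod.map ((γ J).map s.toIso.hom) (𝟙 V) ≫
      prod.map (𝟙 _) (prod.lift v u)) ≫ prod.map (𝟙 _) prod.fst ≫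
      (T.θ j).hom ≫ prod.fst = v ≫ T.leaf j (s r) := by
    rw [← lift_cst_θ, copy, ← show _ = cst V (s r) from cst_map V s.toIso.hom r]
    simp
  refine ⟨fun h r => ?_, fun h => hom_ext_copy fun r => ?_⟩
  · rw [← e₁, ← e₂, h]
  · rw [e₁, e₂, h]

theorem isActionSpan_iff {i j : 𝒰.I} {V : Sheaf J (Type u)} (u : V ⟶ 𝒰.comp i)
    (v : V ⟶ 𝒰.comp j) : T.IsActionSpan u v ↔
      ¬ IsEmptyObj V ∧ ∃ s : R i ≃ R j, ∀ r, u ≫ T.leaf i r = v ≫ T.leaf j (s r) := by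
  simp only [IsActionSpan, map_lift_σ_iff]

theorem exists_of_family (p : ∀ i : 𝒰.I, R i → (𝒰.comp i ⟶ X))
    (hinj : ∀ (i : 𝒰.I) (c : C) (v : (rep J).obj c ⟶ 𝒰.comp i) (r r' : R i), ⊥ ∉ J c →
      v ≫ p i r = v ≫ p i r' → r = r')
    (hsurj : ∀ (i : 𝒰.I) (c : C) (v : (rep J).obj c ⟶ 𝒰.comp i) (x : (rep J).obj c ⟶ X),
      Loc J c fun _ g => ∃ r : R i, (rep J).map g ≫ v ≫ p i r = (rep J).map g ≫ x) :
    ∃ T : Trivialization 𝒰 X R, ∀ i r, T.leaf i r = p i r := by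
  choose θ h₁ h₂ using fun i => exists_iso_of_family (p i) (hinj i) (hsurj i)
  exact ⟨⟨θ, h₁⟩, h₂⟩

/-- In a covering projection, any two points of the cover are locally in an action span. -/
theorem IsCoveringProjection.loc_action (h : T.IsCoveringProjection) {i j : 𝒰.I} {c : C}
    (u : (rep J).obj c ⟶ 𝒰.comp i) (v : (rep J).obj c ⟶ 𝒰.comp j) :
    Loc J c fun _ g => ∃ s : R i ≃ R j,
      ∀ r, (rep J).map g ≫ u ≫ T.leaf i r = (rep J).map g ≫ v ≫ T.leaf j (s r) := by
  refine Loc.of_not_bot fun hc => ?_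
  have hne : ¬ IsEmptyObj (𝒰.comp i ⨯ 𝒰.comp j) :=
    not_isEmptyObj_iff.2 ⟨c, prod.lift u v, hc⟩
  -- The class consists of the points of `U_i × U_j` over which a single bijection describes the
  -- action. It contains all points that factor through an action span, and these spans are jointly
  -- epimorphic.
  refine (loc_of_jointly_epi (Z := 𝒰.comp i ⨯ 𝒰.comp j) (fun c z => ∃ s : R i ≃ R j,
    ∀ r, z ≫ prod.fst ≫ T.leaf i r = z ≫ prod.snd ≫ T.leaf j (s r)) ?_ ?_ (prod.lift u v)).mono ?_
  · rintro c d g z ⟨s, hs⟩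
    exact ⟨s, fun r => by rw [Category.assoc, hs, Category.assoc]⟩
  · intro Y f g hfg
    refine h i j hne Y f g fun V u v huv => hom_ext_pt fun c z => ?_
    obtain ⟨-, s, hs⟩ := (T.isActionSpan_iff u v).1 huv
    rw [← Category.assoc, ← Category.assoc]
    refine hfg c _ ⟨s, fun r => ?_⟩
    simp [hs r]
  · rintro d g ⟨s, hs⟩
    exact ⟨s, fun r => by simpa using hs r⟩

end Trivialization

/-! ### Simplicial identities and duality on components -/

namespace SimplicialFamily

variable (X : SimplicialFamily J)

/-- The inclusion of `(H_0)_i` in `H_0`. -/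
def vertι (i : X.S _⦋0⦌) : X.vert i ⟶ X.H _⦋0⦌ := componentι (X.ζ.app (op ⦋0⦌)) i

/-- The inclusion of `(H_1)_ℓ` in `H_1`. -/
def arrι {i j : X.S _⦋0⦌} (ℓ : SSet.Edge i j) : X.arr ℓ ⟶ X.H _⦋1⦌ :=
  componentι (X.ζ.app (op ⦋1⦌)) ℓ.edge

/-- The inclusion of `(H_2)_w` in `H_2`. -/
def triι {i j k : X.S _⦋0⦌} {ℓ : SSet.Edge i j} {r : SSet.Edge j k} {t : SSet.Edge i k}
    (w : SSet.Edge.CompStruct ℓ r t) : X.tri w ⟶ X.H _⦋2⦌ :=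
  componentι (X.ζ.app (op ⦋2⦌)) w.simplex

/-- The component `H_n ⟶ γ^* S_n` of the structure morphism. -/
def index (n : ℕ) : X.H _⦋n⦌ ⟶ (γ J).obj (X.S _⦋n⦌) := X.ζ.app (op ⦋n⦌)

theorem δ_index (n : ℕ) (a : Fin (n + 2)) :
    X.H.δ a ≫ X.index n = X.index (n + 1) ≫ (γ J).map (X.S.δ a) :=
  X.ζ.naturality _

instance (i : X.S _⦋0⦌) : Mono (X.vertι i) :=
  ⟨fun _ _ h => component_hom_ext _ _ h⟩

theorem vertι_index (i : X.S _⦋0⦌) : X.vertι i ≫ X.index 0 = cst _ i :=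
  componentι_comp _ _

theorem arrι_index {i j : X.S _⦋0⦌} (ℓ : SSet.Edge i j) :
    X.arrι ℓ ≫ X.index 1 = cst _ ℓ.edge :=
  componentι_comp _ _

theorem exists_vert_pt {A : Sheaf J (Type u)} {i : X.S _⦋0⦌} (x : A ⟶ X.H _⦋0⦌)
    (hx : x ≫ X.index 0 = cst A i) : ∃ y : A ⟶ X.vert i, y ≫ X.vertι i = x :=
  exists_component_pt _ _ x hx

theorem exists_arr_pt {A : Sheaf J (Type u)} {i j : X.S _⦋0⦌} (ℓ : SSet.Edge i j)
    (x : A ⟶ X.H _⦋1⦌) (hx : x ≫ X.index 1 = cst A ℓ.edge) :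
    ∃ y : A ⟶ X.arr ℓ, y ≫ X.arrι ℓ = x :=
  exists_component_pt _ _ x hx

section

variable {i j : X.S _⦋0⦌} (ℓ : SSet.Edge i j)

theorem d₁_ι : X.d₁ ℓ ≫ X.vertι i = X.arrι ℓ ≫ X.H.δ 1 :=
  componentMap_fst _ _ _ _ (X.ζ.naturality _) _ _ ℓ.src_eq

theorem d₀_ι : X.d₀ ℓ ≫ X.vertι j = X.arrι ℓ ≫ X.H.δ 0 :=
  componentMap_fst _ _ _ _ (X.ζ.naturality _) _ _ ℓ.tgt_eq

theorem s₀_ι : X.s₀ i ≫ X.arrι (SSet.Edge.id i) = X.vertι i ≫ X.H.σ 0 :=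
  componentMap_fst _ _ _ _ (X.ζ.naturality _) _ _ rfl

end

section

variable {i j k : X.S _⦋0⦌} {ℓ : SSet.Edge i j} {r : SSet.Edge j k} {t : SSet.Edge i k}
  (w : SSet.Edge.CompStruct ℓ r t)

theorem face₂_ι : X.face₂ w ≫ X.arrι ℓ = X.triι w ≫ X.H.δ 2 :=
  componentMap_fst _ _ _ _ (X.ζ.naturality _) _ _ w.d₂

theorem face₁_ι : X.face₁ w ≫ X.arrι t = X.triι w ≫ X.H.δ 1 :=
  componentMap_fst _ _ _ _ (X.ζ.naturality _) _ _ w.d₁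

theorem face₀_ι : X.face₀ w ≫ X.arrι r = X.triι w ≫ X.H.δ 0 :=
  componentMap_fst _ _ _ _ (X.ζ.naturality _) _ _ w.d₀

theorem face₂_d₁ : X.face₂ w ≫ X.d₁ ℓ = X.face₁ w ≫ X.d₁ t := by
  rw [← cancel_mono (X.vertι i), Category.assoc, Category.assoc, d₁_ι, d₁_ι, ← Category.assoc,
    ← Category.assoc, face₂_ι, face₁_ι, Category.assoc, Category.assoc]
  exact congrArg _ (X.H.δ_comp_δ (i := 1) (j := 1) le_rfl)

theorem face₂_d₀ : X.face₂ w ≫ X.d₀ ℓ = X.face₀ w ≫ X.d₁ r := by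
  rw [← cancel_mono (X.vertι j), Category.assoc, Category.assoc, d₁_ι, d₀_ι, ← Category.assoc,
    ← Category.assoc, face₂_ι, face₀_ι, Category.assoc, Category.assoc]
  exact congrArg _ (X.H.δ_comp_δ (i := 0) (j := 1) (Fin.zero_le _))

theorem face₁_d₀ : X.face₁ w ≫ X.d₀ t = X.face₀ w ≫ X.d₀ r := by
  rw [← cancel_mono (X.vertι k), Category.assoc, Category.assoc, d₀_ι, d₀_ι, ← Category.assoc,
    ← Category.assoc, face₁_ι, face₀_ι, Category.assoc, Category.assoc]
  exact congrArg _ (X.H.δ_comp_δ (i := 0) (j := 0) le_rfl)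

theorem s₀_d₁ (i : X.S _⦋0⦌) : X.s₀ i ≫ X.d₁ (SSet.Edge.id i) = 𝟙 _ := by
  rw [← cancel_mono (X.vertι i), Category.assoc, d₁_ι, ← Category.assoc, s₀_ι, Category.assoc,
    Category.id_comp]
  exact (congrArg _ (X.H.δ_comp_σ_succ (i := 0))).trans (Category.comp_id _)

theorem s₀_d₀ (i : X.S _⦋0⦌) : X.s₀ i ≫ X.d₀ (SSet.Edge.id i) = 𝟙 _ := by
  rw [← cancel_mono (X.vertι i), Category.assoc, d₀_ι, ← Category.assoc, s₀_ι, Category.assoc,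
    Category.id_comp]
  exact (congrArg _ (X.H.δ_comp_σ_self (i := 0))).trans (Category.comp_id _)

end

end SimplicialFamily

namespace SelfDualFamily

variable (X : SelfDualFamily J) {i j : X.S _⦋0⦌} (ℓ : SSet.Edge i j)

theorem τ₁_ι : (X.τ₁ ℓ).hom ≫ X.arrι (X.opp ℓ) = X.arrι ℓ ≫ (X.dualH.τ 1).hom :=
  componentMap_fst _ _ _ _ (X.τ_ζ 1) _ _ rfl

theorem τ₁_d₁ : (X.τ₁ ℓ).hom ≫ X.d₁ (X.opp ℓ) = X.d₀ ℓ := by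
  have h := X.dualH.τ_δ 0 1
  rw [X.dualH.τ_zero, Iso.refl_hom, Category.comp_id] at h
  rw [← cancel_mono (X.vertι j), Category.assoc, X.d₁_ι, ← Category.assoc, X.τ₁_ι, Category.assoc,
    X.d₀_ι]
  exact congrArg _ h

theorem τ₁_d₀ : (X.τ₁ ℓ).hom ≫ X.d₀ (X.opp ℓ) = X.d₁ ℓ := by
  have h := X.dualH.τ_δ 0 0
  rw [X.dualH.τ_zero, Iso.refl_hom, Category.comp_id] at h
  rw [← cancel_mono (X.vertι i), Category.assoc, X.d₀_ι, ← Category.assoc, X.τ₁_ι, Category.assoc,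
    X.d₁_ι]
  exact congrArg _ h

end SelfDualFamily

namespace HypercoverRefinement

variable {𝒰 : Cover J} (X : HypercoverRefinement 𝒰) {R : 𝒰.I → Type u}

/-- Since `τ_0 = id`, the isomorphism `(τ_1)_ℓ` exchanges the two legs of the span of `ℓ`. Composed
with `(h_1)_{ℓ^op}` it gives `(d_0, d_1)`, so the correspondence over `ℓ` is the action span
equation for `(d_1, d_0)` and `s_ℓ`. -/
theorem induces_iff {Y : Sheaf J (Type u)} (T : Trivialization 𝒰 Y R)
    (s : SetDescentDatum X.S fun i => R (X.idx i)) :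
    T.Induces X (s.induced X.toSelfDualFamily) ↔
      ∀ ⦃i j : X.S _⦋0⦌⦄ (ℓ : SSet.Edge i j) (r : R (X.idx i)),
        (X.d₁ ℓ ≫ X.toComp i) ≫ T.leaf _ r = (X.d₀ ℓ ≫ X.toComp j) ≫ T.leaf _ (s.s ℓ r) := by
  refine forall_congr' fun i => forall_congr' fun j => forall_congr' fun ℓ => ?_
  rw [← T.map_lift_σ_iff]
  have : (X.τ₁ ℓ).hom ≫ X.h₁ (X.opp ℓ) =
      prod.lift (X.d₀ ℓ ≫ X.toComp j) (X.d₁ ℓ ≫ X.toComp i) := by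
    rw [h₁, prod.comp_lift, ← Category.assoc, ← Category.assoc, X.τ₁_d₀, X.τ₁_d₁]
  have e : ((s.induced X.toSelfDualFamily).σ ℓ).hom ≫ prod.map (𝟙 _) (X.h₁ (X.opp ℓ)) =
      prod.map ((γ J).map (s.s ℓ).toIso.hom) (𝟙 _) ≫
        prod.map (𝟙 _) (prod.lift (X.d₀ ℓ ≫ X.toComp j) (X.d₁ ℓ ≫ X.toComp i)) := by
    rw [← this]
    simp [SetDescentDatum.induced]
  rw [e]
  rfl

end HypercoverRefinement

end Trivializations

section Coskeleta

variable {C : Type u} [SmallCategory C] {J : GrothendieckTopology C}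

/-! ### Coskeleta -/

variable (H : SimplicialObject (Sheaf J (Type u)))

/-- The projection of `(cosk_k H)_n` to `H_m` given by an operator `[m] ⟶ [n]`, `m ≤ k`. -/
def coskLeg (k n : ℕ) {x : SimplexCategory} (hx : x.len ≤ k) (θ : x ⟶ ⦋n⦌) :
    ((SimplicialObject.cosk k).obj H) _⦋n⦌ ⟶ H.obj (op x) :=
  ((SimplicialObject.cosk k).obj H).map θ.op ≫
    ((SimplicialObject.coskAdj k).counit.app ((SimplicialObject.truncation k).obj H)).app
      (op ⟨x, hx⟩)

/-- The unit of the adjunction, in degree `n`. -/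
def toCosk (k n : ℕ) : H _⦋n⦌ ⟶ ((SimplicialObject.cosk k).obj H) _⦋n⦌ :=
  ((SimplicialObject.coskAdj k).unit.app H).app (op ⦋n⦌)

theorem toCosk_leg (k n : ℕ) {x : SimplexCategory} (hx : x.len ≤ k) (θ : x ⟶ ⦋n⦌) :
    toCosk H k n ≫ coskLeg H k n hx θ = H.map θ.op := by
  have h := NatTrans.congr_app ((SimplicialObject.coskAdj k).left_triangle_components H)
    (op ⟨x, hx⟩)
  have h' := ((SimplicialObject.coskAdj k).unit.app H).naturality θ.op
  exact (Category.assoc _ _ _).symm.trans ((congrArg (· ≫ _) h'.symm).trans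
    ((Category.assoc _ _ _).trans ((congrArg (H.map θ.op ≫ ·) h).trans (Category.comp_id _))))

theorem coskLeg_map (k n : ℕ) {x y : SimplexCategory} (hx : x.len ≤ k) (hy : y.len ≤ k)
    (θ : x ⟶ ⦋n⦌) (φ : y ⟶ x) :
    coskLeg H k n hx θ ≫ H.map φ.op = coskLeg H k n hy (φ ≫ θ) := by
  have h := ((SimplicialObject.coskAdj k).counit.app
    ((SimplicialObject.truncation k).obj H)).naturality
      (X := op ⟨x, hx⟩) (Y := op ⟨y, hy⟩) (ObjectProperty.homMk φ).op
  exact (Category.assoc _ _ _).trans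
    ((congrArg (((SimplicialObject.cosk k).obj H).map θ.op ≫ ·) h.symm).trans
      ((Category.assoc _ _ _).symm.trans (congrArg (· ≫ _)
        (((SimplicialObject.cosk k).obj H).map_comp θ.op φ.op).symm)))

/-- `(cosk_k H)_n` is the limit of the `H_m` over the operators `[m] ⟶ [n]`, `m ≤ k`. -/
def isLimitCosk (k n : ℕ) := (SimplexCategory.Truncated.inclusion k).op
  |>.isPointwiseRightKanExtensionRanCounit ((SimplicialObject.truncation k).obj H) (op ⦋n⦌)

theorem isLimitCosk_π (k n : ℕ) (f : StructuredArrow (op ⦋n⦌)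
      (SimplexCategory.Truncated.inclusion k).op) :
    ((Functor.RightExtension.mk _ ((SimplexCategory.Truncated.inclusion k).op.ranCounit.app
      ((SimplicialObject.truncation k).obj H))).coneAt (op ⦋n⦌)).π.app f =
      coskLeg H k n f.right.unop.property f.hom.unop := by
  rw [coskLeg, SimplicialObject.coskAdj, Functor.ranAdjunction_counit]
  rfl

theorem cosk_hom_ext {k n : ℕ} {A : Sheaf J (Type u)}
    {f g : A ⟶ ((SimplicialObject.cosk k).obj H) _⦋n⦌}
    (h : ∀ (x : SimplexCategory) (hx : x.len ≤ k) (θ : x ⟶ ⦋n⦌),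
      f ≫ coskLeg H k n hx θ = g ≫ coskLeg H k n hx θ) : f = g := by
  refine (isLimitCosk H k n).hom_ext fun j => ?_
  rw [isLimitCosk_π]
  exact h _ _ _

/-- The universal property of the pointwise right Kan extension, restated so that a cone is just a
family indexed by operators `[m] ⟶ [n]` with `m ≤ k`. -/
theorem cosk_exists_lift {k n : ℕ} {A : Sheaf J (Type u)}
    (f : ∀ (x : SimplexCategory), x.len ≤ k → (x ⟶ ⦋n⦌) → (A ⟶ H.obj (op x)))
    (hf : ∀ (x y : SimplexCategory) (hx : x.len ≤ k) (hy : y.len ≤ k) (θ : x ⟶ ⦋n⦌) (φ : y ⟶ x),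
      f x hx θ ≫ H.map φ.op = f y hy (φ ≫ θ)) :
    ∃ a : A ⟶ ((SimplicialObject.cosk k).obj H) _⦋n⦌,
      ∀ (x : SimplexCategory) (hx : x.len ≤ k) (θ : x ⟶ ⦋n⦌), a ≫ coskLeg H k n hx θ = f x hx θ := by
  let c : Cone (StructuredArrow.proj (op ⦋n⦌) (SimplexCategory.Truncated.inclusion k).op ⋙
      (SimplicialObject.truncation k).obj H) :=
    { pt := A
      π :=
        { app := fun j => f j.right.unop.obj j.right.unop.property j.hom.unop
          naturality := fun i j g => by
            refine (Category.id_comp _).trans ?_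
            refine Eq.trans ?_ (hf _ _ _ j.right.unop.property i.hom.unop g.right.unop.hom).symm
            congr 1
            exact congrArg Quiver.Hom.unop (StructuredArrow.w g).symm } }
  refine ⟨(isLimitCosk H k n).lift c, fun x hx θ => ?_⟩
  have := (isLimitCosk H k n).fac c (StructuredArrow.mk (Y := op (⟨x, hx⟩ : SimplexCategory.Truncated k)) θ.op)
  rw [isLimitCosk_π] at this
  exact this

end Coskeleta

section Cocycles

variable {C : Type u} [SmallCategory C] {J : GrothendieckTopology C}

/-! ### Gluing along locally constant cocycles -/

/-- A locally constant cocycle: transition bijections between the sets `R_i`, defined locally on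
the points of `V_i × V_j`, which satisfy the cocycle condition. -/
structure Cocycle (J : GrothendieckTopology C) {ι : Type u} (V : ι → Sheaf J (Type u))
    (R : ι → Type u) where
  rel {i j : ι} {c : C} (u : (rep J).obj c ⟶ V i) (v : (rep J).obj c ⟶ V j) (e : R i ≃ R j) : Prop
  restrict {i j : ι} {c d : C} (g : d ⟶ c) {u : (rep J).obj c ⟶ V i} {v : (rep J).obj c ⟶ V j}
    {e : R i ≃ R j} : rel u v e → rel ((rep J).map g ≫ u) ((rep J).map g ≫ v) e
  loc_exists {i j : ι} {c : C} (u : (rep J).obj c ⟶ V i) (v : (rep J).obj c ⟶ V j) :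
    Loc J c fun _ g => ∃ e : R i ≃ R j, rel ((rep J).map g ≫ u) ((rep J).map g ≫ v) e
  comp {i j k : ι} {c : C} {u : (rep J).obj c ⟶ V i} {v : (rep J).obj c ⟶ V j}
    {w : (rep J).obj c ⟶ V k} {e : R i ≃ R j} {f : R j ≃ R k} {q : R i ≃ R k} :
    rel u v e → rel v w f → rel u w q → ⊥ ∉ J c → q = e.trans f

namespace Cocycle

variable {ι : Type u} {V : ι → Sheaf J (Type u)} {R : ι → Type u} (T : Cocycle J V R)

/-- The cocycle condition on `(u, u, u)` says that `q` is idempotent, and an idempotent bijection is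
the identity. Together with local existence, reflexivity, symmetry and transitivity of the gluing
relation all follow from the one condition `comp`. -/
theorem eq_refl {i : ι} {c : C} {u : (rep J).obj c ⟶ V i} {q : R i ≃ R i} (h : T.rel u u q)
    (hc : ⊥ ∉ J c) : q = Equiv.refl _ := by
  have e := T.comp h h h hc
  ext r
  exact q.injective (Equiv.congr_fun e r).symm

theorem loc_refl {i : ι} {c : C} (u : (rep J).obj c ⟶ V i) :
    Loc J c fun _ g => T.rel ((rep J).map g ≫ u) ((rep J).map g ≫ u) (Equiv.refl _) := by
  refine (T.loc_exists u u).bind ?_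
  rintro d g ⟨q, hq⟩
  refine Loc.of_not_bot fun hd => Loc.of_forall fun e k => ?_
  rw [← T.eq_refl hq hd]
  simpa only [Functor.map_comp, Category.assoc] using T.restrict k hq

theorem loc_symm {i j : ι} {c : C} {u : (rep J).obj c ⟶ V i} {v : (rep J).obj c ⟶ V j}
    {e : R i ≃ R j} (h : T.rel u v e) :
    Loc J c fun _ g => T.rel ((rep J).map g ≫ v) ((rep J).map g ≫ u) e.symm := by
  refine ((T.loc_exists v u).and (T.loc_refl u)).bind ?_
  rintro d g ⟨⟨q, hq⟩, hr⟩
  refine Loc.of_not_bot fun hd => Loc.of_forall fun d' k => ?_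
  have hqe := T.comp (T.restrict g h) hq hr hd
  obtain rfl : q = e.symm := by
    ext r
    obtain ⟨r, rfl⟩ := e.surjective r
    rw [e.symm_apply_apply]
    exact (Equiv.congr_fun hqe r).symm
  simpa only [Functor.map_comp, Category.assoc] using T.restrict k hq

theorem loc_trans {i j l : ι} {c : C} {u : (rep J).obj c ⟶ V i} {v : (rep J).obj c ⟶ V j}
    {w : (rep J).obj c ⟶ V l} {e : R i ≃ R j} {f : R j ≃ R l} (h : T.rel u v e)
    (h' : T.rel v w f) :
    Loc J c fun _ g => T.rel ((rep J).map g ≫ u) ((rep J).map g ≫ w) (e.trans f) := by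
  refine (T.loc_exists u w).bind ?_
  rintro d g ⟨q, hq⟩
  refine Loc.of_not_bot fun hd => Loc.of_forall fun d' k => ?_
  obtain rfl := T.comp (T.restrict g h) (T.restrict g h') hq hd
  simpa only [Functor.map_comp, Category.assoc] using T.restrict k hq

/-- The identifications between the copies of the `V_i`. -/
def glue {c : C} (p q : Σ i, ((rep J).obj c ⟶ V i) × R i) : Prop :=
  Loc J c fun _ g => ∃ e : R p.1 ≃ R q.1,
    T.rel ((rep J).map g ≫ p.2.1) ((rep J).map g ≫ q.2.1) e ∧ e p.2.2 = q.2.2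

/-- The identifications as an equivalence relation. -/
def glueSetoid (c : C) : Setoid (Σ i, ((rep J).obj c ⟶ V i) × R i) where
  r := T.glue
  iseqv :=
    { refl := fun p => (T.loc_refl p.2.1).mono fun d g h => ⟨_, h, rfl⟩
      symm := fun {p q} h => by
        refine h.bind ?_
        rintro d g ⟨e, he, her⟩
        refine (T.loc_symm he).mono fun d' k h => ⟨e.symm, ?_, ?_⟩
        · simpa only [Functor.map_comp, Category.assoc] using h
        · rw [← her, e.symm_apply_apply]
      trans := fun {p q r} h h' => by
        refine (h.and h').bind ?_
        rintro d g ⟨⟨e, he, her⟩, f, hf, hfr⟩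
        refine (T.loc_trans he hf).mono fun d' k h => ⟨e.trans f, ?_, ?_⟩
        · simpa only [Functor.map_comp, Category.assoc] using h
        · rw [Equiv.trans_apply, her, hfr] }

theorem glue_restrict {c d : C} (g : d ⟶ c) {p q : Σ i, ((rep J).obj c ⟶ V i) × R i}
    (h : T.glue p q) :
    T.glue ⟨p.1, (rep J).map g ≫ p.2.1, p.2.2⟩ ⟨q.1, (rep J).map g ≫ q.2.1, q.2.2⟩ := by
  refine (h.restrict g).mono ?_
  rintro d' k ⟨e, he, her⟩
  refine ⟨e, ?_, her⟩
  simpa only [Functor.map_comp, Category.assoc] using he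

/-- The presheaf quotient of the disjoint union of copies of the `V_i`. -/
def quotient : Cᵒᵖ ⥤ Type u where
  obj c := Quotient (T.glueSetoid c.unop)
  map {c d} g := ↾ Quotient.map (sa := T.glueSetoid c.unop) (sb := T.glueSetoid d.unop)
    (fun p => ⟨p.1, (rep J).map g.unop ≫ p.2.1, p.2.2⟩) fun _ _ h => T.glue_restrict g.unop h
  map_id c := by
    ext p
    obtain ⟨⟨i, u, r⟩, rfl⟩ := Quotient.exists_rep p
    change Quotient.mk _ (⟨i, (rep J).map (𝟙 c.unop) ≫ u, r⟩ : Σ i, (_ ⟶ V i) × R i) = _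
    rw [CategoryTheory.Functor.map_id, Category.id_comp]
    rfl
  map_comp {c d e} f g := by
    ext p
    obtain ⟨⟨i, u, r⟩, rfl⟩ := Quotient.exists_rep p
    change Quotient.mk _ (⟨i, (rep J).map (g.unop ≫ f.unop) ≫ u, r⟩ : Σ i, (_ ⟶ V i) × R i) =
      Quotient.mk _ ⟨i, (rep J).map g.unop ≫ (rep J).map f.unop ≫ u, r⟩
    rw [Functor.map_comp, Category.assoc]

/-- The class of a point of a copy of `V_i`. -/
def cls {i : ι} {c : C} (u : (rep J).obj c ⟶ V i) (r : R i) : T.quotient.obj (op c) :=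
  Quotient.mk (T.glueSetoid c) ⟨i, u, r⟩

theorem map_cls {i : ι} {c d : C} (g : d ⟶ c) (u : (rep J).obj c ⟶ V i) (r : R i) :
    T.quotient.map g.op (T.cls u r) = T.cls ((rep J).map g ≫ u) r :=
  rfl

/-- A locally constant cocycle can be glued. -/
theorem exists_glued : ∃ (X : Sheaf J (Type u)) (p : ∀ i, R i → (V i ⟶ X)),
    (∀ {i j : ι} {c : C} (u : (rep J).obj c ⟶ V i) (v : (rep J).obj c ⟶ V j) (e : R i ≃ R j),
      T.rel u v e → ∀ r, u ≫ p i r = v ≫ p j (e r)) ∧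
    (∀ (i : ι) (c : C) (v : (rep J).obj c ⟶ V i) (r r' : R i), ⊥ ∉ J c →
      v ≫ p i r = v ≫ p i r' → r = r') ∧
    (∀ (i : ι) (c : C) (v : (rep J).obj c ⟶ V i) (x : (rep J).obj c ⟶ X),
      Loc J c fun _ g => ∃ r : R i, (rep J).map g ≫ v ≫ p i r = (rep J).map g ≫ x) := by
  choose p hp using fun (i : ι) (r : R i) =>
    exists_hom_of_pt (X := V i) (Y := (presheafToSheaf J (Type u)).obj T.quotient)
      (fun c u => pt (T.cls u r)) (fun {c d} g u => by rw [rep_map_pt, map_cls])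
  have heq {i j : ι} {c : C} (u : (rep J).obj c ⟶ V i) (v : (rep J).obj c ⟶ V j) (e : R i ≃ R j)
      (h : T.rel u v e) (r : R i) : u ≫ p i r = v ≫ p j (e r) := by
    rw [hp, hp]
    congr 1
    exact Quotient.sound (s := T.glueSetoid c)
      (Loc.of_forall fun d g => ⟨e, T.restrict g h, rfl⟩)
  -- Injectivity: an identification of the copies `r` and `r'` over the same `v` is, at some
  -- non-empty stage, a bijection relating `v` to itself, hence the identity. Surjectivity: `x` is
  -- locally a point of a copy of some `V j`, and a bijection relating it to `v` moves it to a copy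
  -- of `V i`.
  refine ⟨_, p, heq, fun i c v r r' hc h => ?_, fun i c v x => ?_⟩
  · rw [hp, hp] at h
    obtain ⟨d, g, hg, hd⟩ := (loc_eq_of_pt_eq h).exists_of_not_bot hc
    rw [map_cls, map_cls] at hg
    have : T.glue _ _ := Quotient.exact (s := T.glueSetoid d) hg
    obtain ⟨d', g', ⟨e, he, her⟩, hd'⟩ := this.exists_of_not_bot hd
    rw [← show e r = r' from her]
    rw [T.eq_refl he hd']
    rfl
  · refine (loc_pt x).bind ?_
    rintro d g ⟨q, hq⟩
    obtain ⟨⟨j, u, r⟩, rfl⟩ := Quotient.exists_rep q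
    have hq : (rep J).map g ≫ x = u ≫ p j r := hq.trans (hp j r d u).symm
    refine (T.loc_exists u ((rep J).map g ≫ v)).mono ?_
    rintro d' k ⟨e, he⟩
    refine ⟨e r, ?_⟩
    have := heq _ _ e he r
    simp only [Functor.map_comp, Category.assoc] at this ⊢
    rw [hq]
    exact this.symm

end Cocycle

end Cocycles

/-! ### Points of the 0- and 1-coskeleton, and filling of edges and triangles -/

section LowCoskeleta

variable {C : Type u} [SmallCategory C] {J : GrothendieckTopology C}
variable (H : SimplicialObject (Sheaf J (Type u)))

/-- A simplex of the 0-coskeleton is an arbitrary tuple of vertices. An `x` with `x.len ≤ 0` is not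
literally `⦋0⦌`, whence the constant operator from `x` to `⦋0⦌`. -/
theorem exists_cosk_zero {n : ℕ} {A : Sheaf J (Type u)} (v : Fin (n + 1) → (A ⟶ H _⦋0⦌)) :
    ∃ a : A ⟶ ((SimplicialObject.cosk 0).obj H) _⦋n⦌,
      ∀ θ : ⦋0⦌ ⟶ ⦋n⦌, a ≫ coskLeg H 0 n le_rfl θ = v (θ.toOrderHom 0) := by
  obtain ⟨a, ha⟩ := cosk_exists_lift H (k := 0) (n := n)
    (fun x hx θ => v (θ.toOrderHom 0) ≫ H.map (x.const ⦋0⦌ 0).op) (by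
      intro x y hx hy θ φ
      have : φ.toOrderHom 0 = 0 := Fin.ext (by have := (φ.toOrderHom 0).2; omega)
      rw [Category.assoc, ← Functor.map_comp, ← op_comp, SimplexCategory.comp_toOrderHom,
        OrderHom.comp_coe, Function.comp_apply, this]
      rfl)
  refine ⟨a, fun θ => ?_⟩
  rw [ha, SimplexCategory.const_eq_id, op_id, CategoryTheory.Functor.map_id, Category.comp_id]

/-- The operator `[m] ⟶ [1]` which sends `0` to `0` and everything else to `1`. -/
def firstOrNot (x : SimplexCategory) : x ⟶ ⦋1⦌ :=
  SimplexCategory.Hom.mk ⟨fun i => if i = 0 then 0 else 1, fun i j hij => by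
    by_cases hi : i = 0
    · simp [hi]
    · have hj : j ≠ 0 := fun h => hi (le_antisymm (h ▸ hij) (Fin.zero_le _))
      simp [hi, hj]⟩

theorem firstOrNot_one : firstOrNot ⦋1⦌ = 𝟙 _ := by
  ext i
  fin_cases i <;> rfl

/-- A simplex of the 1-coskeleton is a compatible system of edges. The vertices enter through their
degenerate edges `e a a`, so that all data live in `H_1`; only the values with `a ≤ b` matter. -/
theorem exists_cosk_one {n : ℕ} {A : Sheaf J (Type u)}
    (e : Fin (n + 1) → Fin (n + 1) → (A ⟶ H _⦋1⦌))
    (h₀ : ∀ a b, a ≤ b → e a b ≫ H.map (⦋1⦌.const ⦋1⦌ 0).op = e a a)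
    (h₁ : ∀ a b, a ≤ b → e a b ≫ H.map (⦋1⦌.const ⦋1⦌ 1).op = e b b) :
    ∃ a : A ⟶ ((SimplicialObject.cosk 1).obj H) _⦋n⦌,
      ∀ θ : ⦋1⦌ ⟶ ⦋n⦌, a ≫ coskLeg H 1 n le_rfl θ = e (θ.toOrderHom 0) (θ.toOrderHom 1) := by
  have hconst (y : SimplexCategory) (a : Fin (n + 1)) (ω ω' : y ⟶ ⦋1⦌) :
      e a a ≫ H.map ω.op = e a a ≫ H.map ω'.op := by
    rw [← h₀ a a le_rfl, Category.assoc, Category.assoc, ← Functor.map_comp, ← Functor.map_comp]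
    rfl
  -- As `y` is `[0]` or `[1]`, `ω` is determined by its first and last values: it is constant, and
  -- `e a b` is replaced by the degenerate edge of an endpoint, or it equals `firstOrNot y`.
  have key (y : SimplexCategory) (hy : y.len ≤ 1) (ω : y ⟶ ⦋1⦌) (a b : Fin (n + 1)) (hab : a ≤ b) :
      e a b ≫ H.map ω.op = e (if ω.toOrderHom 0 = 0 then a else b)
        (if ω.toOrderHom (Fin.last _) = 0 then a else b) ≫ H.map (firstOrNot y).op := by
    have hlast (i : Fin (y.len + 1)) (hi : i ≠ 0) : i = Fin.last _ := by
      have := i.2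
      have : i.1 ≠ 0 := fun h => hi (Fin.ext h)
      ext
      simp
      omega
    have h01 (i : Fin 2) : i = 0 ∨ i = 1 := by omega
    have hmono : ω.toOrderHom 0 ≤ ω.toOrderHom (Fin.last _) :=
      ω.toOrderHom.monotone (Fin.zero_le _)
    have hcst (p : Fin 2) (hp : ω.toOrderHom 0 = p) (hp' : ω.toOrderHom (Fin.last _) = p) :
        ω = ω ≫ ⦋1⦌.const ⦋1⦌ p := by
      ext i : 3
      change ω.toOrderHom i = p
      by_cases hi : i = 0
      · rw [hi, hp]
      · rw [hlast i hi, hp']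
    rcases h01 (ω.toOrderHom 0) with hp | hp <;> rcases h01 (ω.toOrderHom (Fin.last _)) with hq | hq
    · rw [if_pos hp, if_pos hq, hcst 0 hp hq, op_comp, Functor.map_comp, ← Category.assoc, h₀ a b hab]
      exact hconst _ _ _ _
    · rw [if_pos hp, if_neg (by rw [hq]; decide)]
      congr 3
      ext i : 3
      change ω.toOrderHom i = if i = 0 then 0 else 1
      split_ifs with hi
      · rw [hi, hp]
      · rw [hlast i hi, hq]
    · rw [hp, hq] at hmono
      exact absurd hmono (by decide)
    · rw [if_neg (by rw [hp]; decide), if_neg (by rw [hq]; decide), hcst 1 hp hq, op_comp,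
        Functor.map_comp, ← Category.assoc, h₁ a b hab]
      exact hconst _ _ _ _
  obtain ⟨a, ha⟩ := cosk_exists_lift H (k := 1) (n := n)
    -- One formula for both degrees: for `x = [1]` the operator `firstOrNot x` is the identity and
    -- this is the edge itself; for `x = [0]` first and last coincide and this is the source of a
    -- degenerate edge.
    (fun x hx θ => e (θ.toOrderHom 0) (θ.toOrderHom (Fin.last _)) ≫ H.map (firstOrNot x).op) (by
      intro x y hx hy θ φ
      rw [Category.assoc, ← Functor.map_comp, ← op_comp,
        key y hy _ _ _ (θ.toOrderHom.monotone (Fin.zero_le _))]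
      have hφ (i : Fin (y.len + 1)) :
          (if (φ ≫ firstOrNot x).toOrderHom i = 0 then θ.toOrderHom 0
            else θ.toOrderHom (Fin.last _)) = (φ ≫ θ).toOrderHom i := by
        change (if (if φ.toOrderHom i = 0 then (0 : Fin 2) else 1) = 0 then θ.toOrderHom 0
            else θ.toOrderHom (Fin.last _)) = θ.toOrderHom (φ.toOrderHom i)
        by_cases hi : φ.toOrderHom i = 0
        · rw [if_pos hi, if_pos rfl, hi]
        · rw [if_neg hi, if_neg (by decide)]
          congr 1
          have := (φ.toOrderHom i).2
          have : (φ.toOrderHom i).1 ≠ 0 := fun h => hi (Fin.ext h)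
          ext
          simp
          omega
      rw [hφ, hφ])
  refine ⟨a, fun θ => ?_⟩
  rw [ha, firstOrNot_one, op_id, CategoryTheory.Functor.map_id, Category.comp_id]
  rfl

variable {H}

theorem loc_edge [Epi (toCosk H 0 1)] {c : C} (a b : (rep J).obj c ⟶ H _⦋0⦌) :
    Loc J c fun d g => ∃ x : (rep J).obj d ⟶ H _⦋1⦌,
      x ≫ H.δ 1 = (rep J).map g ≫ a ∧ x ≫ H.δ 0 = (rep J).map g ≫ b := by
  obtain ⟨z, hz⟩ := exists_cosk_zero H (n := 1) ![a, b]
  refine (loc_lift_of_epi (toCosk H 0 1) z).mono ?_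
  rintro d g ⟨x, hx⟩
  have h (θ : ⦋0⦌ ⟶ ⦋1⦌) : x ≫ H.map θ.op = (rep J).map g ≫ ![a, b] (θ.toOrderHom 0) := by
    rw [← hz, ← Category.assoc, ← hx, Category.assoc, toCosk_leg]
  exact ⟨x, h (SimplexCategory.δ 1), h (SimplexCategory.δ 0)⟩

theorem map_const_zero : H.map (⦋1⦌.const ⦋1⦌ 0).op = H.δ 1 ≫ H.σ 0 := by
  rw [SimplicialObject.δ, SimplicialObject.σ, ← Functor.map_comp, ← op_comp]
  congr 2
  decide

theorem map_const_one : H.map (⦋1⦌.const ⦋1⦌ 1).op = H.δ 0 ≫ H.σ 0 := by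
  rw [SimplicialObject.δ, SimplicialObject.σ, ← Functor.map_comp, ← op_comp]
  congr 2
  decide

theorem exists_triangle_edges {D : Type*} [Category* D] {A K : D} {P Q : K ⟶ K} (hPP : P ≫ P = P)
    (hPQ : P ≫ Q = P) (hQP : Q ≫ P = Q) (hQQ : Q ≫ Q = Q) {x y z : A ⟶ K}
    (hxy : x ≫ Q = y ≫ P) (hxz : x ≫ P = z ≫ P) (hyz : y ≫ Q = z ≫ Q) :
    ∃ E : Fin 3 → Fin 3 → (A ⟶ K), (∀ a b, a ≤ b → E a b ≫ P = E a a) ∧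
      (∀ a b, a ≤ b → E a b ≫ Q = E b b) ∧ E 0 1 = x ∧ E 1 2 = y ∧ E 0 2 = z := by
  -- The diagonal holds the degenerate edges of the three vertices; the entries below it are never
  -- read.
  refine ⟨![![x ≫ P, x, z], ![x, x ≫ Q, y], ![x, x, y ≫ Q]], ?_, ?_, rfl, rfl, rfl⟩
  · intro a b hab
    fin_cases a <;> fin_cases b <;> simp_all
  · intro a b hab
    fin_cases a <;> fin_cases b <;> simp_all

theorem loc_triangle [Epi (toCosk H 1 2)] {c : C} (x y z : (rep J).obj c ⟶ H _⦋1⦌)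
    (hxy : x ≫ H.δ 0 = y ≫ H.δ 1) (hxz : x ≫ H.δ 1 = z ≫ H.δ 1) (hyz : y ≫ H.δ 0 = z ≫ H.δ 0) :
    Loc J c fun d g => ∃ w : (rep J).obj d ⟶ H _⦋2⦌,
      w ≫ H.δ 2 = (rep J).map g ≫ x ∧ w ≫ H.δ 0 = (rep J).map g ≫ y ∧
        w ≫ H.δ 1 = (rep J).map g ≫ z := by
  have hc (a b : Fin 2) : H.map (⦋1⦌.const ⦋1⦌ a).op ≫ H.map (⦋1⦌.const ⦋1⦌ b).op =
      H.map (⦋1⦌.const ⦋1⦌ a).op := by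
    rw [← Functor.map_comp, ← op_comp]
    rfl
  obtain ⟨E, hE₀, hE₁, rfl, rfl, rfl⟩ := exists_triangle_edges (x := x) (y := y) (z := z)
    (hc 0 0) (hc 0 1) (hc 1 0) (hc 1 1)
    (by rw [map_const_zero, map_const_one, ← Category.assoc, hxy, Category.assoc])
    (by rw [map_const_zero, ← Category.assoc, hxz, Category.assoc])
    (by rw [map_const_one, ← Category.assoc, hyz, Category.assoc])
  obtain ⟨t, ht⟩ := exists_cosk_one H (n := 2) E hE₀ hE₁
  refine (loc_lift_of_epi (toCosk H 1 2) t).mono ?_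
  rintro d g ⟨w, hw⟩
  have h (θ : ⦋1⦌ ⟶ ⦋2⦌) : w ≫ H.map θ.op =
      (rep J).map g ≫ E (θ.toOrderHom 0) (θ.toOrderHom 1) := by
    rw [← ht, ← Category.assoc, ← hw, Category.assoc, toCosk_leg]
  exact ⟨w, h (SimplexCategory.δ 2), h (SimplexCategory.δ 0), h (SimplexCategory.δ 1)⟩

end LowCoskeleta

section Converse

variable {C : Type u} [SmallCategory C] {J : GrothendieckTopology C}

/-! ### From descent data to covering projections -/

namespace Cover

variable (𝒰 : Cover J)

/-- Since `U ⟶ 1` is an epimorphism, `U` has a point locally on any stage, and the index of that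
point is locally constant. -/
theorem loc_comp_pt (c : C) : Loc J c fun d _ => ∃ i, Nonempty ((rep J).obj d ⟶ 𝒰.comp i) := by
  have := 𝒰.epi
  refine (loc_lift_of_epi (terminal.from 𝒰.U) (terminal.from _ : (rep J).obj c ⟶ _)).bind ?_
  rintro d g ⟨x, -⟩
  refine (loc_cst (x ≫ 𝒰.ζ)).mono ?_
  rintro e k ⟨i, hi⟩
  obtain ⟨y, -⟩ := exists_component_pt 𝒰.ζ i ((rep J).map k ≫ x) (by rw [Category.assoc, hi])
  exact ⟨i, ⟨y⟩⟩

instance isIso_powerProj_zero : IsIso (𝒰.powerProj (op ⦋0⦌) 0) := by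
  refine ⟨Pi.lift fun _ => 𝟙 _, ?_, limit.lift_π _ _⟩
  refine Pi.hom_ext _ _ fun k => ?_
  obtain rfl : k = (0 : Fin 1) := Subsingleton.elim (α := Fin 1) _ _
  exact (Category.assoc _ _ _).trans ((congrArg (𝒰.powerProj (op ⦋0⦌) 0 ≫ ·)
    (limit.lift_π _ _)).trans ((Category.comp_id _).trans (Category.id_comp _).symm))

theorem nerveVertex_zero_bijective : Function.Bijective (𝒰.nerveVertex (op ⦋0⦌) 0) := by
  refine ⟨fun f g h => Subtype.ext (funext fun k => ?_), fun i => ⟨⟨fun _ => i, fun h => ?_⟩, rfl⟩⟩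
  · obtain rfl : k = (0 : Fin 1) := Subsingleton.elim (α := Fin 1) _ _
    exact h
  · exact 𝒰.nonempty i (isEmptyObj_of_hom (Pi.lift fun _ => 𝟙 _) h)

end Cover

theorem Trivialization.loc_leaf_surj {𝒰 : Cover J} {X : Sheaf J (Type u)} {R : 𝒰.I → Type u}
    (T : Trivialization 𝒰 X R) (c : C) (x : (rep J).obj c ⟶ X) :
    Loc J c fun d g => ∃ (k : Σ i, R i) (p : (rep J).obj d ⟶ 𝒰.comp k.1),
      p ≫ T.leaf k.1 k.2 = (rep J).map g ≫ x := by
  refine (𝒰.loc_comp_pt c).bind ?_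
  rintro d g ⟨i, ⟨u⟩⟩
  refine (T.loc_leaf u ((rep J).map g ≫ x)).mono ?_
  rintro e k ⟨r, hr⟩
  refine ⟨⟨i, r⟩, (rep J).map k ≫ u, ?_⟩
  rw [Functor.map_comp, Category.assoc, Category.assoc, hr]

namespace HypercoverRefinement

variable {𝒰 : Cover J} (X : HypercoverRefinement 𝒰) {R : 𝒰.I → Type u}

instance epi_toCosk (k : ℕ) : Epi (toCosk X.H k (k + 1)) := X.epi_cosk k

/-- The identification `S_0 = I`. -/
def idxMap : X.S _⦋0⦌ ⟶ 𝒰.I := X.hom.α.app (op ⦋0⦌) ≫ 𝒰.nerveVertex (op ⦋0⦌) 0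

theorem idx_bijective : Function.Bijective X.idx :=
  𝒰.nerveVertex_zero_bijective.comp X.bijective_zero

instance : Mono X.idxMap := (mono_iff_injective _).2 X.idx_bijective.1

/-- The identification `H_0 = U`. -/
def toU : X.H _⦋0⦌ ⟶ 𝒰.U := X.hom.h.app (op ⦋0⦌) ≫ 𝒰.powerProj (op ⦋0⦌) 0

instance : IsIso X.toU := by
  exact @IsIso.comp_isIso _ _ _ _ _ (X.hom.h.app (op ⦋0⦌)) _ X.isIso_zero 𝒰.isIso_powerProj_zero

theorem toU_ζ : X.toU ≫ 𝒰.ζ = X.index 0 ≫ (γ J).map X.idxMap :=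
  (Category.assoc _ _ _).trans
      ((congrArg (_ ≫ ·) (𝒰.cechζ_vertex (op ⦋0⦌) 0).symm).trans
        ((Category.assoc _ _ _).symm.trans
          ((congrArg (· ≫ _) (NatTrans.congr_app X.hom.comm (op ⦋0⦌))).trans
            ((Category.assoc _ _ _).trans
              (congrArg (_ ≫ ·) ((γ J).map_comp _ _).symm)))))

theorem toComp_ι (i : X.S _⦋0⦌) : X.toComp i ≫ componentι 𝒰.ζ (X.idx i) = X.vertι i ≫ X.toU :=
  componentMap_fst _ _ _ X.idxMap X.toU_ζ _ _ rfl

/-- A point of `U_i` is carried back to `H_0` by the inverse of `toU`. It lies over the vertex `i`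
because `γ^*` preserves monomorphisms, so indices may be compared in `γ^* I`. -/
theorem exists_toComp {A : Sheaf J (Type u)} {i : X.S _⦋0⦌} (u : A ⟶ 𝒰.comp (X.idx i)) :
    ∃ v : A ⟶ X.vert i, v ≫ X.toComp i = u := by
  obtain ⟨v, hv⟩ := X.exists_vert_pt (i := i) (u ≫ componentι _ _ ≫ inv X.toU) (by
    rw [← cancel_mono ((γ J).map X.idxMap), Category.assoc, ← X.toU_ζ, cst_map]
    simp only [Category.assoc, IsIso.inv_hom_id_assoc, componentι_comp, comp_cst]
    rfl)
  refine ⟨v, ?_⟩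
  rw [← cancel_mono (componentι _ _), Category.assoc, X.toComp_ι, ← Category.assoc, hv]
  simp

instance (i : X.S _⦋0⦌) : IsIso (X.toComp i) := by
  obtain ⟨v, hv⟩ := X.exists_toComp (𝟙 (𝒰.comp (X.idx i)))
  have : Mono (X.toComp i) := by
    have : Mono (X.toComp i ≫ componentι 𝒰.ζ (X.idx i)) := by
      rw [X.toComp_ι]
      infer_instance
    exact mono_of_mono _ (componentι 𝒰.ζ (X.idx i))
  exact ⟨v, by rw [← cancel_mono (X.toComp i), Category.assoc, hv, Category.comp_id,
    Category.id_comp], hv⟩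

/-- Any two points of `H_0` are locally joined by a point of `H_1`. -/
theorem loc_arr {i j : X.S _⦋0⦌} {c : C} (u : (rep J).obj c ⟶ X.vert i)
    (v : (rep J).obj c ⟶ X.vert j) :
    Loc J c fun d g => ∃ (ℓ : SSet.Edge i j) (x : (rep J).obj d ⟶ X.arr ℓ),
      x ≫ X.d₁ ℓ = (rep J).map g ≫ u ∧ x ≫ X.d₀ ℓ = (rep J).map g ≫ v := by
  refine (loc_edge (u ≫ X.vertι i) (v ≫ X.vertι j)).bind ?_
  rintro d g ⟨x, h₁, h₀⟩
  refine (loc_cst (x ≫ X.index 1)).bind ?_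
  rintro e k ⟨w, hw⟩
  refine Loc.of_not_bot fun he => Loc.of_forall fun e' k' => ?_
  -- The index `w` of the edge is known only as a locally constant value; at a non-empty stage its
  -- faces must be the indices of the given endpoints.
  have hδ (a : Fin 2) (l : X.S _⦋0⦌) (y : (rep J).obj c ⟶ X.vert l)
      (h : x ≫ X.H.δ a = (rep J).map g ≫ y ≫ X.vertι l) : X.S.δ a w = l := by
    apply cst_injective he
    rw [← cst_map _ (X.S.δ a), ← hw, Category.assoc, Category.assoc, ← X.δ_index 0 a,
      ← Category.assoc x, h]
    simp [X.vertι_index]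
  obtain ⟨y, hy⟩ := X.exists_arr_pt (SSet.Edge.mk w (hδ 1 i u h₁) (hδ 0 j v h₀))
    ((rep J).map k ≫ x) (by rw [Category.assoc, hw]; rfl)
  refine ⟨_, (rep J).map k' ≫ y, ?_, ?_⟩
  · rw [← cancel_mono (X.vertι i)]
    simp only [Category.assoc, X.d₁_ι, Functor.map_comp]
    rw [← Category.assoc y, hy, Category.assoc, h₁]
  · rw [← cancel_mono (X.vertι j)]
    simp only [Category.assoc, X.d₀_ι, Functor.map_comp]
    rw [← Category.assoc y, hy, Category.assoc, h₀]

/-- The cocycle condition holds for all triangles of points of `H_1`. -/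
theorem s_comp_of_pt {R : X.S _⦋0⦌ → Type u} (s : SetDescentDatum X.S R) {i j k : X.S _⦋0⦌}
    {ℓ : SSet.Edge i j} {r : SSet.Edge j k} {t : SSet.Edge i k} {c : C} (hc : ⊥ ∉ J c)
    (x : (rep J).obj c ⟶ X.arr ℓ) (y : (rep J).obj c ⟶ X.arr r) (z : (rep J).obj c ⟶ X.arr t)
    (hxy : x ≫ X.d₀ ℓ = y ≫ X.d₁ r) (hxz : x ≫ X.d₁ ℓ = z ≫ X.d₁ t)
    (hyz : y ≫ X.d₀ r = z ≫ X.d₀ t) : s.s t = (s.s ℓ).trans (s.s r) := by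
  obtain ⟨d, g, ⟨w, h₂, h₀, h₁⟩, hd⟩ := (loc_triangle (x ≫ X.arrι ℓ) (y ≫ X.arrι r) (z ≫ X.arrι t)
    (by rw [Category.assoc, Category.assoc, ← X.d₁_ι, ← X.d₀_ι, ← Category.assoc, hxy,
      Category.assoc])
    (by rw [Category.assoc, Category.assoc, ← X.d₁_ι, ← X.d₁_ι, ← Category.assoc, hxz,
      Category.assoc])
    (by rw [Category.assoc, Category.assoc, ← X.d₀_ι, ← X.d₀_ι, ← Category.assoc, hyz,
      Category.assoc])).exists_of_not_bot hc
  -- At a smaller non-empty stage the filling triangle has a constant index `W`. Its faces are then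
  -- `ℓ`, `r` and `t`, so the cocycle condition of `s` applies to `W`.
  obtain ⟨e, k, ⟨W, hW⟩, he⟩ := (loc_cst (w ≫ X.index 2)).exists_of_not_bot hd
  have hδ (a : Fin 3) {i j : X.S _⦋0⦌} (l : SSet.Edge i j) (y : (rep J).obj c ⟶ X.arr l)
      (h : w ≫ X.H.δ a = (rep J).map g ≫ y ≫ X.arrι l) : X.S.δ a W = l.edge := by
    apply cst_injective he
    rw [← cst_map _ (X.S.δ a), ← hW, Category.assoc, Category.assoc, ← X.δ_index 1 a,
      ← Category.assoc w, h]
    simp [X.arrι_index]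
  exact s.s_comp (SSet.Edge.CompStruct.mk W (hδ 2 ℓ x h₂) (hδ 0 r y h₀) (hδ 1 t z h₁))

/-- The locally constant cocycle given by a descent datum of the index simplicial set. -/
def cocycle {R : X.S _⦋0⦌ → Type u} (s : SetDescentDatum X.S R) :
    Cocycle J (fun i => 𝒰.comp (X.idx i)) R where
  rel {i j c} u v e := ∃ (ℓ : SSet.Edge i j) (x : (rep J).obj c ⟶ X.arr ℓ),
    (x ≫ X.d₁ ℓ ≫ X.toComp i = u ∧ x ≫ X.d₀ ℓ ≫ X.toComp j = v) ∧ s.s ℓ = e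
  restrict {i j c d} g {u v e} := by
    rintro ⟨ℓ, x, ⟨rfl, rfl⟩, rfl⟩
    exact ⟨ℓ, (rep J).map g ≫ x, ⟨Category.assoc _ _ _, Category.assoc _ _ _⟩, rfl⟩
  loc_exists {i j c} u v := by
    obtain ⟨u, rfl⟩ := X.exists_toComp u
    obtain ⟨v, rfl⟩ := X.exists_toComp v
    refine (X.loc_arr u v).mono ?_
    rintro d g ⟨ℓ, x, h₁, h₀⟩
    refine ⟨_, ℓ, x, ⟨?_, ?_⟩, rfl⟩
    · rw [← Category.assoc, h₁, Category.assoc]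
    · rw [← Category.assoc, h₀, Category.assoc]
  comp {i j k c u v w e f q} := by
    rintro ⟨ℓ, x, ⟨rfl, rfl⟩, rfl⟩ ⟨r, y, ⟨hy, rfl⟩, rfl⟩ ⟨t, z, ⟨hz₁, hz₀⟩, rfl⟩ hc
    simp only [← Category.assoc, cancel_mono] at hy hz₁ hz₀
    exact X.s_comp_of_pt s hc x y z hy.symm hz₁.symm hz₀.symm

/-- A descent datum of the index simplicial set determines a covering projection. -/
theorem exists_covering_projection (s : SetDescentDatum X.S fun i => R (X.idx i)) :
    ∃ (Y : Sheaf J (Type u)) (T : Trivialization 𝒰 Y R),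
      T.IsCoveringProjection ∧ T.Induces X (s.induced X.toSelfDualFamily) := by
  obtain ⟨Y, p, hp, hinj, hsurj⟩ := (X.cocycle s).exists_glued
  -- The glued maps are indexed by `S_0`, a trivialization by `I`; the dependent family is
  -- transported along the bijection `idx`.
  obtain ⟨q, hq⟩ : ∃ q : ∀ i, R i → (𝒰.comp i ⟶ Y), ∀ i, q (X.idx i) = p i :=
    ⟨Equiv.piCongrLeft (fun i => R i → (𝒰.comp i ⟶ Y)) (Equiv.ofBijective _ X.idx_bijective) p,
      fun i => Equiv.piCongrLeft_apply_apply (fun i => R i → (𝒰.comp i ⟶ Y))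
        (Equiv.ofBijective _ X.idx_bijective) p i⟩
  obtain ⟨T, hT⟩ := Trivialization.exists_of_family q
    (fun i => by
      obtain ⟨i, rfl⟩ := X.idx_bijective.2 i
      rw [hq]
      exact hinj i)
    (fun i => by
      obtain ⟨i, rfl⟩ := X.idx_bijective.2 i
      rw [hq]
      exact hsurj i)
  have hind ⦃i j : X.S _⦋0⦌⦄ (ℓ : SSet.Edge i j) (r : R (X.idx i)) :
      (X.d₁ ℓ ≫ X.toComp i) ≫ T.leaf _ r = (X.d₀ ℓ ≫ X.toComp j) ≫ T.leaf _ (s.s ℓ r) := by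
    rw [hT, hT, hq, hq]
    refine hom_ext_pt fun c x => ?_
    have := hp _ _ (s.s ℓ) ⟨ℓ, x, ⟨rfl, rfl⟩, rfl⟩ r
    simpa only [Category.assoc] using this
  refine ⟨Y, T, fun i j _ Z f g hfg => ?_, (X.induces_iff T s).2 hind⟩
  obtain ⟨i, rfl⟩ := X.idx_bijective.2 i
  obtain ⟨j, rfl⟩ := X.idx_bijective.2 j
  refine hom_ext_pt fun c x => pt_ext ?_
  obtain ⟨u, hu⟩ := X.exists_toComp (x ≫ prod.fst)
  obtain ⟨v, hv⟩ := X.exists_toComp (x ≫ prod.snd)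
  refine (X.loc_arr u v).bind ?_
  rintro d k ⟨ℓ, y, h₁, h₀⟩
  refine Loc.of_not_bot fun hd => Loc.of_forall fun d' k' => ?_
  -- The action spans used to cover `U_i × U_j` are those of the 1-simplexes: the point `x` locally
  -- factors through one, and that component is non-empty since `y` is a point of it at a non-empty
  -- stage.
  have := hfg (X.arr ℓ) (X.d₁ ℓ ≫ X.toComp i) (X.d₀ ℓ ≫ X.toComp j)
    ((T.isActionSpan_iff _ _).2 ⟨not_isEmptyObj_iff.2 ⟨d, y, hd⟩, s.s ℓ, hind ℓ⟩)
  have e : (rep J).map k ≫ x = y ≫ prod.lift (X.d₁ ℓ ≫ X.toComp i) (X.d₀ ℓ ≫ X.toComp j) := by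
    apply Limits.prod.hom_ext
    · rw [Category.assoc, Category.assoc, prod.lift_fst, ← hu, ← Category.assoc, ← Category.assoc,
        h₁]
    · rw [Category.assoc, Category.assoc, prod.lift_snd, ← hv, ← Category.assoc, ← Category.assoc,
        h₀]
  rw [Functor.map_comp, Category.assoc, Category.assoc, ← Category.assoc _ x, e, ← Category.assoc _ x,
    e, Category.assoc, Category.assoc, this]

/-- The leaves cover `Y`, so it suffices that points of leaves that coincide in `Y` also coincide in
`Y'`. Join the two points of the cover by a point over some `ℓ`: coincidence in `Y` forces `r' = s_ℓ
r`, and the same equation for `Y'` gives the coincidence there. -/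
theorem exists_hom_of_induces (s : SetDescentDatum X.S fun i => R (X.idx i))
    {Y Y' : Sheaf J (Type u)} {T : Trivialization 𝒰 Y R} {T' : Trivialization 𝒰 Y' R}
    (h : T.Induces X (s.induced X.toSelfDualFamily))
    (h' : T'.Induces X (s.induced X.toSelfDualFamily)) :
    ∃ e : Y ⟶ Y', ∀ i r, T.leaf i r ≫ e = T'.leaf i r := by
  rw [induces_iff] at h h'
  obtain ⟨e, he⟩ := exists_desc (fun k : Σ i, R i => T.leaf k.1 k.2) (fun k => T'.leaf k.1 k.2)
    T.loc_leaf_surj (by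
      rintro c ⟨i, r⟩ ⟨j, r'⟩ u v huv
      dsimp only at r r' u v huv ⊢
      obtain ⟨i, rfl⟩ := X.idx_bijective.2 i
      obtain ⟨j, rfl⟩ := X.idx_bijective.2 j
      obtain ⟨u, rfl⟩ := X.exists_toComp u
      obtain ⟨v, rfl⟩ := X.exists_toComp v
      refine pt_ext ((X.loc_arr u v).bind ?_)
      rintro d g ⟨ℓ, x, h₁, h₀⟩
      refine Loc.of_not_bot fun hd => Loc.of_forall fun d' k => ?_
      have key {Z : Sheaf J (Type u)} (S : Trivialization 𝒰 Z R)
          (hS : ∀ ⦃i j : X.S _⦋0⦌⦄ (ℓ : SSet.Edge i j) (r : R (X.idx i)),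
            (X.d₁ ℓ ≫ X.toComp i) ≫ S.leaf _ r = (X.d₀ ℓ ≫ X.toComp j) ≫ S.leaf _ (s.s ℓ r)) :
          (rep J).map g ≫ (u ≫ X.toComp i) ≫ S.leaf _ r =
            ((rep J).map g ≫ v ≫ X.toComp j) ≫ S.leaf _ (s.s ℓ r) := by
        have := congrArg (x ≫ ·) (hS ℓ r)
        simp only [← Category.assoc, h₁, h₀] at this
        simpa only [Category.assoc] using this
      have hr : s.s ℓ r = r' := by
        refine T.leaf_injective ((rep J).map g ≫ v ≫ X.toComp j) hd ?_
        rw [← key T h, huv]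
        simp only [Category.assoc]
      have := congrArg ((rep J).map k ≫ ·) (key T' h')
      rw [hr] at this
      simpa only [Functor.map_comp, Category.assoc] using this)
  exact ⟨e, fun i r => he ⟨i, r⟩⟩

theorem existsUnique_iso_of_induces (s : SetDescentDatum X.S fun i => R (X.idx i))
    {Y Y' : Sheaf J (Type u)} {T : Trivialization 𝒰 Y R} {T' : Trivialization 𝒰 Y' R}
    (h : T.Induces X (s.induced X.toSelfDualFamily))
    (h' : T'.Induces X (s.induced X.toSelfDualFamily)) :
    ∃! e : Y ≅ Y', ∀ i, (T.θ i).hom ≫ prod.map e.hom (𝟙 (𝒰.comp i)) = (T'.θ i).hom := by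
  obtain ⟨f, hf⟩ := X.exists_hom_of_induces s h h'
  obtain ⟨g, hg⟩ := X.exists_hom_of_induces s h' h
  refine ⟨⟨f, g, ?_, ?_⟩, fun i => (T.eq_of_leaf T' f i).2 (hf i), fun e he => ?_⟩
  · refine hom_ext_of_loc_surj _ T.loc_leaf_surj fun k => ?_
    rw [← Category.assoc, hf, hg, Category.comp_id]
  · refine hom_ext_of_loc_surj _ T'.loc_leaf_surj fun k => ?_
    rw [← Category.assoc, hg, hf, Category.comp_id]
  · ext1
    refine hom_ext_of_loc_surj _ T.loc_leaf_surj fun k => ?_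
    rw [(T.eq_of_leaf T' e.hom k.1).1 (he k.1), hf]

end HypercoverRefinement

end Converse

section MarkedActions

variable {C : Type u} [SmallCategory C] {J : GrothendieckTopology C}

/-! ### The hypercover of the action spans of a covering projection -/

/-- Compatible candidates for the bijections of an `(n + 1)`-tuple of points of the cover, with
marks on some of the pairs of points that are equal. -/
structure MarkedAction {I : Type u} (R : I → Type u) (n : ℕ) where
  idx : Fin (n + 1) → I
  act (a b : Fin (n + 1)) : R (idx a) ≃ R (idx b)
  mark : Fin (n + 1) → Fin (n + 1) → Prop
  mark_refl (a : Fin (n + 1)) : mark a a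
  mark_symm (a b : Fin (n + 1)) : mark a b → mark b a

namespace MarkedAction

variable {I : Type u} {R : I → Type u} {l m n : ℕ}

/-- Reindexing along an arbitrary map. -/
def comap (w : MarkedAction R n) (f : Fin (m + 1) → Fin (n + 1)) : MarkedAction R m where
  idx a := w.idx (f a)
  act a b := w.act (f a) (f b)
  mark a b := w.mark (f a) (f b)
  mark_refl a := w.mark_refl (f a)
  mark_symm a b := w.mark_symm (f a) (f b)

/-- By reflexivity and symmetry the marks amount to a free choice for each pair `a < b`, hence for
each edge; transitivity is deliberately not asked. -/
theorem mark_ext {w w' : MarkedAction R n} (h : ∀ a b, a < b → (w.mark a b ↔ w'.mark a b)) :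
    w.mark = w'.mark := by
  funext a b
  rcases lt_trichotomy a b with hab | rfl | hab
  · exact propext (h a b hab)
  · exact propext ⟨fun _ => w'.mark_refl a, fun _ => w.mark_refl a⟩
  · exact propext ⟨fun hw => w'.mark_symm _ _ ((h b a hab).1 (w.mark_symm _ _ hw)),
      fun hw => w.mark_symm _ _ ((h b a hab).2 (w'.mark_symm _ _ hw))⟩

end MarkedAction

namespace Trivialization

variable {𝒰 : Cover J} {X : Sheaf J (Type u)} {R : 𝒰.I → Type u} (T : Trivialization 𝒰 X R)
variable {l m n : ℕ}

/-- The points `u` of the cover lie in the components prescribed by `w`, the bijections of `w`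
describe the action over them, and marked pairs are equal. -/
def Realizes (w : MarkedAction R n) {c : C} (u : Fin (n + 1) → ((rep J).obj c ⟶ 𝒰.U)) : Prop :=
  (∀ a b, w.mark a b → u a = u b) ∧
    ∃ v : ∀ a, (rep J).obj c ⟶ 𝒰.comp (w.idx a), (∀ a, v a ≫ componentι _ _ = u a) ∧
      ∀ a b r, v a ≫ T.leaf _ r = v b ≫ T.leaf _ (w.act a b r)

variable {T}

namespace Realizes

variable {w w' : MarkedAction R n} {c d : C} {u : Fin (n + 1) → ((rep J).obj c ⟶ 𝒰.U)}

theorem comap (h : T.Realizes w u) (f : Fin (m + 1) → Fin (n + 1)) :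
    T.Realizes (w.comap f) fun a => u (f a) := by
  obtain ⟨h₁, v, h₂, h₃⟩ := h
  exact ⟨fun a b => h₁ _ _, fun a => v (f a), fun a => h₂ _, fun a b => h₃ _ _⟩

theorem restrict (h : T.Realizes w u) (g : d ⟶ c) :
    T.Realizes w fun a => (rep J).map g ≫ u a := by
  obtain ⟨h₁, v, h₂, h₃⟩ := h
  exact ⟨fun a b hab => congrArg (_ ≫ ·) (h₁ a b hab), fun a => (rep J).map g ≫ v a,
    fun a => by rw [Category.assoc, h₂], fun a b r => by rw [Category.assoc, h₃, Category.assoc]⟩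

theorem comp_ζ (h : T.Realizes w u) (a : Fin (n + 1)) : u a ≫ 𝒰.ζ = cst _ (w.idx a) := by
  obtain ⟨-, v, h₂, -⟩ := h
  rw [← h₂, Category.assoc, componentι_comp, comp_cst]

/-- The points determine their indices because constants are distinct, and the bijections because
leaves are injective. Only the marks remain free. -/
theorem unique (h : T.Realizes w u) (h' : T.Realizes w' u) (hc : ⊥ ∉ J c)
    (hm : w.mark = w'.mark) : w = w' := by
  have hidx : w.idx = w'.idx := funext fun a =>
    cst_injective hc ((h.comp_ζ a).symm.trans (h'.comp_ζ a))
  obtain ⟨-, v, h₂, h₃⟩ := h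
  obtain ⟨-, v', h₂', h₃'⟩ := h'
  obtain ⟨idx, act, mark, _, _⟩ := w
  obtain ⟨idx', act', mark', _, _⟩ := w'
  obtain rfl : idx = idx' := hidx
  obtain rfl : mark = mark' := hm
  obtain rfl : v = v' := funext fun a => component_hom_ext _ _ ((h₂ a).trans (h₂' a).symm)
  obtain rfl : act = act' := by
    funext a b
    ext r
    exact T.leaf_injective (v b) hc ((h₃ a b r).symm.trans (h₃' a b r))
  rfl

end Realizes

/-- The indices are locally constant and each of the finitely many pairs of points locally has a
bijection; no compatibility between these has to be arranged. The marks may be any reflexive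
symmetric relation that holds only between equal points. -/
theorem IsCoveringProjection.loc_realizes (hT : T.IsCoveringProjection) {c : C}
    (u : Fin (n + 1) → ((rep J).obj c ⟶ 𝒰.U)) (M : Fin (n + 1) → Fin (n + 1) → Prop)
    (hr : ∀ a, M a a) (hs : ∀ a b, M a b → M b a) (hM : ∀ a b, M a b → u a = u b) :
    Loc J c fun _ g => ∃ w : MarkedAction R n, w.mark = M ∧
      T.Realizes w fun a => (rep J).map g ≫ u a := by
  refine (Loc.forall_fin fun a => loc_cst (u a ≫ 𝒰.ζ)).bind ?_
  intro d g hi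
  choose i hi using hi
  choose v hv using fun a => exists_component_pt 𝒰.ζ (i a) ((rep J).map g ≫ u a)
    ((Category.assoc _ _ _).trans (hi a))
  refine (Loc.forall_fin fun a => Loc.forall_fin fun b => IsCoveringProjection.loc_action T hT (v a) (v b)).mono ?_
  intro e k hk
  choose s hs' using hk
  refine ⟨⟨i, s, M, hr, hs⟩, rfl, fun a b hab => congrArg (_ ≫ ·) (hM a b hab),
    fun a => (rep J).map k ≫ v a, fun a => ?_, fun a b r => ?_⟩
  · simp only [Category.assoc, hv, Functor.map_comp]
  · rw [Category.assoc, hs', Category.assoc]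

variable (T)

/-- The marked actions which are realized somewhere. -/
def Simplex (n : ℕ) : Type u :=
  {w : MarkedAction R n // ∃ (c : C) (u : Fin (n + 1) → ((rep J).obj c ⟶ 𝒰.U)),
    ⊥ ∉ J c ∧ T.Realizes w u}

/-- Reindexing of simplexes. -/
def Simplex.comap {T : Trivialization 𝒰 X R} (w : T.Simplex n) (f : Fin (m + 1) → Fin (n + 1)) :
    T.Simplex m :=
  ⟨w.1.comap f, by
    obtain ⟨c, u, hc, h⟩ := w.2
    exact ⟨c, _, hc, h.comap f⟩⟩

/-- The simplicial set of marked actions. -/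
def simplexes : SSet.{u} where
  obj n := T.Simplex n.unop.len
  map θ := ↾ fun w => w.comap θ.unop.toOrderHom

/-- Realizations of simplexes by points defined over `c`. -/
def Realization (n : ℕ) (c : C) : Type u :=
  {p : T.Simplex n × (Fin (n + 1) → ((rep J).obj c ⟶ 𝒰.U)) // T.Realizes p.1.1 p.2}

namespace Realization

variable {T}
variable {c d : C}

/-- Reindexing of realizations. -/
def comap (p : T.Realization n c) (f : Fin (m + 1) → Fin (n + 1)) : T.Realization m c :=
  ⟨(p.1.1.comap f, fun a => p.1.2 (f a)), p.2.comap f⟩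

/-- Restriction of realizations. -/
def restrict (p : T.Realization n c) (g : d ⟶ c) : T.Realization n d :=
  ⟨(p.1.1, fun a => (rep J).map g ≫ p.1.2 a), p.2.restrict g⟩

theorem ext (hc : ⊥ ∉ J c) {p q : T.Realization n c} (hu : ∀ a, p.1.2 a = q.1.2 a)
    (hm : ∀ a b, a < b → (p.1.1.1.mark a b ↔ q.1.1.1.mark a b)) : p = q := by
  obtain ⟨⟨w, u⟩, hp⟩ := p
  obtain ⟨⟨w', u'⟩, hq⟩ := q
  obtain rfl : u = u' := funext hu
  obtain rfl : w = w' := Subtype.ext (hp.unique hq hc (MarkedAction.mark_ext hm))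
  rfl

end Realization

/-- The presheaf of realizations. -/
def realizations (n : ℕ) : Cᵒᵖ ⥤ Type u where
  obj c := T.Realization n c.unop
  map g := ↾ fun p => p.restrict g.unop
  map_id c := by
    ext p
    refine Subtype.ext (Prod.ext rfl (funext fun a => ?_))
    change (rep J).map (𝟙 _) ≫ _ = _
    rw [CategoryTheory.Functor.map_id, Category.id_comp]
    rfl
  map_comp g g' := by
    ext p
    refine Subtype.ext (Prod.ext rfl (funext fun a => ?_))
    change (rep J).map (g'.unop ≫ g.unop) ≫ _ = _
    rw [Functor.map_comp, Category.assoc]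
    rfl

/-- Reindexing, as a morphism of presheaves. -/
def realizationsMap (f : Fin (m + 1) → Fin (n + 1)) : T.realizations n ⟶ T.realizations m where
  app c := ↾ fun p => p.comap f

/-- The simplexes of realizations, as a morphism of presheaves. -/
def realizationsIndex (n : ℕ) :
    T.realizations n ⟶ (Functor.const Cᵒᵖ).obj (T.Simplex n) where
  app c := ↾ fun p => p.1.1

/-- The sheaf of realizations. -/
def realSheaf (n : ℕ) : Sheaf J (Type u) := (presheafToSheaf J (Type u)).obj (T.realizations n)

/-- The point of the sheaf of realizations given by a realization. -/
def realPt {c : C} (p : T.Realization n c) : (rep J).obj c ⟶ T.realSheaf n :=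
  pt (J := J) (P := T.realizations n) (c := c) p

/-- Reindexing, as a morphism of sheaves. -/
def realMap (f : Fin (m + 1) → Fin (n + 1)) : T.realSheaf n ⟶ T.realSheaf m :=
  (presheafToSheaf J (Type u)).map (T.realizationsMap f)

theorem realMap_id : T.realMap (n := n) (fun a => a) = 𝟙 _ :=
  (presheafToSheaf J (Type u)).map_id _

theorem realMap_comp (f : Fin (m + 1) → Fin (n + 1)) (g : Fin (l + 1) → Fin (m + 1)) :
    T.realMap f ≫ T.realMap g = T.realMap fun a => f (g a) :=
  ((presheafToSheaf J (Type u)).map_comp _ _).symm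

theorem realPt_map {c : C} (p : T.Realization n c) (f : Fin (m + 1) → Fin (n + 1)) :
    T.realPt p ≫ T.realMap f = T.realPt (p.comap f) :=
  pt_map _ _

theorem rep_map_realPt {c d : C} (p : T.Realization n c) (g : d ⟶ c) :
    (rep J).map g ≫ T.realPt p = T.realPt (p.restrict g) :=
  rep_map_pt _ _

theorem loc_realPt {c : C} (x : (rep J).obj c ⟶ T.realSheaf n) :
    Loc J c fun d g => ∃ p : T.Realization n d, (rep J).map g ≫ x = T.realPt p :=
  loc_pt x

theorem realSheaf_hom_ext {Y : Sheaf J (Type u)} {f g : T.realSheaf n ⟶ Y}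
    (h : ∀ (c : C) (p : T.Realization n c), T.realPt p ≫ f = T.realPt p ≫ g) : f = g :=
  hom_ext_of_pt h

/-- The simplex of a realization. -/
def realIndex (n : ℕ) : T.realSheaf n ⟶ (γ J).obj (T.Simplex n) :=
  (presheafToSheaf J (Type u)).map (T.realizationsIndex n)

theorem realPt_index {c : C} (p : T.Realization n c) :
    T.realPt p ≫ T.realIndex n = cst _ p.1.1 :=
  (pt_map _ _).trans (cst_eq_pt c p.1.1).symm

theorem exists_realVertex (a : Fin (n + 1)) : ∃ f : T.realSheaf n ⟶ 𝒰.U,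
    ∀ (c : C) (p : T.Realization n c), T.realPt p ≫ f = p.1.2 a :=
  exists_hom_of_presheaf (P := T.realizations n) (fun _ p => p.1.2 a) fun _ _ => rfl

/-- The vertices of a realization. -/
def realVertex (a : Fin (n + 1)) : T.realSheaf n ⟶ 𝒰.U := (T.exists_realVertex a).choose

theorem realPt_vertex (a : Fin (n + 1)) {c : C} (p : T.Realization n c) :
    T.realPt p ≫ T.realVertex a = p.1.2 a :=
  (T.exists_realVertex a).choose_spec c p

theorem realMap_vertex (f : Fin (m + 1) → Fin (n + 1)) (a : Fin (m + 1)) :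
    T.realMap f ≫ T.realVertex a = T.realVertex (f a) :=
  T.realSheaf_hom_ext fun c p => by
    rw [← Category.assoc, realPt_map, realPt_vertex, realPt_vertex]
    rfl

/-- At a non-empty stage a realization is determined by its points and its marks, and the mark of a
pair can be read from the index of the corresponding edge. -/
theorem realSheaf_pt_ext {c : C} {x y : (rep J).obj c ⟶ T.realSheaf n}
    (hv : ∀ a, x ≫ T.realVertex a = y ≫ T.realVertex a)
    (he : ∀ a b, a < b → x ≫ T.realMap (m := 1) ![a, b] = y ≫ T.realMap ![a, b]) : x = y := by
  refine pt_ext (((T.loc_realPt x).and ((T.loc_realPt y))).bind ?_)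
  rintro d g ⟨⟨p, hp⟩, ⟨q, hq⟩⟩
  refine Loc.of_not_bot fun hd => Loc.of_forall fun e k => ?_
  have : p = q := by
    refine Realization.ext hd (fun a => ?_) fun a b hab => ?_
    · rw [← T.realPt_vertex a p, ← T.realPt_vertex a q, ← hp, ← hq, Category.assoc, hv,
        Category.assoc]
    · have h : T.realPt p ≫ T.realMap (m := 1) ![a, b] = T.realPt q ≫ T.realMap ![a, b] := by
        rw [← hp, ← hq, Category.assoc, he a b hab, Category.assoc]
      rw [realPt_map, realPt_map] at h
      have h' := cst_injective hd ((T.realPt_index _).symm.trans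
        ((congrArg (· ≫ T.realIndex 1) h).trans (T.realPt_index _)))
      exact iff_of_eq (congrArg (fun w : T.Simplex 1 => w.1.mark 0 1) h')
  rw [Functor.map_comp, Category.assoc, Category.assoc, hp, hq, this]

theorem realSheaf_pt_ext_zero {c : C} {x y : (rep J).obj c ⟶ T.realSheaf 0}
    (h : x ≫ T.realVertex 0 = y ≫ T.realVertex 0) : x = y :=
  T.realSheaf_pt_ext (fun a => by rwa [Subsingleton.elim (α := Fin 1) a 0])
    fun a b hab => absurd hab (by rw [Subsingleton.elim (α := Fin 1) a b]; exact lt_irrefl b)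

/-- The simplicial object of realizations. -/
def realObject : SimplicialObject (Sheaf J (Type u)) where
  obj n := T.realSheaf n.unop.len
  map θ := T.realMap θ.unop.toOrderHom
  map_id _ := T.realMap_id
  map_comp θ θ' := (T.realMap_comp (fun a => θ.unop.toOrderHom a)
    (fun a => θ'.unop.toOrderHom a)).symm

/-- The simplicial family of realizations. -/
def realFamily : SimplicialFamily J where
  S := T.simplexes
  H := T.realObject
  ζ := { app := fun n => T.realIndex n.unop.len
         naturality := fun _ _ θ => ((presheafToSheaf J (Type u)).map_comp _ _).symm.trans
          ((presheafToSheaf J (Type u)).map_comp (T.realizationsIndex _)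
            ((Functor.const Cᵒᵖ).map (T.simplexes.map θ))) }
  nonempty n w := by
    obtain ⟨c, u, hc, h⟩ := w.2
    obtain ⟨x, -⟩ := exists_component_pt (T.realIndex n.unop.len) w (T.realPt ⟨(w, u), h⟩)
      (T.realPt_index _)
    exact not_isEmptyObj_iff.2 ⟨c, x, hc⟩

/-- Reversal of the order of the vertices. -/
def realRev (n : ℕ) : T.realSheaf n ≅ T.realSheaf n where
  hom := T.realMap Fin.rev
  inv := T.realMap Fin.rev
  hom_inv_id := (T.realMap_comp _ _).trans (by simpa using T.realMap_id)
  inv_hom_id := (T.realMap_comp _ _).trans (by simpa using T.realMap_id)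

theorem Simplex.comap_rev_rev {T : Trivialization 𝒰 X R} (w : T.Simplex n) :
    (w.comap Fin.rev).comap Fin.rev = w := by
  have h : (fun a : Fin (n + 1) => a.rev.rev) = fun a => a := funext Fin.rev_rev
  exact congrArg (fun f : Fin (n + 1) → Fin (n + 1) => w.comap f) h

/-- Reversal of the order of the vertices. -/
def simplexRev (n : ℕ) : T.Simplex n ≅ T.Simplex n where
  hom := ↾ fun w => w.comap Fin.rev
  inv := ↾ fun w => w.comap Fin.rev
  hom_inv_id := by ext w; exact w.comap_rev_rev
  inv_hom_id := by ext w; exact w.comap_rev_rev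

theorem rev_δ (a : Fin (n + 2)) :
    (fun b : Fin (n + 1) => Fin.rev ((SimplexCategory.δ a).toOrderHom b)) =
      fun b => (SimplexCategory.δ a.rev).toOrderHom b.rev :=
  funext fun b => Fin.rev_succAbove a b

theorem rev_σ (a : Fin (n + 1)) :
    (fun b : Fin (n + 2) => Fin.rev ((SimplexCategory.σ a).toOrderHom b)) =
      fun b => (SimplexCategory.σ a.rev).toOrderHom b.rev :=
  funext fun b => Fin.rev_predAbove a b

/-- The self-dual simplicial family of realizations. -/
def realSelfDual : SelfDualFamily J where
  toSimplicialFamily := T.realFamily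
  dualS :=
    { τ := T.simplexRev
      τ_δ := fun n a => by
        ext w
        exact congrArg (fun f : Fin (n + 1) → Fin (n + 2) => w.comap f) (rev_δ a)
      τ_σ := fun n a => by
        ext w
        exact congrArg (fun f : Fin (n + 2) → Fin (n + 1) => w.comap f) (rev_σ a)
      τ_zero := by
        ext w
        exact congrArg (fun f : Fin 1 → Fin 1 => w.comap f) 
          (Subsingleton.elim (α := Fin 1 → Fin 1) Fin.rev id) }
  dualH :=
    { τ := T.realRev
      τ_δ := fun n a => (T.realMap_comp _ _).trans
        ((congrArg (fun f => T.realMap f) (rev_δ a)).trans (T.realMap_comp _ _).symm)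
      τ_σ := fun n a => (T.realMap_comp _ _).trans
        ((congrArg (fun f => T.realMap f) (rev_σ a)).trans (T.realMap_comp _ _).symm)
      τ_zero := by
        ext1
        exact (congrArg (fun f : Fin 1 → Fin 1 => T.realMap f) 
          (Subsingleton.elim (α := Fin 1 → Fin 1) Fin.rev id)).trans
          T.realMap_id }
  τ_ζ n := ((presheafToSheaf J (Type u)).map_comp _ _).symm.trans
    ((presheafToSheaf J (Type u)).map_comp (T.realizationsIndex _)
      ((Functor.const Cᵒᵖ).map (T.simplexRev n).hom))

theorem realSelfDual_isInvolutive : T.realSelfDual.IsInvolutive := fun n =>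
  ⟨(T.simplexRev n).hom_inv_id, (T.realRev n).hom_inv_id⟩

end Trivialization

end MarkedActions

/-! ### The realizations form a hypercover refinement of the Čech simplicial family -/

section RealizationRefinement

variable {C : Type u} [SmallCategory C] {J : GrothendieckTopology C}

namespace Trivialization

variable {𝒰 : Cover J} {X : Sheaf J (Type u)} {R : 𝒰.I → Type u} (T : Trivialization 𝒰 X R)
variable {l m n : ℕ}

theorem Simplex.not_isEmptyObj {T : Trivialization 𝒰 X R} (w : T.Simplex n) :
    ¬ IsEmptyObj (∏ᶜ fun k => 𝒰.comp (w.1.idx k)) := by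
  obtain ⟨c, u, hc, -, v, -, -⟩ := w.2
  exact not_isEmptyObj_iff.2 ⟨c, Pi.lift v, hc⟩

theorem powerMap_proj {p q : SimplexCategoryᵒᵖ} (θ : p ⟶ q) (k : Fin (q.unop.len + 1)) :
    𝒰.power.map θ ≫ 𝒰.powerProj q k = 𝒰.powerProj p (θ.unop.toOrderHom k) := by
  simp [Cover.power, Cover.powerProj, cechNerveTerminalFrom]

/-- All the vertices of a realization. -/
def realVertices (n : SimplexCategoryᵒᵖ) : T.realSheaf n.unop.len ⟶ 𝒰.power.obj n :=
  Pi.lift fun k => T.realVertex k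

theorem realVertices_proj (n : SimplexCategoryᵒᵖ) (k : Fin (n.unop.len + 1)) :
    T.realVertices n ≫ 𝒰.powerProj n k = T.realVertex k :=
  limit.lift_π _ _

theorem realVertex_ζ (a : Fin (n + 1)) :
    T.realVertex a ≫ 𝒰.ζ = T.realIndex n ≫ (γ J).map (↾ fun w : T.Simplex n => w.1.idx a) :=
  T.realSheaf_hom_ext fun c p => by
    rw [← Category.assoc, realPt_vertex, p.2.comp_ζ, ← Category.assoc, realPt_index, cst_map]
    rfl

/-- The indices of a simplex. -/
def simplexIdx (n : SimplexCategoryᵒᵖ) : T.Simplex n.unop.len ⟶ 𝒰.nerve.obj n :=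
  ↾ fun w => ⟨w.1.idx, w.not_isEmptyObj⟩

/-- The morphism to the Čech simplicial family. -/
def realHom : SimplicialFamily.Hom T.realFamily 𝒰.cech where
  α := { app := T.simplexIdx }
  h :=
    { app := T.realVertices
      naturality := fun p q θ => Pi.hom_ext _ _ fun k => by
        have h₁ : (T.realMap θ.unop.toOrderHom ≫ T.realVertices q) ≫ 𝒰.powerProj q k =
            T.realVertex (θ.unop.toOrderHom k) := by
          rw [Category.assoc, realVertices_proj, realMap_vertex]
        have h₂ : (T.realVertices p ≫ 𝒰.power.map θ) ≫ 𝒰.powerProj q k =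
            T.realVertex (θ.unop.toOrderHom k) := by
          rw [Category.assoc, powerMap_proj, realVertices_proj]
        exact h₁.trans h₂.symm }
  comm := by
    refine NatTrans.ext (funext fun n => ?_)
    refine 𝒰.hom_ext_nerve n _ _ fun k => ?_
    have h₁ : (T.realVertices n ≫ 𝒰.cechζ.app n) ≫ (γ J).map (𝒰.nerveVertex n k) =
        T.realVertex k ≫ 𝒰.ζ :=
      (Category.assoc _ _ _).trans ((congrArg (T.realVertices n ≫ ·) (𝒰.cechζ_vertex n k)).trans
        ((Category.assoc _ _ _).symm.trans (congrArg (· ≫ 𝒰.ζ) (T.realVertices_proj n k))))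
    refine h₁.trans ((T.realVertex_ζ k).trans ?_)
    exact (congrArg (T.realIndex _ ≫ ·)
      ((γ J).map_comp (T.simplexIdx n) (𝒰.nerveVertex n k))).trans (Category.assoc _ _ _).symm

theorem Simplex.act_self {T : Trivialization 𝒰 X R} (w : T.Simplex n) (a : Fin (n + 1)) :
    w.1.act a a = Equiv.refl _ := by
  obtain ⟨c, u, hc, -, v, -, h⟩ := w.2
  ext r
  exact (T.leaf_injective (v a) hc (h a a r)).symm

theorem Simplex.ext_zero {T : Trivialization 𝒰 X R} {w w' : T.Simplex 0}
    (h : w.1.idx 0 = w'.1.idx 0) : w = w' := by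
  have hact := w.act_self 0
  have hact' := w'.act_self 0
  obtain ⟨⟨idx, act, mark, hr, hs⟩, hw⟩ := w
  obtain ⟨⟨idx', act', mark', hr', hs'⟩, hw'⟩ := w'
  have h0 (a : Fin (0 + 1)) : a = 0 := Subsingleton.elim (α := Fin 1) a 0
  obtain rfl : idx = idx' := funext fun a => by rw [h0 a]; exact h
  obtain rfl : act = act' := funext fun a => funext fun b => by
    obtain rfl := h0 a
    obtain rfl := h0 b
    exact hact.trans hact'.symm
  obtain rfl : mark = mark' := funext fun a => funext fun b => by
    obtain rfl := h0 a
    obtain rfl := h0 b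
    exact propext ⟨fun _ => hr' _, fun _ => hr _⟩
  rfl

theorem realHom_bijective_zero : Function.Bijective (T.realHom.α.app (op ⦋0⦌)) := by
  refine ⟨fun w w' h => Simplex.ext_zero (congrFun (congrArg Subtype.val h) 0), fun f => ?_⟩
  obtain ⟨c, v, hc⟩ := not_isEmptyObj_iff.1 (𝒰.nonempty (f.1 (0 : Fin 1)))
  refine ⟨⟨⟨fun _ => f.1 (0 : Fin 1), fun _ _ => Equiv.refl _, fun _ _ => True, fun _ => trivial,
    fun _ _ _ => trivial⟩, c, fun _ => v ≫ componentι _ _, hc, fun _ _ _ => rfl,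
    fun _ => v, fun _ => rfl, fun _ _ _ => rfl⟩, Subtype.ext (funext fun a => ?_)⟩
  rw [Subsingleton.elim (α := Fin 1) a 0]
  rfl

variable {T} in
theorem IsCoveringProjection.loc_realization (hT : T.IsCoveringProjection) {c : C}
    (u : Fin (n + 1) → ((rep J).obj c ⟶ 𝒰.U)) (M : Fin (n + 1) → Fin (n + 1) → Prop)
    (hr : ∀ a, M a a) (hs : ∀ a b, M a b → M b a) (hM : ∀ a b, M a b → u a = u b) :
    Loc J c fun d g => ∃ p : T.Realization n d, p.1.1.1.mark = M ∧
      ∀ a, p.1.2 a = (rep J).map g ≫ u a := by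
  refine (hT.loc_realizes u M hr hs hM).bind ?_
  rintro d g ⟨w, hw, h⟩
  refine Loc.of_not_bot fun hd => Loc.of_forall fun e k => ?_
  refine ⟨Realization.restrict ⟨(⟨w, d, _, hd, h⟩, _), h⟩ k, hw, fun a => ?_⟩
  rw [Functor.map_comp, Category.assoc]
  rfl

variable {T}

/-- For a single point there is no freedom: its mark is forced by reflexivity, and its index and
bijection by the point. So `H_0` is `U`. -/
theorem IsCoveringProjection.isIso_realVertex (hT : T.IsCoveringProjection) :
    IsIso (T.realVertex (0 : Fin (0 + 1))) := by
  refine isIso_of_pt _ (fun c x y h => T.realSheaf_pt_ext_zero h) fun c y => ?_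
  refine (hT.loc_realization (n := 0) (fun _ => y) (fun _ _ => True) (fun _ => trivial)
    (fun _ _ _ => trivial) fun _ _ _ => rfl).mono ?_
  rintro d g ⟨p, -, hp⟩
  exact ⟨T.realPt p, (T.realPt_vertex 0 p).trans (hp 0)⟩

theorem IsCoveringProjection.isIso_realVertices (hT : T.IsCoveringProjection) :
    IsIso (T.realVertices (op ⦋0⦌)) := by
  have h₁ := 𝒰.isIso_powerProj_zero
  have h₂ : IsIso (T.realVertices (op ⦋0⦌) ≫ 𝒰.powerProj (op ⦋0⦌) (0 : Fin (0 + 1))) := by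
    have := hT.isIso_realVertex
    have h := T.realVertices_proj (op ⦋0⦌) (0 : Fin (0 + 1))
    exact h ▸ this
  exact @IsIso.of_isIso_comp_right _ _ _ _ _ _ (𝒰.powerProj (op ⦋0⦌) (0 : Fin (0 + 1))) h₁ h₂

variable (T)

/-- The coskeleton of the simplicial object of realizations. -/
def realCosk (k n : ℕ) : Sheaf J (Type u) := ((SimplicialObject.cosk k).obj T.realObject) _⦋n⦌

/-- The projections of the coskeleton. -/
def realLeg (k n : ℕ) {x : SimplexCategory} (hx : x.len ≤ k) (θ : x ⟶ ⦋n⦌) :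
    T.realCosk k n ⟶ T.realSheaf x.len :=
  coskLeg T.realObject k n hx θ

/-- The unit of the coskeleton. -/
def realToCosk (k n : ℕ) : T.realSheaf n ⟶ T.realCosk k n := toCosk T.realObject k n

theorem realLeg_map {k n : ℕ} {x y : SimplexCategory} (hx : x.len ≤ k) (hy : y.len ≤ k)
    (θ : x ⟶ ⦋n⦌) (φ : y ⟶ x) :
    T.realLeg k n hx θ ≫ T.realMap φ.toOrderHom = T.realLeg k n hy (φ ≫ θ) :=
  coskLeg_map T.realObject k n hx hy θ φ

theorem realToCosk_leg {k n : ℕ} {x : SimplexCategory} (hx : x.len ≤ k) (θ : x ⟶ ⦋n⦌) :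
    T.realToCosk k n ≫ T.realLeg k n hx θ = T.realMap θ.toOrderHom :=
  toCosk_leg T.realObject k n hx θ

theorem realCosk_hom_ext {k n : ℕ} {A : Sheaf J (Type u)} {f g : A ⟶ T.realCosk k n}
    (h : ∀ (x : SimplexCategory) (hx : x.len ≤ k) (θ : x ⟶ ⦋n⦌),
      f ≫ T.realLeg k n hx θ = g ≫ T.realLeg k n hx θ) : f = g :=
  cosk_hom_ext T.realObject h

variable {T}

/-- The vertices of a point `z` of the coskeleton form a tuple of points of `U`, which locally has a
realization with any admissible marks. With the marks taken from the edges of `z`, the realization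
has the same vertices and edges as `z`, and these determine every leg. For `k = 0` the coskeleton
has no edges to be matched, whence the conditions `1 ≤ k`. -/
theorem IsCoveringProjection.loc_lift_cosk (hT : T.IsCoveringProjection) (k : ℕ) {c : C}
    (z : (rep J).obj c ⟶ T.realCosk k (k + 1))
    (e : ∀ a b : Fin (k + 2), a < b → 1 ≤ k → T.Realization 1 c)
    (he : ∀ a b hab hk, T.realPt (e a b hab hk) =
      z ≫ T.realLeg k (k + 1) (x := ⦋1⦌) hk (SimplexCategory.mkOfLe a b hab.le)) :
    Loc J c fun _ g => ∃ x, x ≫ T.realToCosk k (k + 1) = (rep J).map g ≫ z := by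
  let u (a : Fin (k + 2)) : (rep J).obj c ⟶ 𝒰.U :=
    z ≫ T.realLeg k (k + 1) (x := ⦋0⦌) (Nat.zero_le k) (⦋0⦌.const ⦋k + 1⦌ a) ≫
      T.realVertex (0 : Fin (0 + 1))
  have hleg {x : SimplexCategory} (hx : x.len ≤ k) (θ : x ⟶ ⦋k + 1⦌) (a : Fin (x.len + 1)) :
      z ≫ T.realLeg k (k + 1) hx θ ≫ T.realVertex a = u (θ.toOrderHom a) := by
    have h₁ : T.realLeg k (k + 1) hx θ ≫ T.realMap (m := 0) (fun _ => a) =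
        T.realLeg k (k + 1) (x := ⦋0⦌) (Nat.zero_le k) (⦋0⦌.const ⦋k + 1⦌ (θ.toOrderHom a)) :=
      T.realLeg_map hx (Nat.zero_le k) θ (⦋0⦌.const x a)
    have h₂ := T.realMap_vertex (m := 0) (fun _ => a) 0
    exact congrArg (z ≫ ·) ((congrArg (T.realLeg k (k + 1) hx θ ≫ ·) h₂.symm).trans
      ((Category.assoc _ _ _).symm.trans (congrArg (· ≫ T.realVertex (0 : Fin (0 + 1))) h₁)))
  have hu (a b hab hk) (i : Fin 2) : (e a b hab hk).1.2 i = u (![a, b] i) := by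
    refine (T.realPt_vertex (n := 1) i (e a b hab hk)).symm.trans ?_
    rw [he]
    refine (Category.assoc _ _ _).trans
      ((hleg (x := ⦋1⦌) hk (SimplexCategory.mkOfLe a b hab.le) i).trans (congrArg u ?_))
    fin_cases i <;> rfl
  -- The marks that the edges of `z` prescribe for `a < b`. The realization below gets the reflexive
  -- symmetric closure, which still relates only equal points.
  let N (a b : Fin (k + 2)) : Prop := ∃ hab hk, (e a b hab hk).1.1.1.mark 0 1
  have hN (a b) (h : N a b) : u a = u b := by
    obtain ⟨hab, hk, h⟩ := h
    exact (hu a b hab hk 0).symm.trans (((e a b hab hk).2.1 0 1 h).trans (hu a b hab hk 1))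
  refine (hT.loc_realization u (fun a b => a = b ∨ N a b ∨ N b a) (fun _ => Or.inl rfl)
    (fun a b h => h.imp Eq.symm Or.symm) ?_).mono ?_
  · rintro a b (rfl | h | h)
    · rfl
    · exact hN _ _ h
    · exact (hN _ _ h).symm
  rintro d g ⟨p, hm, hp⟩
  refine ⟨T.realPt p, ?_⟩
  by_cases hd : ⊥ ∈ J d
  · exact pt_ext_of_bot hd
  have hv {x : SimplexCategory} (hx : x.len ≤ k) (θ : x ⟶ ⦋k + 1⦌) (a : Fin (x.len + 1)) :
      (T.realPt p ≫ T.realMap θ.toOrderHom) ≫ T.realVertex a =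
        ((rep J).map g ≫ z ≫ T.realLeg k (k + 1) hx θ) ≫ T.realVertex a := by
    rw [realPt_map, realPt_vertex]
    simp only [Category.assoc]
    exact (hp _).trans (congrArg _ (hleg hx θ a).symm)
  -- The realization and `z` have the same edges. For `a = b` both edges are degenerate on the same
  -- vertex; for `a < b` the marks agree by the choice of `N`.
  have hE (hk : 1 ≤ k) (a b : Fin (k + 2)) (hab : a ≤ b) :
      T.realPt p ≫ T.realMap (m := 1) (SimplexCategory.mkOfLe a b hab).toOrderHom =
        (rep J).map g ≫ z ≫
          T.realLeg k (k + 1) (x := ⦋1⦌) hk (SimplexCategory.mkOfLe a b hab) := by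
    obtain rfl | hlt := hab.eq_or_lt
    · have h₀ := T.realSheaf_pt_ext_zero
        (hv (x := ⦋0⦌) (Nat.zero_le k) (⦋0⦌.const ⦋k + 1⦌ a) (0 : Fin 1))
      have h₁ : (⦋1⦌.const ⦋0⦌ 0) ≫ ⦋0⦌.const ⦋k + 1⦌ a = SimplexCategory.mkOfLe a a hab := by
        ext i
        fin_cases i <;> rfl
      have h₃ := T.realLeg_map (x := ⦋0⦌) (y := ⦋1⦌) (Nat.zero_le k) hk (⦋0⦌.const ⦋k + 1⦌ a)
        (⦋1⦌.const ⦋0⦌ 0)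
      rw [h₁] at h₃
      have h₄ := T.realMap_comp (m := 0) (l := 1) (⦋0⦌.const ⦋k + 1⦌ a).toOrderHom
        (⦋1⦌.const ⦋0⦌ 0).toOrderHom
      have h₅ : (fun i => (⦋0⦌.const ⦋k + 1⦌ a).toOrderHom ((⦋1⦌.const ⦋0⦌ 0).toOrderHom i)) =
          (SimplexCategory.mkOfLe a a hab).toOrderHom :=
        congrArg (fun φ : ⦋1⦌ ⟶ ⦋k + 1⦌ => (φ.toOrderHom : Fin 2 → Fin (k + 2))) h₁
      have h₂ := congrArg (· ≫ T.realMap (m := 1) (⦋1⦌.const ⦋0⦌ 0).toOrderHom) h₀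
      rw [← h₃, ← h₅]
      refine (congrArg (T.realPt p ≫ ·) h₄.symm).trans ((Category.assoc _ _ _).symm.trans
        (h₂.trans ?_))
      simp only [Category.assoc]
    · refine (T.realPt_map p _).trans (Eq.trans ?_ (congrArg ((rep J).map g ≫ ·) (he a b hlt hk)))
      refine Eq.trans ?_ (T.rep_map_realPt _ g).symm
      congr 1
      refine Realization.ext hd (fun i => ?_) fun i j hij => ?_
      · refine (hp _).trans (congrArg ((rep J).map g ≫ ·) (Eq.trans ?_ (hu a b hlt hk i).symm))
        refine congrArg u ?_
        fin_cases i <;> rfl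
      · obtain ⟨rfl, rfl⟩ := (by decide : ∀ i j : Fin 2, i < j → i = 0 ∧ j = 1) i j hij
        change p.1.1.1.mark a b ↔ (e a b hlt hk).1.1.1.mark 0 1
        rw [hm]
        refine ⟨?_, fun h => Or.inr (Or.inl ⟨hlt, hk, h⟩)⟩
        rintro (h | ⟨_, _, h⟩ | ⟨h, _⟩)
        · exact absurd h hlt.ne
        · exact h
        · exact absurd h hlt.asymm
  -- A leg of any degree is determined by its vertices and edges, and its edges are again edges of
  -- `z`, possibly degenerate when `θ` is not injective.
  refine T.realCosk_hom_ext fun x hx θ => ?_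
  rw [Category.assoc, realToCosk_leg, Category.assoc]
  refine T.realSheaf_pt_ext (hv hx θ) fun a b hab => ?_
  have hk : 1 ≤ k := by
    have h₁ := b.2
    have h₂ : a.1 < b.1 := hab
    omega
  have h₁ : SimplexCategory.mkOfLe a b hab.le ≫ θ =
      SimplexCategory.mkOfLe _ _ (θ.toOrderHom.monotone hab.le) := by
    ext i
    fin_cases i <;> rfl
  have h₂ := hE hk _ _ (θ.toOrderHom.monotone hab.le)
  rw [← h₁, ← T.realLeg_map (y := ⦋1⦌) hx hk] at h₂
  have h₃ : (![a, b] : Fin 2 → Fin (x.len + 1)) =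
      (SimplexCategory.mkOfLe a b hab.le).toOrderHom := by
    funext i
    fin_cases i <;> rfl
  rw [h₃, Category.assoc]
  refine Eq.trans (congrArg (T.realPt p ≫ ·) ?_) (h₂.trans ?_)
  · exact T.realMap_comp _ _
  · simp only [Category.assoc]

theorem IsCoveringProjection.epi_realToCosk (hT : T.IsCoveringProjection) (k : ℕ) :
    Epi (T.realToCosk k (k + 1)) := by
  refine epi_of_loc_lift _ fun c z => ?_
  -- The side conditions stand inside the local statement so that all pairs can be treated on one
  -- common covering sieve.
  have h (a b : Fin (k + 2)) : Loc J c fun d g => ∀ (hab : a < b) (hk : 1 ≤ k),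
      ∃ p : T.Realization 1 d, (rep J).map g ≫ z ≫
        T.realLeg k (k + 1) (x := ⦋1⦌) hk (SimplexCategory.mkOfLe a b hab.le) = T.realPt p := by
    by_cases hab : a < b
    · by_cases hk : 1 ≤ k
      · exact (T.loc_realPt (n := 1) (z ≫ T.realLeg k (k + 1) (x := ⦋1⦌) hk
          (SimplexCategory.mkOfLe a b hab.le))).mono fun d g hg _ _ => hg
      · exact Loc.of_forall fun d g _ hk' => absurd hk' hk
    · exact Loc.of_forall fun d g hab' => absurd hab' hab
  refine (Loc.forall_fin fun a => Loc.forall_fin fun b => h a b).bind ?_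
  intro d g hg
  choose e he using hg
  refine (hT.loc_lift_cosk k ((rep J).map g ≫ z) e fun a b hab hk => ?_).mono ?_
  · exact (he a b hab hk).symm.trans (Category.assoc _ _ _).symm
  · rintro d' k' ⟨x, hx⟩
    exact ⟨x, by rw [hx, Functor.map_comp, Category.assoc]⟩

variable (T) in
/-- The hypercover refinement of realizations. -/
def realRefinement (hT : T.IsCoveringProjection) : HypercoverRefinement 𝒰 where
  toSelfDualFamily := T.realSelfDual
  hom := T.realHom
  bijective_zero := T.realHom_bijective_zero
  isIso_zero := hT.isIso_realVertices
  epi_cosk := hT.epi_realToCosk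

end Trivialization

end RealizationRefinement

/-! ### The descent datum of a covering projection, and condition G -/

section DescentOfCovering

variable {C : Type u} [SmallCategory C] {J : GrothendieckTopology C}

namespace HypercoverRefinement

variable {𝒰 : Cover J} (X : HypercoverRefinement 𝒰) {R : 𝒰.I → Type u}

/-- If the action of a trivialization over the 1-simplexes of a hypercover refinement is given by
bijections, then these form a consistent descent datum, which the trivialization induces. -/
theorem exists_descentDatum {Y : Sheaf J (Type u)} (T : Trivialization 𝒰 Y R)
    (h : ∀ ⦃i j : X.S _⦋0⦌⦄ (ℓ : SSet.Edge i j), ∃ s : R (X.idx i) ≃ R (X.idx j), ∀ r,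
      (X.d₁ ℓ ≫ X.toComp i) ≫ T.leaf _ r = (X.d₀ ℓ ≫ X.toComp j) ≫ T.leaf _ (s r)) :
    ∃ s : SetDescentDatum X.S fun i => R (X.idx i),
      s.IsConsistent X.toSimplicialFamily ∧ T.Induces X (s.induced X.toSelfDualFamily) := by
  choose s hs using h
  have hs' {A : Sheaf J (Type u)} {i j : X.S _⦋0⦌} (ℓ : SSet.Edge i j) (x : A ⟶ X.arr ℓ)
      {y : A ⟶ X.vert i} {z : A ⟶ X.vert j} (hy : x ≫ X.d₁ ℓ = y) (hz : x ≫ X.d₀ ℓ = z)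
      (r : R (X.idx i)) :
      (y ≫ X.toComp i) ≫ T.leaf _ r = (z ≫ X.toComp j) ≫ T.leaf _ (s ℓ r) := by
    subst hy hz
    simpa only [Category.assoc] using congrArg (x ≫ ·) (hs ℓ r)
  refine ⟨⟨fun ℓ => s ℓ, fun i => ?_, fun {i j k ℓ r t} w => ?_⟩, fun i j ℓ t hf => ?_,
    (X.induces_iff T _).2 fun i j ℓ r => hs ℓ r⟩
  -- Each of the three conditions is an equality of bijections, so one point at a non-empty stage
  -- suffices. It is taken in `(H_0)_i`, `(H_2)_w` and `(H_1)_ℓ` respectively; the action is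
  -- transported along the degeneracy, the faces and the morphism of spans, and injectivity of the
  -- leaves concludes.
  · obtain ⟨c, x, hc⟩ := not_isEmptyObj_iff.1 (X.nonempty (op ⦋0⦌) i)
    change (rep J).obj c ⟶ X.vert i at x
    ext r
    refine T.leaf_injective (x ≫ X.toComp i) hc (hs' _ (x ≫ X.s₀ i) ?_ ?_ r).symm
    · rw [Category.assoc, X.s₀_d₁, Category.comp_id]
    · rw [Category.assoc, X.s₀_d₀, Category.comp_id]
  · obtain ⟨c, x, hc⟩ := not_isEmptyObj_iff.1 (X.nonempty (op ⦋2⦌) w.simplex)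
    change (rep J).obj c ⟶ X.tri w at x
    ext a
    refine T.leaf_injective ((x ≫ X.face₁ w ≫ X.d₀ t) ≫ X.toComp k) hc ?_
    have h₁ := hs' _ (x ≫ X.face₁ w) (Category.assoc _ _ _) (Category.assoc _ _ _) a
    have h₂ := hs' _ (x ≫ X.face₂ w) (Category.assoc _ _ _) (Category.assoc _ _ _) a
    have h₃ := hs' _ (x ≫ X.face₀ w) (Category.assoc _ _ _) (Category.assoc _ _ _) (s ℓ a)
    rw [X.face₂_d₁, X.face₂_d₀] at h₂
    rw [← X.face₁_d₀] at h₃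
    exact h₁.symm.trans (h₂.trans h₃)
  · obtain ⟨f, hf₁, hf₀⟩ := hf
    obtain ⟨c, x, hc⟩ := not_isEmptyObj_iff.1 (X.nonempty (op ⦋1⦌) ℓ.edge)
    change (rep J).obj c ⟶ X.arr ℓ at x
    ext r
    refine T.leaf_injective ((x ≫ X.d₀ ℓ) ≫ X.toComp j) hc ?_
    exact (hs' ℓ x rfl rfl r).symm.trans (hs' t (x ≫ f) ((Category.assoc _ _ _).trans
      (congrArg (x ≫ ·) hf₁)) ((Category.assoc _ _ _).trans (congrArg (x ≫ ·) hf₀)) r)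

end HypercoverRefinement

namespace Trivialization

variable {𝒰 : Cover J} {X : Sheaf J (Type u)} {R : 𝒰.I → Type u} (T : Trivialization 𝒰 X R)
variable {m n : ℕ}

theorem loc_arrι {i j : T.realFamily.S _⦋0⦌} (ℓ : SSet.Edge i j) {c : C}
    (x : (rep J).obj c ⟶ T.realFamily.arr ℓ) :
    Loc J c fun d g => ∃ p : T.Realization 1 d, (rep J).map g ≫ x ≫ T.realFamily.arrι ℓ =
      T.realPt p ∧ p.1.1 = ℓ.edge := by
  refine (T.loc_realPt (n := 1) (x ≫ T.realFamily.arrι ℓ)).bind ?_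
  rintro d g ⟨p, hp⟩
  refine Loc.of_not_bot fun hd => Loc.of_forall fun e k => ?_
  refine ⟨p.restrict k, ?_, ?_⟩
  · rw [Functor.map_comp, ← T.rep_map_realPt, ← hp]
    exact Category.assoc _ _ _
  · refine cst_injective hd ((T.realPt_index p).symm.trans ?_)
    rw [← hp]
    refine (Category.assoc _ _ _).trans ((congrArg ((rep J).map g ≫ ·)
      ((Category.assoc _ _ _).trans ((congrArg (x ≫ ·) (T.realFamily.arrι_index ℓ)).trans
        (comp_cst _ _)))).trans (comp_cst _ _))

/-- The inclusion of the component of a vertex, as a map to the cover. -/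
def vertU (i : T.realFamily.S _⦋0⦌) : T.realFamily.vert i ⟶ 𝒰.U :=
  T.realFamily.vertι i ≫ T.realVertex (0 : Fin (0 + 1))

theorem vertU_pt_injective {i : T.realFamily.S _⦋0⦌} {c : C}
    {x y : (rep J).obj c ⟶ T.realFamily.vert i} (h : x ≫ T.vertU i = y ≫ T.vertU i) : x = y := by
  rw [← cancel_mono (T.realFamily.vertι i)]
  exact T.realSheaf_pt_ext_zero ((Category.assoc _ _ _).trans (h.trans (Category.assoc _ _ _).symm))

/-- Deleting one vertex of an edge leaves the other, which is `a.rev`. So `d_1` reads vertex `0` and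
`d_0` reads vertex `1`. -/
theorem realFamily_δ_vertex (a : Fin 2) :
    T.realFamily.H.δ (n := 0) a ≫ T.realVertex (0 : Fin (0 + 1)) = T.realVertex (n := 1) a.rev := by
  refine (T.realMap_vertex (m := 0) (n := 1) _ 0).trans (congrArg _ ?_)
  fin_cases a <;> rfl

theorem comp_vertU {i j : T.realFamily.S _⦋0⦌} {ℓ : SSet.Edge i j} {c : C}
    {x : (rep J).obj c ⟶ T.realFamily.arr ℓ} {p : T.Realization 1 c}
    (h : x ≫ T.realFamily.arrι ℓ = T.realPt p) :
    (x ≫ T.realFamily.d₁ ℓ) ≫ T.vertU i = p.1.2 0 ∧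
      (x ≫ T.realFamily.d₀ ℓ) ≫ T.vertU j = p.1.2 1 := by
  have key {k : T.realFamily.S _⦋0⦌} {d : T.realFamily.arr ℓ ⟶ T.realFamily.vert k} {a : Fin 2}
      (hd : d ≫ T.realFamily.vertι k = T.realFamily.arrι ℓ ≫ T.realFamily.H.δ (n := 0) a) :
      (x ≫ d) ≫ T.vertU k = p.1.2 a.rev := by
    have h₁ : d ≫ T.vertU k = T.realFamily.arrι ℓ ≫ T.realVertex (n := 1) a.rev :=
      (Category.assoc _ _ _).symm.trans
        ((congrArg (· ≫ T.realVertex (0 : Fin (0 + 1))) hd).trans ((Category.assoc _ _ _).trans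
          (congrArg (T.realFamily.arrι ℓ ≫ ·) (T.realFamily_δ_vertex a))))
    exact (Category.assoc _ _ _).trans ((congrArg (x ≫ ·) h₁).trans
      ((Category.assoc _ _ _).symm.trans ((congrArg (· ≫ T.realVertex (n := 1) a.rev) h).trans
        (T.realPt_vertex _ p))))
  exact ⟨key (T.realFamily.d₁_ι ℓ), key (T.realFamily.d₀_ι ℓ)⟩

/-- This is what the marks are for: the mark of the pair `(0, 1)` on a degenerate edge is the mark
of a vertex with itself, which always holds, so the two points of any realization of that edge are
equal. -/
theorem realFamily_d₁_id (i : T.realFamily.S _⦋0⦌) :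
    T.realFamily.d₁ (SSet.Edge.id i) = T.realFamily.d₀ (SSet.Edge.id i) := by
  refine hom_ext_pt fun c x => pt_ext ((T.loc_arrι _ x).mono ?_)
  rintro d g ⟨p, hp, hi⟩
  obtain ⟨h₁, h₀⟩ := T.comp_vertU ((Category.assoc _ _ _).trans hp)
  rw [← Category.assoc, ← Category.assoc]
  refine T.vertU_pt_injective (h₁.trans (Eq.trans ?_ h₀.symm))
  refine p.2.1 0 1 ?_
  rw [hi]
  exact MarkedAction.mark_refl _ _

/-- The simplex `(i, j, i)` on the 1-simplex `w` from `i` to `j`. -/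
def Simplex.double {T : Trivialization 𝒰 X R} (w : T.Simplex 1) : T.Simplex 2 :=
  w.comap ![0, 1, 0]

theorem Simplex.comap_congr {T : Trivialization 𝒰 X R} (w : T.Simplex n)
    {f g : Fin (m + 1) → Fin (n + 1)} (h : ∀ a, f a = g a) : w.comap f = w.comap g :=
  congrArg _ (funext h)

/-- Reindexing `ℓ` along `0, 1, 0` and then along the faces gives the sequences `0, 1`, then `1, 0`,
then `0, 0`: the edge, its reversal, and a degenerate edge. -/
theorem exists_compStruct_opp {i j : T.simplexes _⦋0⦌} (ℓ : SSet.Edge i j) :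
    Nonempty (SSet.Edge.CompStruct ℓ (T.realSelfDual.opp ℓ) (SSet.Edge.id i)) := by
  refine ⟨SSet.Edge.CompStruct.mk (Simplex.double (T := T) ℓ.edge) ?_ ?_ ?_⟩
  · refine Simplex.comap_congr (m := 1) (n := 1) (f := fun a => ![0, 1, 0]
      ((SimplexCategory.δ 2).toOrderHom a)) (g := fun a => a) ℓ.edge fun a => ?_
    fin_cases a <;> rfl
  · refine Simplex.comap_congr (m := 1) (n := 1) (f := fun a => ![0, 1, 0]
      ((SimplexCategory.δ 0).toOrderHom a)) (g := Fin.rev) ℓ.edge fun a => ?_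
    fin_cases a <;> rfl
  -- Writing `i` as a face of `ℓ` makes both sides reindexings of the one simplex `ℓ.edge`.
  · have h : (SSet.Edge.id i).edge = T.simplexes.σ 0 (T.simplexes.δ 1 ℓ.edge) :=
      congrArg (T.simplexes.σ 0) ℓ.src_eq.symm
    refine Eq.trans ?_ h.symm
    refine Simplex.comap_congr (m := 1) (n := 1) (f := fun a => ![0, 1, 0]
      ((SimplexCategory.δ 1).toOrderHom a)) (g := fun a => (SimplexCategory.δ 1).toOrderHom
        ((SimplexCategory.σ 0).toOrderHom a)) ℓ.edge fun a => ?_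
    fin_cases a <;> rfl

theorem realSelfDual_conditionG : T.realSelfDual.ConditionG :=
  fun i _ ℓ =>
  ⟨SSet.Edge.id i, T.exists_compStruct_opp ℓ, T.realFamily_d₁_id i⟩

variable {T} in
theorem IsCoveringProjection.toComp_ι (hT : T.IsCoveringProjection) (i : T.realFamily.S _⦋0⦌) :
    (T.realRefinement hT).toComp i ≫ componentι 𝒰.ζ _ = T.vertU i :=
  ((T.realRefinement hT).toComp_ι i).trans
    (congrArg (T.realFamily.vertι i ≫ ·) (T.realVertices_proj (op ⦋0⦌) (0 : Fin 1)))

variable {T} in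
theorem IsCoveringProjection.exists_action (hT : T.IsCoveringProjection)
    ⦃i j : (T.realRefinement hT).S _⦋0⦌⦄ (ℓ : SSet.Edge i j) :
    ∃ s : R ((T.realRefinement hT).idx i) ≃ R ((T.realRefinement hT).idx j), ∀ r,
      ((T.realRefinement hT).d₁ ℓ ≫ (T.realRefinement hT).toComp i) ≫ T.leaf _ r =
        ((T.realRefinement hT).d₀ ℓ ≫ (T.realRefinement hT).toComp j) ≫ T.leaf _ (s r) := by
  -- This makes `i` and `j` the faces of `w` by definition. The bijection is the one stored in `w`
  -- from vertex `0` to vertex `1`, with these vertices left in the form of face operators so that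
  -- the types match those of the indices of `i` and `j`.
  obtain ⟨w, rfl, rfl⟩ := ℓ
  refine ⟨(show T.Simplex 1 from w).1.act ((SimplexCategory.δ (1 : Fin 2)).toOrderHom 0)
    ((SimplexCategory.δ (0 : Fin 2)).toOrderHom 0), fun r => ?_⟩
  refine hom_ext_pt fun c x => pt_ext ((T.loc_arrι _ x).mono ?_)
  rintro d g ⟨⟨⟨w, u⟩, hu⟩, hp, rfl⟩
  obtain ⟨h₁, h₀⟩ := T.comp_vertU ((Category.assoc _ _ _).trans hp)
  obtain ⟨_, v, hv, h⟩ := hu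
  have e₁ : ((rep J).map g ≫ x ≫ (T.realRefinement hT).d₁ _) ≫
      (T.realRefinement hT).toComp _ = v 0 := by
    refine component_hom_ext _ _ ((Category.assoc _ _ _).trans
      ((congrArg (_ ≫ ·) (hT.toComp_ι _)).trans (Eq.trans ?_ (hv 0).symm)))
    exact (congrArg (· ≫ T.vertU _) (Category.assoc _ _ _).symm).trans h₁
  have e₀ : ((rep J).map g ≫ x ≫ (T.realRefinement hT).d₀ _) ≫
      (T.realRefinement hT).toComp _ = v 1 := by
    refine component_hom_ext _ _ ((Category.assoc _ _ _).trans
      ((congrArg (_ ≫ ·) (hT.toComp_ι _)).trans (Eq.trans ?_ (hv 1).symm)))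
    exact (congrArg (· ≫ T.vertU _) (Category.assoc _ _ _).symm).trans h₀
  have := (congrArg (· ≫ T.leaf _ r) e₁).trans ((h 0 1 r).trans
    (congrArg (· ≫ T.leaf _ _) e₀.symm))
  refine Eq.trans ?_ (this.trans ?_)
  · simp only [Category.assoc]
  · simp only [Category.assoc]
    rfl

end Trivialization

end DescentOfCovering

end

end CoveringProj

theorem mainTheorem1 {C : Type u} [SmallCategory C] (J : GrothendieckTopology C)
    (𝒰 : CoveringProj.Cover J) (R : 𝒰.I → Type u) :
    (∀ (X : Sheaf J (Type u)) (T : CoveringProj.Trivialization 𝒰 X R),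
      T.IsCoveringProjection →
        ∃ H : CoveringProj.HypercoverRefinement 𝒰,
          H.IsInvolutive ∧ H.ConditionG ∧
          ∃ s : CoveringProj.SetDescentDatum H.S fun i => R (H.idx i),
            s.IsConsistent H.toSimplicialFamily ∧
              T.Induces H (s.induced H.toSelfDualFamily)) ∧
    (∀ (H : CoveringProj.HypercoverRefinement 𝒰)
      (s : CoveringProj.SetDescentDatum H.S fun i => R (H.idx i)),
      s.IsConsistent H.toSimplicialFamily →
        (∃ (X : Sheaf J (Type u)) (T : CoveringProj.Trivialization 𝒰 X R),
          T.IsCoveringProjection ∧ T.Induces H (s.induced H.toSelfDualFamily)) ∧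
        (∀ (X X' : Sheaf J (Type u)) (T : CoveringProj.Trivialization 𝒰 X R)
          (T' : CoveringProj.Trivialization 𝒰 X' R),
          T.Induces H (s.induced H.toSelfDualFamily) →
          T'.Induces H (s.induced H.toSelfDualFamily) →
            ∃! e : X ≅ X', ∀ i, (T.θ i).hom ≫ prod.map e.hom (𝟙 (𝒰.comp i)) = (T'.θ i).hom)) := by
  refine ⟨fun X T hT => ?_, fun H s _ => ⟨?_, fun X X' T T' h h' => ?_⟩⟩
  · obtain ⟨s, hs, h⟩ := (T.realRefinement hT).exists_descentDatum T hT.exists_action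
    exact ⟨T.realRefinement hT, T.realSelfDual_isInvolutive, T.realSelfDual_conditionG, s, hs, h⟩
  · exact H.exists_covering_projection s
  · exact H.existsUnique_iso_of_induces s h h'
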